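/- For $\lambda\in\mathbb{R}$ and $0<\alpha\le 1$ let $L(\lambda,\alpha,s)$ be the Lerch zeta-function, $L(\lambda,\alpha,s)=\sum_{n\ge0}e^{2\pi i\lambda n}(n+\alpha)^{-s}$ for $\Re s>0$ if $\lambda\notin\mathbb{Z}$, and for $\Re s>1$ if $\lambda\in\mathbb{Z}$, continued analytically to $\mathbb{C}\setminus\{1\}$ in the latter case (the Hurwitz zeta-function). Let $S$ be the set of all $\alpha\in(0,1]$ such that (1) the numbers $\log(n+\alpha)$, $n\ge0$, are linearly independent over $\mathbb{Q}$; and (2) there are constants $\Omega(\alpha)>0$ and $X(\alpha)$ such that for all $X\ge X(\alpha)$, all $N$, all integers $0\le n_1,\dots,n_N\le X$ and all $\epsilon_1,\dots,\epsilon_N\in\{1,-1\}$ with $\sum_{j=1}^N\epsilon_j\log(n_j+\alpha)\ne0$ one has $\bigl|\sum_{j=1}^N\epsilon_j\log(n_j+\alpha)\bigr|\ge X^{-\Omega(\alpha)N^2}$. Write $|dz|=(2\pi)^{-1}dx\,dy$ on $\mathbb{C}$, $\psi_z(w)=e^{i\Re(z\overline{w})}$ and $\tilde f(z)=\int_{\mathbb{C}}f(w)\psi_z(w)|dw|$.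 Let $\Lambda$ be the class of all $f\colon\mathbb{C}\to\mathbb{C}$ with $f,\tilde f\in L^1(\mathbb{C})\cap L^\infty(\mathbb{C})$ and $f(z)=\int_{\mathbb{C}}\tilde f(w)\psi_{-z}(w)|dw|$ for all $z\in\mathbb{C}$. For $\sigma>1/2$ let $M_\sigma(\,\cdot\,;\alpha)$ be the non-negative continuous density with respect to $|dz|$ of the infinite convolution $\phi_0*\phi_1*\cdots$ (the weak limit of $\phi_0*\cdots*\phi_n$ as $n\to\infty$), where $\phi_n$ is the uniform probability measure on the circle $|z|=(n+\alpha)^{-\sigma}$; this density exists and is unique. Theorem. Let $\lambda\in\mathbb{R}$, $\alpha\in S$, $\sigma_1>0$, and let $\theta,\delta>0$ with $\theta+\delta<1/4$. There exist $T_0=T_0(\alpha,\theta,\delta)>0$, depending only on $\alpha,\theta,\delta$, and $C=C(\lambda,\sigma_1)>0$, depending only on $\lambda,\sigma_1$, such that for all $T\ge T_0$, all $\sigma\in[1/2+(\log T)^{-\theta},\sigma_1]$ and all $\Phi\in\Lambda$, \[\Bigl|\frac1T\int_0^T\Phi(L(\lambda,\alpha,\sigma+it))\,dt-\int_{\mathbb{C}}\Phi(z)M_\sigma(z;\alpha)|dz|\Bigr|\le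 C\Bigl(\exp\bigl(-\tfrac12(\log T)^{\theta/2}\bigr)\int_{\Omega}|\tilde\Phi(z)||dz|+\int_{\mathbb{C}\setminus\Omega}|\tilde\Phi(z)||dz|\Bigr),\] where $\Omega=\{x+iy\in\mathbb{C}: |x|\le(\log T)^\delta,\ |y|\le(\log T)^\delta\}$. -/

import Mathlib

namespace LerchMean

open MeasureTheory Filter Topology

/-- The Lerch zeta-function `L(lam, α, s)` on the half-plane `Re s > 0` (for `0 < α ≤ 1`, `lam` real).
For `lam ∉ ℤ` it is the sum `∑_{n ≥ 0} e^{2πi lam n} (n + α)^{-s}`, which converges (conditionally,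
hence the limit of partial sums) for `Re s > 0`.
For `lam ∈ ℤ` it is the (analytically continued) Hurwitz zeta-function; Mathlib's `hurwitzZeta`
is the continuation of `∑_{n ≥ 0} (n + α)^{-s}` for `0 < α ≤ 1` (the class of `α = 1` in `ℝ/ℤ`
gives the Riemann zeta-function `∑_{n ≥ 0} (n + 1)^{-s}`). -/
noncomputable def lerchZeta (lam α : ℝ) (s : ℂ) : ℂ :=
  open Classical in
  if ∃ k : ℤ, lam = k then
    HurwitzZeta.hurwitzZeta (α : UnitAddCircle) s
  else
    limUnder atTop fun N : ℕ => ∑ n ∈ Finset.range N,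
      Complex.exp (2 * Real.pi * Complex.I * lam * n) / ((n : ℂ) + (α : ℂ)) ^ s

/-- The admissible set `S ⊆ (0, 1]`. The threshold for `X` in the spacing condition depends on `α`
only; it is uniform in the number `N` of terms. -/
def admissibleSet : Set ℝ :=
  {α | (0 < α ∧ α ≤ 1) ∧
    LinearIndependent ℚ (fun n : ℕ => Real.log (n + α)) ∧
    ∃ Ω : ℝ, 0 < Ω ∧ ∀ᶠ X : ℝ in atTop,
      ∀ (N : ℕ) (n : Fin N → ℕ) (ε : Fin N → ℝ),
        (∀ j, (n j : ℝ) ≤ X) → (∀ j, ε j = 1 ∨ ε j = -1) →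
        ∑ j, ε j * Real.log (n j + α) ≠ 0 →
        X ^ (-(Ω * (N : ℝ) ^ 2)) ≤ |∑ j, ε j * Real.log (n j + α)|}

/-- The measure `|dz| = (2π)⁻¹ dx dy` on `ℂ`. -/
noncomputable def dz : Measure ℂ := ENNReal.ofReal (2 * Real.pi)⁻¹ • (volume : Measure ℂ)

/-- The additive character `ψ_z(w) = exp(i Re(z w̄))`. -/
noncomputable def psi (z w : ℂ) : ℂ :=
  Complex.exp (Complex.I * ((z * (starRingEnd ℂ) w).re : ℂ))

/-- The Fourier transform `f̃(z) = ∫ f(w) ψ_z(w) |dw|`. -/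
noncomputable def fourierT (f : ℂ → ℂ) (z : ℂ) : ℂ := ∫ w, f w * psi z w ∂dz

/-- The class `Λ`: `f` and `f̃` lie in `L¹ ∩ L^∞`, and Fourier inversion holds at every point. -/
structure ClassLambda (f : ℂ → ℂ) : Prop where
  memL1 : MemLp f 1 dz
  memLinf : MemLp f ⊤ dz
  fourier_memL1 : MemLp (fourierT f) 1 dz
  fourier_memLinf : MemLp (fourierT f) ⊤ dz
  inversion : ∀ z : ℂ, f z = ∫ w, fourierT f w * psi (-z) w ∂dz

/-- The equidistribution on the circle `|z| = r`: the image of normalized Haar measure on `ℝ/ℤ`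
under `x ↦ r e^{2πix}`. -/
noncomputable def circleEquidist (r : ℝ) : ProbabilityMeasure ℂ :=
  ⟨(AddCircle.haarAddCircle : Measure UnitAddCircle).map
      (fun x => (r : ℂ) * (AddCircle.toCircle x : ℂ)),
    Measure.isProbabilityMeasure_map (by
      have h : Continuous fun x : UnitAddCircle => (r : ℂ) * (AddCircle.toCircle x : ℂ) :=
        continuous_const.mul (continuous_subtype_val.comp AddCircle.continuous_toCircle)
      exact h.measurable.aemeasurable)⟩

/-- The finite convolution `φ_0 ∗ φ_1 ∗ ⋯ ∗ φ_n`, where `φ_k` is the equidistribution on the circle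
`|z| = (k + α)^{-σ}`. -/
noncomputable def partialConv (σ α : ℝ) : ℕ → ProbabilityMeasure ℂ
  | 0 => circleEquidist (((0 : ℕ) + α) ^ (-σ))
  | n + 1 =>
    ⟨Measure.conv (partialConv σ α n : Measure ℂ)
        (circleEquidist ((((n + 1 : ℕ) : ℝ) + α) ^ (-σ)) : Measure ℂ), inferInstance⟩

/-- `M` is the continuous density, with respect to `|dz|`, of the infinite convolution
`φ_0 ∗ φ_1 ∗ ⋯` (the weak limit of the finite convolutions). Such an `M` is unique. -/
structure IsLimitDensity (σ α : ℝ) (M : ℂ → ℝ) : Prop where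
  continuous : Continuous M
  nonneg : ∀ z, 0 ≤ M z
  isLimit : ∃ φ : ProbabilityMeasure ℂ, Tendsto (partialConv σ α) atTop (𝓝 φ) ∧
    (φ : Measure ℂ) = dz.withDensity (fun z => ENNReal.ofReal (M z))

/-- The density function `M_σ(z; α)`, i.e. the function `M` with `IsLimitDensity σ α M`
(which exists for `σ > 1/2` and `0 < α ≤ 1`). -/
noncomputable def densityM (σ α : ℝ) : ℂ → ℝ := Classical.epsilon (IsLimitDensity σ α)

/-- The square `Ω = {x + iy : |x| ≤ (log T)^δ, |y| ≤ (log T)^δ}`. -/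
def squareΩ (δ T : ℝ) : Set ℂ :=
  {z | |z.re| ≤ Real.log T ^ δ ∧ |z.im| ≤ Real.log T ^ δ}

end LerchMean

/-!
By Fourier inversion on the class `Λ`, both mean values of `Φ` are integrals of `Φ̃` against
characteristic functions, so it suffices to compare the characteristic function of
`t ↦ L(lam, α, σ + i t)` on `[0, T]` with that of `φ₀ ∗ φ₁ ∗ ⋯`, namely `∏ J₀((n + α)^(-σ) ‖v‖)`,
for `v` in the square. Outside the square, the trivial bound `2` is enough.

For the comparison, the partial summation formula and a mean value theorem for Dirichlet
polynomials replace `L` by a polynomial of length `N = exp((log T)^(3θ/2))`. The exponential is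
expanded to order `2k`. Each mixed moment of the polynomial is a mean of exponentials in `t` whose
frequencies are `∑ ε_j log(n_j + α)`: by linear independence, the terms of frequency zero give the
moments of independent uniform phases, and the spacing condition bounds all the other terms. The
choice `k ≍ (log T)^(2δ + 5θ/4)` balances the error in the expansion against the loss `N^(Ω (2k)²)`
from the spacing; the exponents fit together because `4δ + 4θ < 1`.
-/

namespace LerchMean

open MeasureTheory Filter Topology
open AddCircle (haarAddCircle toCircle)
open Complex (I)
open scoped Real FourierTransform RealInnerProductSpace

section Oscillation

lemma hasDerivAt_pow_succ_div_factorial {𝕜 : Type*} [RCLike 𝕜] (n : ℕ) (z : 𝕜) :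
    HasDerivAt (fun z : 𝕜 => z ^ (n + 1) / ((n + 1).factorial : 𝕜))
      (z ^ n / (n.factorial : 𝕜)) z := by
  refine ((hasDerivAt_pow (n + 1) z).div_const _).congr_deriv ?_
  have : (n.factorial : 𝕜) ≠ 0 := by exact_mod_cast n.factorial_ne_zero
  rw [Nat.factorial_succ]
  push_cast
  field_simp

lemma hasDerivAt_sum_range_pow_div_factorial {𝕜 : Type*} [RCLike 𝕜] (n : ℕ) (z : 𝕜) :
    HasDerivAt (fun z : 𝕜 => ∑ m ∈ Finset.range (n + 1), z ^ m / (m.factorial : 𝕜))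
      (∑ m ∈ Finset.range n, z ^ m / (m.factorial : 𝕜)) z := by
  simp_rw [Finset.sum_range_succ' _ n]
  simpa using! (HasDerivAt.fun_sum fun m (_ : m ∈ Finset.range n) =>
    hasDerivAt_pow_succ_div_factorial m z).add_const (1 : 𝕜)

lemma hasDerivAt_ofReal_mul_I (y : ℝ) : HasDerivAt (fun y : ℝ => (y : ℂ) * I) I y := by
  simpa using (Complex.ofRealCLM.hasDerivAt (x := y)).mul_const I

lemma norm_exp_mul_I_sub_sum_le_of_nonneg (n : ℕ) {x : ℝ} (hx : 0 ≤ x) :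
    ‖Complex.exp (x * I) - ∑ m ∈ Finset.range n, (x * I) ^ m / (m.factorial : ℂ)‖
      ≤ x ^ n / n.factorial := by
  induction n generalizing x with
  | zero => simp [Complex.norm_exp_ofReal_mul_I]
  | succ n ih =>
    have hderiv (y : ℝ) := ((Complex.hasDerivAt_exp (y * I)).sub
      (hasDerivAt_sum_range_pow_div_factorial n (y * I))).comp y (hasDerivAt_ofReal_mul_I y)
    refine image_norm_le_of_norm_deriv_right_le_deriv_boundary (a := 0) (b := x)
      (fun y _ => (hderiv y).continuousAt.continuousWithinAt)
      (fun y _ => (hderiv y).hasDerivWithinAt) ?_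
      (fun y => hasDerivAt_pow_succ_div_factorial n y) (fun y hy => ?_) ⟨hx, le_rfl⟩
    · simp [Finset.sum_range_succ']
    · rw [norm_mul, Complex.norm_I, mul_one]
      exact ih hy.1

lemma norm_exp_mul_I_sub_sum_le (n : ℕ) (x : ℝ) :
    ‖Complex.exp (x * I) - ∑ m ∈ Finset.range n, (x * I) ^ m / (m.factorial : ℂ)‖
      ≤ |x| ^ n / n.factorial := by
  rcases le_total 0 x with hx | hx
  · rw [abs_of_nonneg hx]
    exact norm_exp_mul_I_sub_sum_le_of_nonneg n hx
  · rw [abs_of_nonpos hx]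
    convert norm_exp_mul_I_sub_sum_le_of_nonneg n (neg_nonneg.mpr hx) using 1
    rw [← Complex.norm_conj]
    simp [map_sum, ← Complex.exp_conj]

lemma norm_exp_mul_I_sub_exp_mul_I_le (a b : ℝ) :
    ‖Complex.exp (a * I) - Complex.exp (b * I)‖ ≤ |a - b| := by
  have hfactor : Complex.exp (a * I) - Complex.exp (b * I)
      = Complex.exp (b * I) * (Complex.exp (((a - b : ℝ) : ℂ) * I) - 1) := by
    rw [mul_sub, ← Complex.exp_add, mul_one]
    push_cast
    ring_nf
  rw [hfactor, norm_mul, Complex.norm_exp_ofReal_mul_I, one_mul]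
  simpa using norm_exp_mul_I_sub_sum_le 1 (a - b)

lemma norm_intervalIntegral_exp_mul_I_le_sub (φ : ℝ → ℝ) {a b : ℝ} (hab : a ≤ b) :
    ‖∫ x in a..b, Complex.exp (φ x * I)‖ ≤ b - a := by
  simpa [abs_of_nonneg (sub_nonneg.mpr hab)] using
    intervalIntegral.norm_integral_le_of_norm_le_const (a := a) (b := b)
      fun x _ => (Complex.norm_exp_ofReal_mul_I (φ x)).le

/-- Integration by parts of `exp (φ I) = -I / φ' * (exp (φ I))'`. -/
lemma intervalIntegral_exp_mul_I_eq {φ φ' φ'' : ℝ → ℝ} {a b : ℝ}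
    (hφ : ∀ x ∈ Set.uIcc a b, HasDerivAt φ (φ' x) x)
    (hφ' : ∀ x ∈ Set.uIcc a b, HasDerivAt φ' (φ'' x) x)
    (hcont : ContinuousOn φ'' (Set.uIcc a b)) (hne : ∀ x ∈ Set.uIcc a b, φ' x ≠ 0) :
    ∫ x in a..b, Complex.exp (φ x * I)
      = -I * (φ' b : ℂ)⁻¹ * Complex.exp (φ b * I) - -I * (φ' a : ℂ)⁻¹ * Complex.exp (φ a * I)
        - ∫ x in a..b, -I * (-(φ'' x : ℂ) / (φ' x : ℂ) ^ 2) * Complex.exp (φ x * I) := by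
  have hne' : ∀ x ∈ Set.uIcc a b, (φ' x : ℂ) ≠ 0 := fun x hx =>
    Complex.ofReal_ne_zero.mpr (hne x hx)
  have hφc : ContinuousOn φ (Set.uIcc a b) := fun x hx =>
    (hφ x hx).continuousAt.continuousWithinAt
  have hφ'c : ContinuousOn φ' (Set.uIcc a b) := fun x hx =>
    (hφ' x hx).continuousAt.continuousWithinAt
  rw [← intervalIntegral.integral_mul_deriv_eq_deriv_mul
    (u := fun x => -I * (φ' x : ℂ)⁻¹) (v := fun x => Complex.exp (φ x * I))
    (u' := fun x => -I * (-(φ'' x : ℂ) / (φ' x : ℂ) ^ 2))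
    (v' := fun x => Complex.exp (φ x * I) * (φ' x * I))
    (fun x hx => ((hφ' x hx).ofReal_comp.inv (hne' x hx)).const_mul (-I))
    (fun x hx => ((hφ x hx).ofReal_comp.mul_const I).cexp)]
  · refine intervalIntegral.integral_congr fun x hx => ?_
    field_simp [hne' x hx]
    simp [Complex.I_sq]
  · exact (continuousOn_const.mul (ContinuousOn.div (by fun_prop) (by fun_prop)
      fun x hx => pow_ne_zero 2 (hne' x hx))).intervalIntegrable
  · apply ContinuousOn.intervalIntegrable
    fun_prop

lemma norm_intervalIntegral_exp_mul_I_le {φ φ' φ'' : ℝ → ℝ} {a b m K : ℝ} (hab : a ≤ b)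
    (hm : 0 < m) (hφ : ∀ x ∈ Set.Icc a b, HasDerivAt φ (φ' x) x)
    (hφ' : ∀ x ∈ Set.Icc a b, HasDerivAt φ' (φ'' x) x) (hcont : ContinuousOn φ'' (Set.Icc a b))
    (hlower : ∀ x ∈ Set.Icc a b, m ≤ |φ' x|) (hupper : ∀ x ∈ Set.Icc a b, |φ'' x| ≤ K) :
    ‖∫ x in a..b, Complex.exp (φ x * I)‖ ≤ 2 / m + K * (b - a) / m ^ 2 := by
  have hboundary : ∀ x ∈ Set.Icc a b, ‖-I * (φ' x : ℂ)⁻¹ * Complex.exp (φ x * I)‖ ≤ 1 / m :=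
    fun x hx => by
      simp only [norm_mul, norm_neg, Complex.norm_I, one_mul, Complex.norm_exp_ofReal_mul_I,
        mul_one, norm_inv, Complex.norm_real, Real.norm_eq_abs, one_div]
      exact inv_anti₀ hm (hlower x hx)
  have hremainder : ‖∫ x in a..b, -I * (-(φ'' x : ℂ) / (φ' x : ℂ) ^ 2) * Complex.exp (φ x * I)‖
      ≤ K / m ^ 2 * (b - a) := by
    rw [← abs_of_nonneg (sub_nonneg.mpr hab)]
    refine intervalIntegral.norm_integral_le_of_norm_le_const fun x hx => ?_
    rw [Set.uIoc_of_le hab] at hx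
    have hx' := Set.Ioc_subset_Icc_self hx
    have hK : 0 ≤ K := (abs_nonneg _).trans (hupper x hx')
    simp only [norm_mul, norm_neg, Complex.norm_I, one_mul, Complex.norm_exp_ofReal_mul_I,
      mul_one, norm_div, norm_pow, Complex.norm_real, Real.norm_eq_abs]
    exact div_le_div₀ hK (hupper x hx') (by positivity) (pow_le_pow_left₀ hm.le (hlower x hx') 2)
  rw [← Set.uIcc_of_le hab] at hφ hφ' hcont
  rw [intervalIntegral_exp_mul_I_eq hφ hφ' hcont fun x hx =>
    abs_pos.mp (hm.trans_le (hlower x (Set.uIcc_of_le hab ▸ hx)))]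
  calc _ ≤ 1 / m + 1 / m + K / m ^ 2 * (b - a) :=
        (norm_sub_le _ _).trans (add_le_add ((norm_sub_le _ _).trans (add_le_add
          (hboundary b ⟨hab, le_rfl⟩) (hboundary a ⟨le_rfl, hab⟩))) hremainder)
    _ = 2 / m + K * (b - a) / m ^ 2 := by ring

end Oscillation

section CharFunInversion

variable {V : Type*} [NormedAddCommGroup V] [InnerProductSpace ℝ V] [FiniteDimensional ℝ V]
  [MeasurableSpace V] [BorelSpace V]

/-- The density that Fourier inversion predicts for a measure with integrable characteristic
function. The dilation by `2π` translates between the normalizations of `charFun` and of `𝓕`. -/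
noncomputable def charFunDensity (μ : Measure V) : V → ℂ :=
  𝓕 fun ξ => charFun μ ((2 * π) • ξ)

variable {μ : Measure V}

lemma integrable_charFun_two_pi_smul (hμ : Integrable (charFun μ)) :
    Integrable fun ξ => charFun μ ((2 * π) • ξ) :=
  hμ.comp_smul (by positivity)

lemma continuous_charFunDensity (hμ : Integrable (charFun μ)) : Continuous (charFunDensity μ) :=
  VectorFourier.fourierIntegral_continuous Real.continuous_fourierChar
    (by exact continuous_inner) (integrable_charFun_two_pi_smul hμ)

lemma integral_fourierInv_eq_integral_mul_charFun [IsFiniteMeasure μ] {g : V → ℂ}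
    (hg : Integrable g) : ∫ x, 𝓕⁻ g x ∂μ = ∫ ξ, g ξ * charFun μ ((2 * π) • ξ) := by
  have hflip := VectorFourier.integral_fourierIntegral_smul_eq_flip (μ := volume) (ν := μ)
    (L := -innerₗ V) (g := fun _ : V => (1 : ℂ)) Real.continuous_fourierChar
    (by exact continuous_inner.neg) hg (integrable_const 1)
  simp only [smul_eq_mul, mul_one] at hflip
  refine hflip.trans (integral_congr_ae (ae_of_all _ fun ξ => ?_))
  simp only [VectorFourier.fourierIntegral, charFun_apply, Circle.smul_def, smul_eq_mul, mul_one,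
    Real.fourierChar_apply, inner_smul_right]
  congr 1
  refine integral_congr_ae (ae_of_all _ fun x => ?_)
  simp [real_inner_comm ξ x]

lemma integral_schwartz_eq_integral_mul_charFunDensity [IsFiniteMeasure μ]
    (hμ : Integrable (charFun μ)) (γ : SchwartzMap V ℂ) :
    ∫ x, γ x ∂μ = ∫ x, γ x * charFunDensity μ x := by
  have hflip := VectorFourier.integral_fourierIntegral_smul_eq_flip (L := innerₗ V)
    Real.continuous_fourierChar continuous_inner (γ.integrable (μ := volume))
    (integrable_charFun_two_pi_smul hμ)
  rw [flip_innerₗ] at hflip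
  have hfourier : Integrable (𝓕 (γ : V → ℂ)) := by
    rw [← SchwartzMap.fourier_coe]
    exact (𝓕 γ : SchwartzMap V ℂ).integrable
  calc ∫ x, γ x ∂μ = ∫ x, 𝓕⁻ (𝓕 (γ : V → ℂ)) x ∂μ := by
        rw [← SchwartzMap.fourier_coe, ← SchwartzMap.fourierInv_coe,
          FourierTransform.fourierInv_fourier_eq]
    _ = ∫ ξ, 𝓕 (γ : V → ℂ) ξ * charFun μ ((2 * π) • ξ) :=
        integral_fourierInv_eq_integral_mul_charFun hfourier
    _ = ∫ x, γ x * charFunDensity μ x := hflip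

lemma integral_contDiff_eq_integral_mul_charFunDensity [IsFiniteMeasure μ]
    (hμ : Integrable (charFun μ)) {γ : V → ℝ} (hγ : HasCompactSupport γ)
    (hγ' : ContDiff ℝ (⊤ : ℕ∞) γ) :
    ((∫ x, γ x ∂μ : ℝ) : ℂ) = ∫ x, (γ x : ℂ) * charFunDensity μ x := by
  have hsupp : HasCompactSupport fun x => (γ x : ℂ) := hγ.comp_left Complex.ofReal_zero
  rw [← integral_complex_ofReal]
  exact integral_schwartz_eq_integral_mul_charFunDensity hμ
    (hsupp.toSchwartzMap (Complex.ofRealCLM.contDiff.comp hγ'))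

open scoped ComplexOrder in
lemma charFunDensity_nonneg [IsFiniteMeasure μ] (hμ : Integrable (charFun μ)) (x : V) :
    0 ≤ charFunDensity μ x := by
  let bump (n : ℕ) : ContDiffBump (0 : V) :=
    ⟨1 / (2 * (n + 1)), 1 / (n + 1), by positivity, by gcongr; linarith⟩
  have hmean := ContDiffBump.convolution_tendsto_right_of_continuous (φ := bump) (μ := volume)
    tendsto_one_div_add_atTop_nhds_zero_nat (continuous_charFunDensity hμ) x
  refine ge_of_tendsto' hmean fun n => ?_
  have hsupp : HasCompactSupport fun y => (bump n).normed volume (x - y) :=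
    (bump n).hasCompactSupport_normed.comp_homeomorph (Homeomorph.subLeft x)
  have hsmooth : ContDiff ℝ (⊤ : ℕ∞) fun y => (bump n).normed volume (x - y) :=
    (bump n).contDiff_normed.comp (contDiff_const.sub contDiff_id)
  rw [convolution_eq_swap]
  simp only [ContinuousLinearMap.lsmul_apply, Complex.real_smul]
  rw [← integral_contDiff_eq_integral_mul_charFunDensity hμ hsupp hsmooth, Complex.zero_le_real]
  exact integral_nonneg fun y => (bump n).nonneg_normed _

lemma ofReal_re_charFunDensity [IsFiniteMeasure μ] (hμ : Integrable (charFun μ)) (x : V) :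
    ((charFunDensity μ x).re : ℂ) = charFunDensity μ x :=
  Complex.ext rfl (Complex.nonneg_iff.mp (charFunDensity_nonneg hμ x)).2

lemma re_charFunDensity_nonneg [IsFiniteMeasure μ] (hμ : Integrable (charFun μ)) (x : V) :
    0 ≤ (charFunDensity μ x).re :=
  (Complex.nonneg_iff.mp (charFunDensity_nonneg hμ x)).1

lemma lintegral_bump_mul_charFunDensity_le [IsFiniteMeasure μ] (hμ : Integrable (charFun μ))
    (φ : ContDiffBump (0 : V)) :
    ∫⁻ x, ENNReal.ofReal (φ x * (charFunDensity μ x).re) ≤ ENNReal.ofReal (μ.real Set.univ) := by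
  have hcont : Continuous fun x => (charFunDensity μ x).re :=
    Complex.continuous_re.comp (continuous_charFunDensity hμ)
  have hint : Integrable fun x => φ x * (charFunDensity μ x).re :=
    (φ.continuous.mul hcont).integrable_of_hasCompactSupport φ.hasCompactSupport.mul_right
  have hmass : ∫ x, φ x * (charFunDensity μ x).re = ∫ x, φ x ∂μ := by
    have h := integral_contDiff_eq_integral_mul_charFunDensity hμ φ.hasCompactSupport φ.contDiff
    have hreal (x : V) : (φ x : ℂ) * charFunDensity μ x =
        ((φ x * (charFunDensity μ x).re : ℝ) : ℂ) := by
      rw [Complex.ofReal_mul, ofReal_re_charFunDensity hμ]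
    simp only [hreal, integral_complex_ofReal] at h
    exact_mod_cast h.symm
  rw [← ofReal_integral_eq_lintegral_ofReal hint
    (ae_of_all _ fun x => mul_nonneg φ.nonneg (re_charFunDensity_nonneg hμ x)), hmass]
  refine ENNReal.ofReal_le_ofReal ?_
  calc ∫ x, φ x ∂μ ≤ ∫ _, (1 : ℝ) ∂μ :=
        integral_mono (φ.continuous.integrable_of_hasCompactSupport φ.hasCompactSupport)
          (integrable_const 1) fun _ => φ.le_one
    _ = μ.real Set.univ := by simp

lemma integrable_charFunDensity [IsFiniteMeasure μ] (hμ : Integrable (charFun μ)) :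
    Integrable (charFunDensity μ) := by
  let bump (n : ℕ) : ContDiffBump (0 : V) := ⟨n + 1, n + 2, by positivity, by linarith⟩
  have hcont := continuous_charFunDensity hμ
  have hbump_one (x : V) : ∀ᶠ n in atTop, bump n x = 1 := by
    filter_upwards [eventually_ge_atTop ⌈‖x‖⌉₊] with n hn
    refine (bump n).one_of_mem_closedBall (mem_closedBall_zero_iff.mpr ?_)
    linarith [Nat.ceil_le.mp hn, show (bump n).rIn = n + 1 from rfl]
  have hlim (x : V) : Tendsto (fun n => ENNReal.ofReal (bump n x * (charFunDensity μ x).re)) atTop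
      (𝓝 (ENNReal.ofReal (charFunDensity μ x).re)) := by
    refine tendsto_nhds_of_eventually_eq ((hbump_one x).mono fun n hn => ?_)
    rw [hn, one_mul]
  have hfatou := lintegral_liminf_le (μ := (volume : Measure V)) (u := atTop)
    (f := fun n x => ENNReal.ofReal (bump n x * (charFunDensity μ x).re)) fun n =>
      (((bump n).continuous.mul (Complex.continuous_re.comp hcont)).measurable).ennreal_ofReal
  simp only [fun x => (hlim x).liminf_eq] at hfatou
  refine ⟨hcont.aestronglyMeasurable, hasFiniteIntegral_iff_norm _ |>.mpr ?_⟩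
  have hnorm (x : V) : ‖charFunDensity μ x‖ = (charFunDensity μ x).re := by
    rw [← ofReal_re_charFunDensity hμ x, Complex.norm_real, Complex.ofReal_re,
      Real.norm_of_nonneg (re_charFunDensity_nonneg hμ x)]
  simp only [hnorm]
  exact (hfatou.trans (liminf_le_of_frequently_le' (Frequently.of_forall fun n =>
    lintegral_bump_mul_charFunDensity_le hμ (bump n)))).trans_lt ENNReal.ofReal_lt_top

theorem eq_withDensity_charFunDensity [IsFiniteMeasure μ] (hμ : Integrable (charFun μ)) :
    μ = volume.withDensity fun x => ENNReal.ofReal (charFunDensity μ x).re := by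
  have hint := integrable_charFunDensity hμ
  have hcont := continuous_charFunDensity hμ
  have : IsFiniteMeasure (volume.withDensity fun x => ENNReal.ofReal (charFunDensity μ x).re) :=
    isFiniteMeasure_withDensity_ofReal hint.re.2
  have hinv : 𝓕⁻ (charFunDensity μ) = fun ξ => charFun μ ((2 * π) • ξ) :=
    (continuous_charFun.comp (continuous_const_smul _)).fourierInv_fourier_eq
      (integrable_charFun_two_pi_smul hμ) hint
  refine Measure.ext_of_charFun (funext fun t => ?_)
  have ht : charFun μ t = 𝓕⁻ (charFunDensity μ) ((2 * π)⁻¹ • t) := by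
    simp only [hinv]
    rw [smul_smul, mul_inv_cancel₀ (by positivity), one_smul]
  rw [ht, Real.fourierInv_eq', charFun_apply,
    integral_withDensity_eq_integral_toReal_smul (by fun_prop) (ae_of_all _ fun x => by simp)]
  refine integral_congr_ae (ae_of_all _ fun x => ?_)
  simp only [ENNReal.toReal_ofReal (re_charFunDensity_nonneg hμ x), inner_smul_right, smul_eq_mul,
    Complex.real_smul, ofReal_re_charFunDensity hμ]
  rw [mul_comm, ← mul_assoc, mul_inv_cancel₀ (by positivity), one_mul]

end CharFunInversion

lemma exists_continuous_density_of_integrable_charFun {μ : Measure ℂ} [IsFiniteMeasure μ]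
    (hμ : Integrable (charFun μ)) :
    ∃ M : ℂ → ℝ, Continuous M ∧ (∀ z, 0 ≤ M z) ∧
      μ = dz.withDensity fun z => ENNReal.ofReal (M z) := by
  have hcont := continuous_charFunDensity hμ
  refine ⟨fun z => 2 * π * (charFunDensity μ z).re, by fun_prop,
    fun z => mul_nonneg (by positivity) (re_charFunDensity_nonneg hμ z), ?_⟩
  rw [dz, withDensity_smul_measure, ← withDensity_smul _ (by fun_prop)]
  conv_lhs => rw [eq_withDensity_charFunDensity hμ]
  congr 1 with z
  rw [Pi.smul_apply, smul_eq_mul, ← ENNReal.ofReal_mul (by positivity),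
    inv_mul_cancel_left₀ (by positivity)]

section Circle

lemma integrable_of_continuous_of_compactSpace {X E : Type*} [TopologicalSpace X] [CompactSpace X]
    [MeasurableSpace X] [OpensMeasurableSpace X] [NormedAddCommGroup E] {μ : Measure X}
    [IsFiniteMeasureOnCompacts μ] {f : X → E} (hf : Continuous f) : Integrable f μ :=
  hf.integrable_of_hasCompactSupport (.of_compactSpace f)

lemma integral_comp_const_mul_toCircle {E : Type*} [NormedAddCommGroup E] [NormedSpace ℝ E]
    (f : ℂ → E) (c : ℂ) :
    ∫ x : UnitAddCircle, f (c * toCircle x) ∂haarAddCircle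
      = ∫ x : UnitAddCircle, f (‖c‖ * toCircle x) ∂haarAddCircle := by
  obtain ⟨y, hy⟩ : ∃ y : UnitAddCircle, c = ‖c‖ * toCircle y := by
    refine ⟨((c.arg / (2 * π) : ℝ) : UnitAddCircle), ?_⟩
    rw [AddCircle.toCircle_apply_mk, div_one, mul_div_cancel₀ _ (by positivity), Circle.coe_exp,
      Complex.norm_mul_exp_arg_mul_I]
  rw [← integral_add_left_eq_self (fun x => f (‖c‖ * toCircle x)) y]
  conv_lhs => rw [hy]
  simp only [AddCircle.toCircle_add, Circle.coe_mul, mul_assoc]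

lemma integral_re_const_mul_toCircle (c : ℂ) :
    ∫ x : UnitAddCircle, (c * toCircle x).re ∂haarAddCircle = 0 := by
  have h := integral_comp_const_mul_toCircle Complex.re (-c)
  rw [norm_neg, ← integral_comp_const_mul_toCircle] at h
  simp only [neg_mul, Complex.neg_re, integral_neg] at h
  linarith

/-- The Bessel function `J₀`, introduced as the characteristic function of the uniform
distribution on the unit circle. -/
noncomputable def besselJZero (u : ℝ) : ℂ :=
  ∫ x : UnitAddCircle, Complex.exp (((u * toCircle x : ℂ).re : ℂ) * I) ∂haarAddCircle

lemma integral_exp_re_const_mul_toCircle (c : ℂ) :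
    ∫ x : UnitAddCircle, Complex.exp (((c * toCircle x : ℂ).re : ℂ) * I) ∂haarAddCircle
      = besselJZero ‖c‖ :=
  integral_comp_const_mul_toCircle (fun z => Complex.exp ((z.re : ℂ) * I)) c

lemma norm_besselJZero_le_one (u : ℝ) : ‖besselJZero u‖ ≤ 1 :=
  (norm_integral_le_of_norm_le_const (ae_of_all _ fun _ =>
    (Complex.norm_exp_ofReal_mul_I _).le)).trans (by simp)

lemma norm_besselJZero_sub_one_le (u : ℝ) : ‖besselJZero u - 1‖ ≤ u ^ 2 / 2 := by
  have hint {f : UnitAddCircle → ℂ} (hf : Continuous f) : Integrable f haarAddCircle :=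
    integrable_of_continuous_of_compactSpace hf
  -- The linear term of the exponential has mean zero, so it may be subtracted for free.
  have htaylor : besselJZero u - 1 = ∫ x : UnitAddCircle,
      (Complex.exp (((u * toCircle x : ℂ).re : ℂ) * I)
        - ∑ m ∈ Finset.range 2, ((u * toCircle x : ℂ).re * I) ^ m / (m.factorial : ℂ))
        ∂haarAddCircle := by
    simp only [Finset.sum_range_succ, Finset.sum_range_zero, zero_add, pow_zero, pow_one,
      Nat.factorial, Nat.cast_one, div_one, mul_one]
    rw [integral_sub (hint (by fun_prop)) (hint (by fun_prop)),
      integral_add (hint (by fun_prop)) (hint (by fun_prop)), integral_mul_const,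
      integral_complex_ofReal, integral_re_const_mul_toCircle, besselJZero]
    simp
  rw [htaylor]
  refine (norm_integral_le_of_norm_le_const (C := u ^ 2 / 2) (ae_of_all _ fun x => ?_)).trans
    (by simp)
  refine (norm_exp_mul_I_sub_sum_le 2 _).trans ?_
  have hre : |(u * toCircle x : ℂ).re| ≤ |u| :=
    (Complex.abs_re_le_norm _).trans_eq (by
      rw [norm_mul, Circle.norm_coe, mul_one, Complex.norm_real, Real.norm_eq_abs])
  rw [Nat.factorial_two, Nat.cast_two, ← sq_abs u]
  gcongr

lemma besselJZero_eq_intervalIntegral (u : ℝ) :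
    besselJZero u
      = 2 * ∫ x in (0 : ℝ)..(1 / 2), Complex.exp ((u * Real.cos (2 * π * x) : ℝ) * I) := by
  set F : ℝ → ℂ := fun x => Complex.exp ((u * Real.cos (2 * π * x) : ℝ) * I)
  have hint (a b : ℝ) : IntervalIntegrable F volume a b :=
    Continuous.intervalIntegrable (by fun_prop) a b
  have hreflect : ∫ x in (1 / 2 : ℝ)..1, F x = ∫ x in (0 : ℝ)..(1 / 2), F x := by
    have h := intervalIntegral.integral_comp_sub_left (a := 0) (b := 1 / 2) F 1
    rw [sub_zero, sub_half] at h
    rw [← h]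
    refine intervalIntegral.integral_congr fun x _ => ?_
    simp only [F, mul_sub, mul_one, Real.cos_two_pi_sub]
  calc besselJZero u = ∫ x in (0 : ℝ)..1, F x := by
        rw [besselJZero, AddCircle.integral_haarAddCircle, inv_one, one_smul,
          ← UnitAddCircle.intervalIntegral_preimage 0, zero_add]
        refine intervalIntegral.integral_congr fun x _ => ?_
        simp only [F, AddCircle.toCircle_apply_mk, div_one, Circle.coe_exp, Complex.re_ofReal_mul,
          Complex.exp_ofReal_mul_I_re]
    _ = 2 * ∫ x in (0 : ℝ)..(1 / 2), F x := by
        rw [← intervalIntegral.integral_add_adjacent_intervals (hint 0 (1 / 2)) (hint _ _),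
          hreflect, two_mul]

lemma four_mul_le_sin_two_pi_mul {η x : ℝ} (hη : 0 ≤ η) (hx : x ∈ Set.Icc η (1 / 2 - η)) :
    4 * η ≤ Real.sin (2 * π * x) := by
  have hconcave : ∀ y ∈ Set.Icc 0 (1 / 4 : ℝ), 4 * y ≤ Real.sin (2 * π * y) := fun y hy => by
    have h := Real.mul_le_sin (x := 2 * π * y) (by have := hy.1; positivity)
      (by nlinarith [hy.2, Real.pi_pos])
    rwa [show 2 / π * (2 * π * y) = 4 * y by field_simp; ring] at h
  rcases le_total x (1 / 4) with h | h
  · linarith [hconcave x ⟨hη.trans hx.1, h⟩, hx.1]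
  · have hsin : Real.sin (2 * π * x) = Real.sin (2 * π * (1 / 2 - x)) := by
      rw [← Real.sin_pi_sub]
      ring_nf
    linarith [hconcave (1 / 2 - x) ⟨by linarith [hx.2], by linarith⟩, hx.2]

lemma norm_intervalIntegral_exp_cos_le {u a b m : ℝ} (hu : 0 < u) (hm : 0 < m) (hab : a ≤ b)
    (hsin : ∀ x ∈ Set.Icc a b, m ≤ Real.sin (2 * π * x)) :
    ‖∫ x in a..b, Complex.exp ((u * Real.cos (2 * π * x) : ℝ) * I)‖
      ≤ 2 / (2 * π * u * m) + (2 * π) ^ 2 * u * (b - a) / (2 * π * u * m) ^ 2 := by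
  have hlin (x : ℝ) : HasDerivAt (fun x => 2 * π * x) (2 * π) x := by
    simpa using (hasDerivAt_id x).const_mul (2 * π)
  refine norm_intervalIntegral_exp_mul_I_le (φ' := fun x => u * (-Real.sin (2 * π * x) * (2 * π)))
    (φ'' := fun x => u * (-(Real.cos (2 * π * x) * (2 * π)) * (2 * π))) hab (by positivity)
    (fun x _ => (hlin x).cos.const_mul u)
    (fun x _ => ((hlin x).sin.neg.mul_const (2 * π)).const_mul u) (by fun_prop)
    (fun x hx => ?_) (fun x _ => ?_)
  · rw [abs_mul, abs_mul, abs_neg, abs_of_pos hu, abs_of_pos Real.two_pi_pos]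
    calc 2 * π * u * m ≤ 2 * π * u * |Real.sin (2 * π * x)| := by
          gcongr
          exact (hsin x hx).trans (le_abs_self _)
      _ = u * (|Real.sin (2 * π * x)| * (2 * π)) := by ring
  · rw [abs_mul, abs_mul, abs_neg, abs_mul, abs_of_pos hu, abs_of_pos Real.two_pi_pos]
    calc u * (|Real.cos (2 * π * x)| * (2 * π) * (2 * π)) ≤ u * (1 * (2 * π) * (2 * π)) := by
          gcongr
          exact Real.abs_cos_le_one _
      _ = (2 * π) ^ 2 * u := by ring

lemma norm_besselJZero_le_rpow {u : ℝ} (hu : 1 ≤ u) :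
    ‖besselJZero u‖ ≤ 5 * u ^ (-(1 / 3) : ℝ) := by
  -- Cut off pieces of length `v / 4` around the stationary points of `cos (2 * π * x)`.
  set v : ℝ := u ^ (-(1 / 3) : ℝ)
  have hu_pos : 0 < u := by linarith
  have hv : 0 < v := Real.rpow_pos_of_pos hu_pos _
  have hv_one : v ≤ 1 := Real.rpow_le_one_of_one_le_of_nonpos hu (by norm_num)
  have huv : u * v ^ 3 = 1 := by
    rw [← Real.rpow_natCast, ← Real.rpow_mul hu_pos.le]
    norm_num [Real.rpow_neg_one, hu_pos.ne']
  set F : ℝ → ℂ := fun x => Complex.exp ((u * Real.cos (2 * π * x) : ℝ) * I)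
  have hint (a b : ℝ) : IntervalIntegrable F volume a b :=
    Continuous.intervalIntegrable (by fun_prop) a b
  have hleft : ‖∫ x in (0 : ℝ)..(v / 4), F x‖ ≤ v / 4 - 0 :=
    norm_intervalIntegral_exp_mul_I_le_sub _ (by linarith)
  have hright : ‖∫ x in (1 / 2 - v / 4)..(1 / 2), F x‖ ≤ 1 / 2 - (1 / 2 - v / 4) :=
    norm_intervalIntegral_exp_mul_I_le_sub _ (by linarith)
  have hmiddle : ‖∫ x in (v / 4)..(1 / 2 - v / 4), F x‖ ≤ 2 * v := by
    refine (norm_intervalIntegral_exp_cos_le hu_pos hv (by linarith) fun x hx => ?_).trans ?_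
    · linarith [four_mul_le_sin_two_pi_mul (by linarith) hx]
    have hpi := Real.pi_gt_three
    have hfirst : 2 / (2 * π * u * v) ≤ v := by
      rw [div_le_iff₀ (by positivity)]
      nlinarith [mul_le_of_le_one_right (by positivity : 0 ≤ u * v ^ 2) hv_one]
    have hsecond : (2 * π) ^ 2 * u * (1 / 2 - v / 4 - v / 4) / (2 * π * u * v) ^ 2 ≤ v := by
      rw [div_le_iff₀ (by positivity)]
      calc (2 * π) ^ 2 * u * (1 / 2 - v / 4 - v / 4) ≤ (2 * π) ^ 2 * u * 1 := by
            gcongr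
            linarith
        _ = (2 * π) ^ 2 * u * (u * v ^ 3) := by rw [huv]
        _ = v * (2 * π * u * v) ^ 2 := by ring
    linarith
  rw [besselJZero_eq_intervalIntegral,
    ← intervalIntegral.integral_add_adjacent_intervals (hint 0 (1 / 2 - v / 4)) (hint _ _),
    ← intervalIntegral.integral_add_adjacent_intervals (hint 0 (v / 4)) (hint _ _), norm_mul,
    Complex.norm_two]
  linarith [norm_add₃_le (a := ∫ x in (0 : ℝ)..(v / 4), F x)
    (b := ∫ x in (v / 4)..(1 / 2 - v / 4), F x) (c := ∫ x in (1 / 2 - v / 4)..(1 / 2), F x)]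

lemma norm_besselJZero_le_one_add_rpow {u : ℝ} (hu : 0 ≤ u) :
    ‖besselJZero u‖ ≤ 10 * (1 + u) ^ (-(1 / 3) : ℝ) := by
  have htwo : (1 / 2 : ℝ) ≤ 2 ^ (-(1 / 3) : ℝ) := by
    rw [one_div, ← Real.rpow_neg_one]
    exact Real.rpow_le_rpow_of_exponent_le one_le_two (by norm_num)
  rcases le_total u 1 with h | h
  · have hanti : (2 : ℝ) ^ (-(1 / 3) : ℝ) ≤ (1 + u) ^ (-(1 / 3) : ℝ) :=
      Real.rpow_le_rpow_of_nonpos (by linarith) (by linarith) (by norm_num)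
    linarith [norm_besselJZero_le_one u]
  · have hanti : (2 * u) ^ (-(1 / 3) : ℝ) ≤ (1 + u) ^ (-(1 / 3) : ℝ) :=
      Real.rpow_le_rpow_of_nonpos (by linarith) (by linarith) (by norm_num)
    rw [Real.mul_rpow zero_le_two hu] at hanti
    nlinarith [norm_besselJZero_le_rpow h, Real.rpow_nonneg hu (-(1 / 3))]

end Circle

section LimitDistribution

lemma charFun_circleEquidist {r : ℝ} (hr : 0 ≤ r) (w : ℂ) :
    charFun (circleEquidist r : Measure ℂ) w = besselJZero (‖w‖ * r) := by
  have hmeas : Measurable fun x : UnitAddCircle => (r : ℂ) * toCircle x :=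
    Continuous.measurable (by fun_prop)
  have hmap : (circleEquidist r : Measure ℂ)
      = haarAddCircle.map fun x : UnitAddCircle => (r : ℂ) * toCircle x := rfl
  have hnorm : ‖(starRingEnd ℂ) w * r‖ = ‖w‖ * r := by
    rw [norm_mul, RCLike.norm_conj, Complex.norm_of_nonneg hr]
  rw [hmap, charFun_apply, integral_map hmeas.aemeasurable (by fun_prop), ← hnorm,
    ← integral_exp_re_const_mul_toCircle]
  refine integral_congr_ae (ae_of_all _ fun x => ?_)
  simp only [real_inner_comm w, Complex.inner]
  ring_nf

/-- The radius `(k + α) ^ (-σ)` of the `k`-th circle in the infinite convolution. -/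
noncomputable def circleRadius (σ α : ℝ) (k : ℕ) : ℝ := ((k : ℝ) + α) ^ (-σ)

lemma circleRadius_pos {α : ℝ} (hα : 0 < α) (σ : ℝ) (k : ℕ) : 0 < circleRadius σ α k :=
  Real.rpow_pos_of_pos (by positivity) _

lemma summable_circleRadius_sq {σ α : ℝ} (hα : 0 < α) (hσ : 1 / 2 < σ) :
    Summable fun k => circleRadius σ α k ^ 2 := by
  have hzeta : Summable fun k : ℕ => (k : ℝ) ^ (-(2 * σ)) := Real.summable_nat_rpow.2 (by linarith)
  rw [← summable_nat_add_iff 1] at hzeta ⊢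
  refine Summable.of_nonneg_of_le (fun k => sq_nonneg _) (fun k => ?_) hzeta
  rw [circleRadius, ← Real.rpow_natCast, ← Real.rpow_mul (by positivity),
    show -σ * ((2 : ℕ) : ℝ) = -(2 * σ) by push_cast; ring]
  exact Real.rpow_le_rpow_of_nonpos (by positivity) (by linarith) (by linarith)

lemma charFun_partialConv {α : ℝ} (hα : 0 < α) (σ : ℝ) (n : ℕ) (w : ℂ) :
    charFun (partialConv σ α n : Measure ℂ) w
      = ∏ k ∈ Finset.range (n + 1), besselJZero (‖w‖ * circleRadius σ α k) := by
  induction n with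
  | zero =>
    rw [Finset.prod_range_one]
    exact charFun_circleEquidist (circleRadius_pos hα σ 0).le w
  | succ n ih =>
    have hconv : (partialConv σ α (n + 1) : Measure ℂ)
        = (partialConv σ α n : Measure ℂ).conv (circleEquidist (circleRadius σ α (n + 1))) := rfl
    rw [Finset.prod_range_succ, ← ih, hconv, charFun_conv,
      charFun_circleEquidist (circleRadius_pos hα σ (n + 1)).le w]

lemma norm_prod_range_sub_prod_range_le {R : Type*} [NormedCommRing R] [NormOneClass R] {a : ℕ → R}
    (ha : ∀ i, ‖a i‖ ≤ 1) {N M : ℕ} (hNM : N ≤ M) :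
    ‖∏ i ∈ Finset.range M, a i - ∏ i ∈ Finset.range N, a i‖
      ≤ ∑ i ∈ Finset.Ico N M, ‖a i - 1‖ := by
  induction M, hNM using Nat.le_induction with
  | base => simp
  | succ M hNM ih =>
    have hprod : ‖∏ i ∈ Finset.range M, a i‖ ≤ 1 :=
      (Finset.norm_prod_le _ _).trans
        (Finset.prod_le_one (fun _ _ => norm_nonneg _) fun i _ => ha i)
    calc ‖∏ i ∈ Finset.range (M + 1), a i - ∏ i ∈ Finset.range N, a i‖
        = ‖(∏ i ∈ Finset.range M, a i - ∏ i ∈ Finset.range N, a i)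
            + (∏ i ∈ Finset.range M, a i) * (a M - 1)‖ := by
          rw [Finset.prod_range_succ]
          ring_nf
      _ ≤ ∑ i ∈ Finset.Ico N M, ‖a i - 1‖ + ‖a M - 1‖ :=
          norm_add_le_of_le ih
            ((norm_mul_le _ _).trans (mul_le_of_le_one_left (norm_nonneg _) hprod))
      _ = ∑ i ∈ Finset.Ico N (M + 1), ‖a i - 1‖ := (Finset.sum_Ico_succ_top hNM _).symm

lemma norm_prod_besselJZero_sub_prod_le (r : ℕ → ℝ) (x : ℝ) {N M : ℕ} (hNM : N ≤ M) :
    ‖∏ k ∈ Finset.range M, besselJZero (x * r k) - ∏ k ∈ Finset.range N, besselJZero (x * r k)‖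
      ≤ x ^ 2 / 2 * ∑ k ∈ Finset.Ico N M, r k ^ 2 := by
  refine (norm_prod_range_sub_prod_range_le (fun i => norm_besselJZero_le_one _) hNM).trans ?_
  rw [Finset.mul_sum]
  refine Finset.sum_le_sum fun i _ => (norm_besselJZero_sub_one_le _).trans_eq ?_
  ring

lemma tendsto_prod_besselJZero {r : ℕ → ℝ} (hr : Summable fun k => r k ^ 2) (x : ℝ) :
    Tendsto (fun n => ∏ k ∈ Finset.range n, besselJZero (x * r k)) atTop
      (𝓝 (∏' k, besselJZero (x * r k))) := by
  have hsum : Summable fun k => ‖besselJZero (x * r k) - 1‖ :=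
    (hr.mul_left (x ^ 2 / 2)).of_nonneg_of_le (fun _ => norm_nonneg _) fun k =>
      (norm_besselJZero_sub_one_le _).trans_eq (by ring)
  have hmult := multipliable_one_add_of_summable hsum
  simp only [add_sub_cancel] at hmult
  exact hmult.hasProd.tendsto_prod_nat

lemma norm_tprod_besselJZero_sub_one_le {r : ℕ → ℝ} (hr : Summable fun k => r k ^ 2) (x : ℝ) :
    ‖∏' k, besselJZero (x * r k) - 1‖ ≤ x ^ 2 / 2 * ∑' k, r k ^ 2 := by
  refine le_of_tendsto' ((tendsto_prod_besselJZero hr x).sub_const 1).norm fun n => ?_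
  calc ‖∏ k ∈ Finset.range n, besselJZero (x * r k) - 1‖
      ≤ x ^ 2 / 2 * ∑ k ∈ Finset.Ico 0 n, r k ^ 2 := by
        simpa using norm_prod_besselJZero_sub_prod_le r x (Nat.zero_le n)
    _ ≤ x ^ 2 / 2 * ∑' k, r k ^ 2 := by
        gcongr
        exact hr.sum_le_tsum _ fun _ _ => sq_nonneg _

lemma continuousAt_tprod_besselJZero_norm {r : ℕ → ℝ} (hr : Summable fun k => r k ^ 2) :
    ContinuousAt (fun w : ℂ => ∏' k, besselJZero (‖w‖ * r k)) 0 := by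
  have hzero : ∏' k, besselJZero (‖(0 : ℂ)‖ * r k) = 1 := by
    simpa [sub_eq_zero] using norm_tprod_besselJZero_sub_one_le hr ‖(0 : ℂ)‖
  have hbound : Continuous fun w : ℂ => ‖w‖ ^ 2 / 2 * ∑' k, r k ^ 2 := by fun_prop
  rw [ContinuousAt, hzero, tendsto_iff_norm_sub_tendsto_zero]
  exact squeeze_zero (fun _ => norm_nonneg _)
    (fun w => norm_tprod_besselJZero_sub_one_le hr ‖w‖) (by simpa using hbound.tendsto 0)

theorem exists_tendsto_of_tendsto_charFun {E : Type*} [NormedAddCommGroup E] [InnerProductSpace ℝ E]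
    [FiniteDimensional ℝ E] [MeasurableSpace E] [BorelSpace E] {μ : ℕ → ProbabilityMeasure E}
    {f : E → ℂ} (hf : ContinuousAt f 0)
    (h : ∀ t, Tendsto (fun n => charFun (μ n : Measure E) t) atTop (𝓝 (f t))) :
    ∃ φ : ProbabilityMeasure E, Tendsto μ atTop (𝓝 φ) := by
  have hcompact : IsCompact (closure (Set.range μ)) := by
    refine isCompact_closure_of_isTightMeasureSet ?_
    convert isTightMeasureSet_of_tendsto_charFun hf h using 1
    ext ν
    simp
  obtain ⟨φ, -, hφ⟩ := hcompact.exists_mapClusterPt (f := atTop) (u := μ)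
    (le_principal_iff.2 (mem_map.2 (univ_mem' fun n => subset_closure ⟨n, rfl⟩)))
  refine ⟨φ, ProbabilityMeasure.tendsto_of_tendsto_charFun fun t => ?_⟩
  have hcont : Continuous fun ν : ProbabilityMeasure E => charFun (ν : Measure E) t := by
    simp only [charFun_eq_integral_innerProbChar]
    exact continuous_iff_continuousAt.2 fun ν =>
      (ProbabilityMeasure.tendsto_iff_forall_integral_rclike_tendsto ℂ).1 tendsto_id _
  have hcluster : MapClusterPt (charFun (φ : Measure E) t) atTop
      ((fun ν : ProbabilityMeasure E => charFun (ν : Measure E) t) ∘ μ) :=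
    hφ.continuousAt_comp hcont.continuousAt
  rw [eq_of_nhds_neBot (hcluster.clusterPt.mono (h t))]
  exact h t

lemma norm_besselJZero_mul_le {r : ℝ} (hr : 0 < r) {x : ℝ} (hx : 0 ≤ x) :
    ‖besselJZero (x * r)‖ ≤ 10 * min 1 r ^ (-(1 / 3) : ℝ) * (1 + x) ^ (-(1 / 3) : ℝ) := by
  have hmin : 0 < min 1 r := lt_min one_pos hr
  refine (norm_besselJZero_le_one_add_rpow (by positivity)).trans ?_
  rw [mul_assoc, ← Real.mul_rpow hmin.le (by positivity)]
  gcongr 10 * ?_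
  refine Real.rpow_le_rpow_of_nonpos (by positivity) ?_ (by norm_num)
  linarith [min_le_left 1 r, mul_le_mul_of_nonneg_right (min_le_right 1 r) hx]

/- Seven factors, each decaying like `‖w‖ ^ (-1/3)`, beat the critical exponent `2` of the plane. -/
lemma integrable_of_norm_le_prod_besselJZero {f : ℂ → ℂ} (hf : Continuous f) {r : ℕ → ℝ}
    (hr : ∀ k, 0 < r k) (h : ∀ w, ‖f w‖ ≤ ∏ k ∈ Finset.range 7, ‖besselJZero (‖w‖ * r k)‖) :
    Integrable f := by
  have hdecay : Integrable fun w : ℂ =>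
      (∏ k ∈ Finset.range 7, 10 * min 1 (r k) ^ (-(1 / 3) : ℝ)) * (1 + ‖w‖) ^ (-(7 / 3) : ℝ) := by
    refine (integrable_one_add_norm ?_).const_mul _
    rw [Complex.finrank_real_complex]
    norm_num
  refine hdecay.mono' hf.aestronglyMeasurable (ae_of_all _ fun w => (h w).trans ?_)
  refine (Finset.prod_le_prod (fun _ _ => norm_nonneg _) fun k _ =>
    norm_besselJZero_mul_le (hr k) (norm_nonneg w)).trans_eq ?_
  rw [Finset.prod_mul_distrib, Finset.prod_const, Finset.card_range, ← Real.rpow_natCast,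
    ← Real.rpow_mul (by positivity)]
  norm_num

lemma integrable_charFun_of_tendsto_partialConv {σ α : ℝ} (hα : 0 < α) {φ : ProbabilityMeasure ℂ}
    (hφ : Tendsto (partialConv σ α) atTop (𝓝 φ)) : Integrable (charFun (φ : Measure ℂ)) := by
  refine integrable_of_norm_le_prod_besselJZero continuous_charFun (circleRadius_pos hα σ)
    fun w => le_of_tendsto (ProbabilityMeasure.tendsto_iff_tendsto_charFun.1 hφ w).norm ?_
  filter_upwards [eventually_ge_atTop 6] with n hn
  rw [charFun_partialConv hα, norm_prod,
    ← Finset.prod_range_mul_prod_Ico _ (show 7 ≤ n + 1 by omega)]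
  exact mul_le_of_le_one_right (Finset.prod_nonneg fun _ _ => norm_nonneg _)
    (Finset.prod_le_one (fun _ _ => norm_nonneg _) fun _ _ => norm_besselJZero_le_one _)

theorem exists_isLimitDensity {σ α : ℝ} (hα : 0 < α) (hσ : 1 / 2 < σ) :
    ∃ M, IsLimitDensity σ α M := by
  have hsum := summable_circleRadius_sq hα hσ
  have hcharFun (w : ℂ) : Tendsto (fun n => charFun (partialConv σ α n : Measure ℂ) w) atTop
      (𝓝 (∏' k, besselJZero (‖w‖ * circleRadius σ α k))) := by
    simp only [charFun_partialConv hα]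
    exact (tendsto_prod_besselJZero hsum ‖w‖).comp (tendsto_add_atTop_nat 1)
  obtain ⟨φ, hφ⟩ :=
    exists_tendsto_of_tendsto_charFun (continuousAt_tprod_besselJZero_norm hsum) hcharFun
  obtain ⟨M, hM, hM_nonneg, hφM⟩ := exists_continuous_density_of_integrable_charFun
    (integrable_charFun_of_tendsto_partialConv hα hφ)
  exact ⟨M, hM, hM_nonneg, φ, hφ, hφM⟩

lemma isLimitDensity_densityM {σ α : ℝ} (hα : 0 < α) (hσ : 1 / 2 < σ) :
    IsLimitDensity σ α (densityM σ α) :=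
  Classical.epsilon_spec (exists_isLimitDensity hα hσ)

lemma norm_charFun_sub_prod_besselJZero_le {σ α : ℝ} (hα : 0 < α) {φ : ProbabilityMeasure ℂ}
    (hφ : Tendsto (partialConv σ α) atTop (𝓝 φ)) {N : ℕ} {B : ℝ}
    (hB : ∀ M, ∑ k ∈ Finset.Ico N M, circleRadius σ α k ^ 2 ≤ B) (w : ℂ) :
    ‖charFun (φ : Measure ℂ) w - ∏ k ∈ Finset.range N, besselJZero (‖w‖ * circleRadius σ α k)‖
      ≤ ‖w‖ ^ 2 / 2 * B := by
  have hlim := ProbabilityMeasure.tendsto_iff_tendsto_charFun.1 hφ w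
  refine le_of_tendsto (hlim.sub_const _).norm ?_
  filter_upwards [eventually_ge_atTop N] with n hn
  rw [charFun_partialConv hα]
  refine (norm_prod_besselJZero_sub_prod_le _ _ (by omega)).trans ?_
  gcongr
  exact hB _

end LimitDistribution

section UniformAverage

/-- The uniform probability measure on `(0, T]`, which turns the time averages of the theorem into
expectations. -/
noncomputable def uniformAverage (T : ℝ) : Measure ℝ :=
  ENNReal.ofReal T⁻¹ • volume.restrict (Set.Ioc 0 T)

lemma isProbabilityMeasure_uniformAverage {T : ℝ} (hT : 0 < T) :
    IsProbabilityMeasure (uniformAverage T) := by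
  constructor
  rw [uniformAverage, Measure.smul_apply, Measure.restrict_apply_univ, Real.volume_Ioc, sub_zero,
    smul_eq_mul, ← ENNReal.ofReal_mul (by positivity), inv_mul_cancel₀ hT.ne', ENNReal.ofReal_one]

lemma integral_uniformAverage {E : Type*} [NormedAddCommGroup E] [NormedSpace ℝ E] {T : ℝ}
    (hT : 0 < T) (f : ℝ → E) : ∫ t, f t ∂uniformAverage T = T⁻¹ • ∫ t in (0 : ℝ)..T, f t := by
  rw [uniformAverage, integral_smul_measure, intervalIntegral.integral_of_le hT.le,
    ENNReal.toReal_ofReal (by positivity)]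

lemma integrable_uniformAverage_of_continuous {E : Type*} [NormedAddCommGroup E] {f : ℝ → E}
    (hf : Continuous f) (T : ℝ) : Integrable f (uniformAverage T) :=
  ((hf.integrableOn_Icc (a := 0) (b := T)).mono_set Set.Ioc_subset_Icc_self).smul_measure
    ENNReal.ofReal_ne_top

lemma norm_integral_uniformAverage_exp_le {T ω : ℝ} (hT : 0 < T) (hω : ω ≠ 0) :
    ‖∫ t, Complex.exp (((-(t * ω) : ℝ) : ℂ) * I) ∂uniformAverage T‖ ≤ 2 / (T * |ω|) := by
  have hlin (t : ℝ) : ((-(t * ω) : ℝ) : ℂ) * I = -(ω : ℂ) * I * t := by push_cast; ring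
  have hendpoints : ‖Complex.exp (-(ω : ℂ) * I * (T : ℝ)) - Complex.exp (-(ω : ℂ) * I * (0 : ℝ))‖
      ≤ 2 := by
    refine (norm_sub_le _ _).trans ?_
    rw [← hlin, ← hlin, Complex.norm_exp_ofReal_mul_I, Complex.norm_exp_ofReal_mul_I]
    norm_num
  simp only [integral_uniformAverage hT, hlin]
  rw [integral_exp_mul_complex (by simpa using hω), norm_smul, norm_div, norm_mul, norm_neg,
    Complex.norm_I, mul_one, Complex.norm_real, Real.norm_eq_abs ω,
    Real.norm_of_nonneg (inv_nonneg.2 hT.le), inv_mul_eq_div, div_div, mul_comm |ω|]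
  gcongr

end UniformAverage

section MomentComparison

variable {X : Type*} [MeasurableSpace X] {μ : Measure X} [IsProbabilityMeasure μ] {P : X → ℝ}

lemma norm_integral_exp_mul_I_sub_sum_moments_le (hP : ∀ m : ℕ, Integrable (fun x => P x ^ m) μ)
    (n : ℕ) :
    ‖∫ x, Complex.exp (P x * I) ∂μ
        - ∑ m ∈ Finset.range n, I ^ m / (m.factorial : ℂ) * (∫ x, P x ^ m ∂μ : ℝ)‖
      ≤ (∫ x, |P x| ^ n ∂μ) / n.factorial := by
  have hPmeas : AEStronglyMeasurable P μ := by simpa using (hP 1).1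
  have hexp : Integrable (fun x => Complex.exp (P x * I)) μ :=
    .of_bound (Complex.continuous_exp.comp_aestronglyMeasurable
      ((Complex.continuous_ofReal.comp_aestronglyMeasurable hPmeas).mul_const _)) 1
      (ae_of_all _ fun x => (Complex.norm_exp_ofReal_mul_I _).le)
  have hterm_eq (m : ℕ) (x : X) : (P x * I) ^ m / (m.factorial : ℂ)
      = I ^ m / (m.factorial : ℂ) * ((P x ^ m : ℝ) : ℂ) := by push_cast; ring
  have hterm (m : ℕ) : Integrable (fun x => (P x * I) ^ m / (m.factorial : ℂ)) μ := by
    simp only [hterm_eq]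
    exact (hP m).ofReal.const_mul _
  have hsum : ∑ m ∈ Finset.range n, I ^ m / (m.factorial : ℂ) * (∫ x, P x ^ m ∂μ : ℝ)
      = ∫ x, ∑ m ∈ Finset.range n, (P x * I) ^ m / (m.factorial : ℂ) ∂μ := by
    rw [integral_finsetSum _ fun m _ => hterm m]
    simp only [hterm_eq, integral_const_mul, integral_complex_ofReal]
  rw [hsum, ← integral_sub hexp (integrable_finsetSum _ fun m _ => hterm m), ← integral_div]
  refine norm_integral_le_of_norm_le ?_ (ae_of_all _ fun x => norm_exp_mul_I_sub_sum_le n (P x))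
  simpa only [norm_pow, Real.norm_eq_abs] using (hP n).norm.div_const (n.factorial : ℝ)

lemma norm_sum_I_pow_div_factorial_sub_le {a b : ℕ → ℝ} {D : ℝ} {n : ℕ}
    (hab : ∀ m < n, |a m - b m| ≤ D) :
    ‖∑ m ∈ Finset.range n, I ^ m / (m.factorial : ℂ) * (a m : ℝ)
        - ∑ m ∈ Finset.range n, I ^ m / (m.factorial : ℂ) * (b m : ℝ)‖
      ≤ D * ∑ m ∈ Finset.range n, (1 : ℝ) ^ m / m.factorial := by
  rw [← Finset.sum_sub_distrib, Finset.mul_sum]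
  refine norm_sum_le_of_le _ fun m hm => ?_
  rw [← mul_sub, norm_mul, ← Complex.ofReal_sub, Complex.norm_real, norm_div, norm_pow,
    Complex.norm_I, mul_comm, Complex.norm_natCast]
  exact mul_le_mul_of_nonneg_right (hab m (Finset.mem_range.1 hm)) (by positivity)

lemma norm_integral_exp_mul_I_sub_le_of_moments {Y : Type*} [MeasurableSpace Y] {ν : Measure Y}
    [IsProbabilityMeasure ν] {R : Y → ℝ} (hP : ∀ m : ℕ, Integrable (fun x => P x ^ m) μ)
    (hR : ∀ m : ℕ, Integrable (fun y => R y ^ m) ν) (k : ℕ) {D : ℝ}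
    (hD : ∀ m ≤ 2 * k, |∫ x, P x ^ m ∂μ - ∫ y, R y ^ m ∂ν| ≤ D) :
    ‖∫ x, Complex.exp (P x * I) ∂μ - ∫ y, Complex.exp (R y * I) ∂ν‖
      ≤ 3 * D + 2 * ((∫ y, R y ^ (2 * k) ∂ν) / (2 * k).factorial) := by
  have heven (y : ℝ) : |y| ^ (2 * k) = y ^ (2 * k) := (even_two_mul k).pow_abs y
  have hexpP := norm_integral_exp_mul_I_sub_sum_moments_le hP (2 * k)
  have hexpR := norm_integral_exp_mul_I_sub_sum_moments_le hR (2 * k)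
  simp only [heven] at hexpP hexpR
  have hmoments := norm_sum_I_pow_div_factorial_sub_le (a := fun m => ∫ x, P x ^ m ∂μ)
    (b := fun m => ∫ y, R y ^ m ∂ν) fun m hm => hD m hm.le
  have hlast : (∫ x, P x ^ (2 * k) ∂μ) / (2 * k).factorial
      ≤ (∫ y, R y ^ (2 * k) ∂ν) / (2 * k).factorial + D * (1 ^ (2 * k) / (2 * k).factorial) := by
    rw [one_pow, mul_one_div, ← add_div]
    gcongr
    linarith [(abs_le.1 (hD (2 * k) le_rfl)).2]
  have hexp_one : D * ∑ m ∈ Finset.range (2 * k + 1), (1 : ℝ) ^ m / m.factorial ≤ D * 3 := by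
    have hD_nonneg : 0 ≤ D := (abs_nonneg _).trans (hD 0 (Nat.zero_le _))
    gcongr
    exact (Real.sum_le_exp_of_nonneg zero_le_one _).trans (by linarith [Real.exp_one_lt_d9])
  rw [Finset.sum_range_succ, mul_add] at hexp_one
  rw [norm_sub_rev] at hexpR
  have htriangle := (norm_sub_le_norm_sub_add_norm_sub _ _ _).trans
    (add_le_add hexpP ((norm_sub_le_norm_sub_add_norm_sub _ _ _).trans (add_le_add hmoments hexpR)))
  linarith

end MomentComparison

section RandomTrigonometricSum

variable {ι : Type*} [Fintype ι]

/-- The law of a family of independent uniform points of `ℝ / ℤ` indexed by `ι`. -/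
noncomputable abbrev torusMeasure (ι : Type*) [Fintype ι] : Measure (ι → UnitAddCircle) :=
  Measure.pi fun _ => haarAddCircle

/-- The random trigonometric sum `∑ Re (c_n X_n)`, with the `X_n` independent and uniform on the
unit circle. -/
noncomputable def randSum (c : ι → ℂ) (x : ι → UnitAddCircle) : ℝ :=
  ∑ n, (c n * toCircle (x n)).re

/-- The trigonometric polynomial `∑ Re (c_n e^{-itω_n})`, whose values at a random time `t` are
modelled by `randSum c`. -/
noncomputable def trigSum (c : ι → ℂ) (ω : ι → ℝ) (t : ℝ) : ℝ :=
  ∑ n, (c n * Complex.exp (((-(t * ω n) : ℝ) : ℂ) * I)).re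

@[fun_prop]
lemma continuous_randSum (c : ι → ℂ) : Continuous (randSum c) := by
  unfold randSum
  fun_prop

@[fun_prop]
lemma continuous_trigSum (c : ι → ℂ) (ω : ι → ℝ) : Continuous (trigSum c ω) := by
  unfold trigSum
  fun_prop

lemma randSum_ofReal_mul (a : ℝ) (c : ι → ℂ) (x : ι → UnitAddCircle) :
    randSum (fun n => (a : ℂ) * c n) x = a * randSum c x := by
  simp only [randSum, Finset.mul_sum, mul_assoc, Complex.re_ofReal_mul]

lemma integral_exp_randSum (c : ι → ℂ) :
    ∫ x, Complex.exp (randSum c x * I) ∂torusMeasure ι = ∏ n, besselJZero ‖c n‖ := by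
  simp only [randSum, Complex.ofReal_sum, Finset.sum_mul, Complex.exp_sum]
  rw [integral_fintype_prod_eq_prod (f := fun n (y : UnitAddCircle) =>
    Complex.exp (((c n * toCircle y).re : ℂ) * I))]
  exact Finset.prod_congr rfl fun n _ => integral_exp_re_const_mul_toCircle (c n)

lemma integral_cosh_eq {X : Type*} [MeasurableSpace X] {μ : Measure X} {f : X → ℝ}
    (hpos : Integrable (fun x => Real.exp (f x)) μ)
    (hneg : Integrable (fun x => Real.exp (-f x)) μ) :
    ∫ x, Real.cosh (f x) ∂μ = (∫ x, Real.exp (f x) ∂μ + ∫ x, Real.exp (-f x) ∂μ) / 2 := by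
  simp only [Real.cosh_eq]
  rw [integral_div, integral_add hpos hneg]

lemma integral_rexp_re_const_mul_toCircle_le (c : ℂ) :
    ∫ x : UnitAddCircle, Real.exp ((c * toCircle x).re) ∂haarAddCircle
      ≤ Real.exp (‖c‖ ^ 2 / 2) := by
  have hsymm : ∫ x : UnitAddCircle, Real.exp (-(c * toCircle x).re) ∂haarAddCircle
      = ∫ x : UnitAddCircle, Real.exp ((c * toCircle x).re) ∂haarAddCircle := by
    rw [integral_comp_const_mul_toCircle (fun z => Real.exp z.re), ← norm_neg,
      ← integral_comp_const_mul_toCircle (fun z => Real.exp z.re)]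
    simp only [neg_mul, Complex.neg_re]
  have hbound (x : UnitAddCircle) : Real.cosh ((c * toCircle x).re) ≤ Real.exp (‖c‖ ^ 2 / 2) := by
    refine (Real.cosh_le_exp_half_sq _).trans ?_
    have hre : |(c * toCircle x).re| ≤ ‖c‖ :=
      (Complex.abs_re_le_norm _).trans (by rw [norm_mul, Circle.norm_coe, mul_one])
    rw [← sq_abs]
    gcongr
  calc ∫ x : UnitAddCircle, Real.exp ((c * toCircle x).re) ∂haarAddCircle
      = ∫ x : UnitAddCircle, Real.cosh ((c * toCircle x).re) ∂haarAddCircle := by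
        rw [integral_cosh_eq (integrable_of_continuous_of_compactSpace (by fun_prop))
          (integrable_of_continuous_of_compactSpace (by fun_prop)), hsymm]
        ring
    _ ≤ ∫ _ : UnitAddCircle, Real.exp (‖c‖ ^ 2 / 2) ∂haarAddCircle :=
        integral_mono (integrable_of_continuous_of_compactSpace (by fun_prop))
          (integrable_const _) hbound
    _ = Real.exp (‖c‖ ^ 2 / 2) := by simp

lemma integral_rexp_randSum_le (c : ι → ℂ) :
    ∫ x, Real.exp (randSum c x) ∂torusMeasure ι ≤ Real.exp ((∑ n, ‖c n‖ ^ 2) / 2) := by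
  simp only [randSum, Real.exp_sum]
  rw [integral_fintype_prod_eq_prod (f := fun n (y : UnitAddCircle) =>
    Real.exp ((c n * toCircle y).re)), Finset.sum_div, Real.exp_sum]
  exact Finset.prod_le_prod (fun n _ => integral_nonneg fun _ => (Real.exp_pos _).le)
    fun n _ => integral_rexp_re_const_mul_toCircle_le (c n)

lemma pow_two_mul_div_factorial_le_cosh (y : ℝ) (k : ℕ) :
    y ^ (2 * k) / (2 * k).factorial ≤ Real.cosh y :=
  le_hasSum (Real.hasSum_cosh y) k fun j _ => by
    have := (even_two_mul j).pow_nonneg y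
    positivity

lemma integral_randSum_pow_div_factorial_le (c : ι → ℂ) (k : ℕ) {s : ℝ} (hs : 0 < s) :
    (∫ x, randSum c x ^ (2 * k) ∂torusMeasure ι) / (2 * k).factorial
      ≤ Real.exp (s ^ 2 * (∑ n, ‖c n‖ ^ 2) / 2) / s ^ (2 * k) := by
  have hexp (a : ℝ) (ha : a ^ 2 = s ^ 2) : ∫ x, Real.exp (a * randSum c x) ∂torusMeasure ι
      ≤ Real.exp (s ^ 2 * (∑ n, ‖c n‖ ^ 2) / 2) := by
    simp only [← randSum_ofReal_mul]
    refine (integral_rexp_randSum_le _).trans_eq ?_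
    simp only [norm_mul, mul_pow, Complex.norm_real, Real.norm_eq_abs, sq_abs, ha, Finset.mul_sum]
  rw [le_div_iff₀ (by positivity), ← integral_div, ← integral_mul_const]
  calc ∫ x, randSum c x ^ (2 * k) / (2 * k).factorial * s ^ (2 * k) ∂torusMeasure ι
      ≤ ∫ x, Real.cosh (s * randSum c x) ∂torusMeasure ι := by
        refine integral_mono (integrable_of_continuous_of_compactSpace (by fun_prop))
          (integrable_of_continuous_of_compactSpace (by fun_prop)) fun x => ?_
        refine Eq.trans_le ?_ (pow_two_mul_div_factorial_le_cosh (s * randSum c x) k)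
        simp only [mul_pow]
        ring
    _ = (∫ x, Real.exp (s * randSum c x) ∂torusMeasure ι
          + ∫ x, Real.exp (-s * randSum c x) ∂torusMeasure ι) / 2 := by
        simp only [neg_mul]
        exact integral_cosh_eq (integrable_of_continuous_of_compactSpace (by fun_prop))
          (integrable_of_continuous_of_compactSpace (by fun_prop))
    _ ≤ Real.exp (s ^ 2 * (∑ n, ‖c n‖ ^ 2) / 2) := by
        linarith [hexp s rfl, hexp (-s) (neg_sq s)]

end RandomTrigonometricSum

section TrigonometricMoments

variable {ι : Type*}

/-- The coefficients of the expansion `∑ Re (c_n z_n) = ∑_{(n, s)} signedCoeff c (n, s) z_n ^ s`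
for `z_n` on the unit circle. -/
noncomputable def signedCoeff (c : ι → ℂ) (p : ι × ℤˣ) : ℂ :=
  (if p.2 = 1 then c p.1 else (starRingEnd ℂ) (c p.1)) / 2

lemma norm_signedCoeff (c : ι → ℂ) (p : ι × ℤˣ) : ‖signedCoeff c p‖ = ‖c p.1‖ / 2 := by
  unfold signedCoeff
  split_ifs <;> simp

/-- The frequency of the monomial `∏ j, e^{±itω_{n_j}}` picked out by `p j = (n_j, ±1)`. -/
noncomputable def frequency {m : ℕ} (ω : ι → ℝ) (p : Fin m → ι × ℤˣ) : ℝ :=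
  ∑ j, ((p j).2 : ℤ) * ω (p j).1

lemma frequency_eq_zero_iff [Finite ι] [DecidableEq ι] {m : ℕ} {ω : ι → ℝ}
    (hω : LinearIndependent ℚ ω) (p : Fin m → ι × ℤˣ) :
    frequency ω p = 0 ↔ ∀ n, ∑ j with (p j).1 = n, ((p j).2 : ℤ) = 0 := by
  have := Fintype.ofFinite ι
  have hfreq : frequency ω p = ∑ n, ((∑ j with (p j).1 = n, ((p j).2 : ℤ) : ℤ) : ℚ) • ω n := by
    rw [frequency, ← Finset.sum_fiberwise (s := Finset.univ) (g := fun j => (p j).1)]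
    refine Finset.sum_congr rfl fun n _ => ?_
    rw [Rat.smul_def, Rat.cast_intCast, Int.cast_sum, Finset.sum_mul]
    exact Finset.sum_congr rfl fun j hj => by rw [(Finset.mem_filter.1 hj).2]
  rw [hfreq]
  refine ⟨fun h n => ?_, fun h => Finset.sum_eq_zero fun n _ => by rw [h, Int.cast_zero, zero_smul]⟩
  exact_mod_cast Fintype.linearIndependent_iff.1 hω _ h n

variable [Fintype ι]

lemma sum_norm_signedCoeff (c : ι → ℂ) : ∑ p, ‖signedCoeff c p‖ = ∑ n, ‖c n‖ := by
  simp only [norm_signedCoeff, Fintype.sum_prod_type, Finset.sum_const, Finset.card_univ,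
    Fintype.card_units_int, nsmul_eq_mul]
  exact Finset.sum_congr rfl fun n _ => by push_cast; ring

lemma ofReal_sum_re_eq_sum_signedCoeff (c : ι → ℂ) {z : ι → ℂ} (hz : ∀ n, ‖z n‖ = 1) :
    ((∑ n, (c n * z n).re : ℝ) : ℂ)
      = ∑ p : ι × ℤˣ, signedCoeff c p * z p.1 ^ (p.2 : ℤ) := by
  have huniv : (Finset.univ : Finset ℤˣ) = {1, -1} := rfl
  rw [Fintype.sum_prod_type, Complex.ofReal_sum]
  refine Finset.sum_congr rfl fun n _ => ?_
  rw [huniv, Finset.sum_pair (by decide), Complex.re_eq_add_conj, map_mul,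
    ← Complex.inv_eq_conj (hz n)]
  simp only [signedCoeff, if_true, Units.val_one, zpow_one, Units.val_neg, zpow_neg,
    if_neg (by decide : (-1 : ℤˣ) ≠ 1)]
  ring

lemma ofReal_randSum_pow (c : ι → ℂ) (x : ι → UnitAddCircle) (m : ℕ) :
    (randSum c x : ℂ) ^ m = ∑ p : Fin m → ι × ℤˣ, (∏ j, signedCoeff c (p j)) *
      ∏ j, (toCircle (x (p j).1) : ℂ) ^ ((p j).2 : ℤ) := by
  rw [randSum, ofReal_sum_re_eq_sum_signedCoeff c fun n => Circle.norm_coe _]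
  simp only [Fintype.sum_pow, Finset.prod_mul_distrib]

lemma ofReal_trigSum_pow (c : ι → ℂ) (ω : ι → ℝ) (t : ℝ) (m : ℕ) :
    (trigSum c ω t : ℂ) ^ m = ∑ p : Fin m → ι × ℤˣ, (∏ j, signedCoeff c (p j)) *
      Complex.exp (((-(t * frequency ω p) : ℝ) : ℂ) * I) := by
  rw [trigSum, ofReal_sum_re_eq_sum_signedCoeff c fun n => Complex.norm_exp_ofReal_mul_I _]
  simp only [Fintype.sum_pow, Finset.prod_mul_distrib, ← Complex.exp_int_mul, ← Complex.exp_sum]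
  refine Finset.sum_congr rfl fun p _ => ?_
  congr 2
  simp only [frequency, Finset.mul_sum, ← Finset.sum_neg_distrib, Complex.ofReal_sum,
    Finset.sum_mul]
  refine Finset.sum_congr rfl fun j _ => ?_
  push_cast
  ring

lemma prod_fiberwise_zpow [DecidableEq ι] {m : ℕ} (x : ι → UnitAddCircle) (p : Fin m → ι × ℤˣ) :
    ∏ j, (toCircle (x (p j).1) : ℂ) ^ ((p j).2 : ℤ)
      = ∏ n, fourier (∑ j with (p j).1 = n, ((p j).2 : ℤ)) (x n) := by
  rw [← Finset.prod_fiberwise (s := Finset.univ) (g := fun j => (p j).1)]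
  refine Finset.prod_congr rfl fun n _ => ?_
  rw [Finset.prod_congr rfl fun j hj => by
    rw [(Finset.mem_filter.1 hj).2, ← Circle.coe_zpow, ← AddCircle.toCircle_zsmul,
      ← fourier_apply]]
  generalize Finset.univ.filter (fun j => (p j).1 = n) = s
  induction s using Finset.cons_induction with
  | empty => simp
  | cons j s hj ih => rw [Finset.prod_cons, Finset.sum_cons, fourier_add, ih]

lemma integral_fourier (k : ℤ) :
    ∫ x : UnitAddCircle, fourier k x ∂haarAddCircle = if k = 0 then 1 else 0 := by
  split_ifs with hk
  · simp [hk]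
  · exact integral_eq_zero_of_add_right_eq_neg (fourier_add_half_inv_index hk one_pos)

lemma integral_prod_zpow_torusMeasure {m : ℕ} {ω : ι → ℝ} (hω : LinearIndependent ℚ ω)
    (p : Fin m → ι × ℤˣ) :
    ∫ x, ∏ j, (toCircle (x (p j).1) : ℂ) ^ ((p j).2 : ℤ) ∂torusMeasure ι
      = if frequency ω p = 0 then 1 else 0 := by
  classical
  simp only [prod_fiberwise_zpow]
  rw [integral_fintype_prod_eq_prod (f := fun n (y : UnitAddCircle) =>
    fourier (∑ j with (p j).1 = n, ((p j).2 : ℤ)) y)]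
  simp only [integral_fourier, frequency_eq_zero_iff hω, Fintype.prod_ite_zero,
    Finset.prod_const_one]

lemma integral_randSum_pow {ω : ι → ℝ} (hω : LinearIndependent ℚ ω) (c : ι → ℂ) (m : ℕ) :
    ((∫ x, randSum c x ^ m ∂torusMeasure ι : ℝ) : ℂ) = ∑ p : Fin m → ι × ℤˣ,
      (∏ j, signedCoeff c (p j)) * if frequency ω p = 0 then 1 else 0 := by
  classical
  rw [← integral_complex_ofReal]
  simp only [Complex.ofReal_pow, ofReal_randSum_pow]
  rw [integral_finsetSum _ fun p _ => ?_]
  · simp only [integral_const_mul, integral_prod_zpow_torusMeasure hω]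
  · simp only [prod_fiberwise_zpow]
    exact integrable_of_continuous_of_compactSpace (by fun_prop)

lemma integral_trigSum_pow (c : ι → ℂ) (ω : ι → ℝ) (T : ℝ) (m : ℕ) :
    ((∫ t, trigSum c ω t ^ m ∂uniformAverage T : ℝ) : ℂ) = ∑ p : Fin m → ι × ℤˣ,
      (∏ j, signedCoeff c (p j)) *
        ∫ t, Complex.exp (((-(t * frequency ω p) : ℝ) : ℂ) * I) ∂uniformAverage T := by
  rw [← integral_complex_ofReal]
  simp only [Complex.ofReal_pow, ofReal_trigSum_pow]
  rw [integral_finsetSum _ fun p _ => integrable_uniformAverage_of_continuous (by fun_prop) T]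
  simp only [integral_const_mul]

lemma abs_integral_trigSum_pow_sub_le {ω : ι → ℝ} (hω : LinearIndependent ℚ ω) (c : ι → ℂ)
    {T η : ℝ} (hT : 0 < T) (hη : 0 < η) (m : ℕ)
    (hgap : ∀ p : Fin m → ι × ℤˣ, frequency ω p ≠ 0 → η ≤ |frequency ω p|) :
    |∫ t, trigSum c ω t ^ m ∂uniformAverage T - ∫ x, randSum c x ^ m ∂torusMeasure ι|
      ≤ (∑ n, ‖c n‖) ^ m * (2 / (T * η)) := by
  have := isProbabilityMeasure_uniformAverage hT
  rw [← Real.norm_eq_abs, ← Complex.norm_real, Complex.ofReal_sub, integral_trigSum_pow,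
    integral_randSum_pow hω, ← Finset.sum_sub_distrib, ← sum_norm_signedCoeff, Fintype.sum_pow,
    Finset.sum_mul]
  refine norm_sum_le_of_le _ fun p _ => ?_
  rw [← mul_sub, norm_mul, norm_prod]
  refine mul_le_mul_of_nonneg_left ?_ (Finset.prod_nonneg fun _ _ => norm_nonneg _)
  split_ifs with hfreq
  · simp only [hfreq, mul_zero, neg_zero, Complex.ofReal_zero, zero_mul, Complex.exp_zero,
      integral_const, probReal_univ, one_smul, sub_self, norm_zero]
    positivity
  · rw [sub_zero]
    refine (norm_integral_uniformAverage_exp_le hT hfreq).trans ?_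
    have := hgap p hfreq
    gcongr

lemma norm_integral_exp_trigSum_sub_le {ω : ι → ℝ} (hω : LinearIndependent ℚ ω) (c : ι → ℂ)
    {T η A V : ℝ} (hT : 0 < T) (hη : 0 < η) (k : ℕ)
    (hgap : ∀ m ≤ 2 * k, ∀ p : Fin m → ι × ℤˣ, frequency ω p ≠ 0 → η ≤ |frequency ω p|)
    (hcA : ∑ n, ‖c n‖ ≤ A) (hA : 1 ≤ A) (hcV : ∑ n, ‖c n‖ ^ 2 ≤ V) :
    ‖∫ t, Complex.exp (trigSum c ω t * I) ∂uniformAverage T - ∏ n, besselJZero ‖c n‖‖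
      ≤ 6 * A ^ (2 * k) / (T * η) + 2 * Real.exp (4 * V - 2 * k) := by
  have := isProbabilityMeasure_uniformAverage hT
  have hmoments (m : ℕ) (hm : m ≤ 2 * k) :
      |∫ t, trigSum c ω t ^ m ∂uniformAverage T - ∫ x, randSum c x ^ m ∂torusMeasure ι|
        ≤ A ^ (2 * k) * (2 / (T * η)) := by
    refine (abs_integral_trigSum_pow_sub_le hω c hT hη m (hgap m hm)).trans ?_
    gcongr
    calc (∑ n, ‖c n‖) ^ m ≤ A ^ m := by gcongr
      _ ≤ A ^ (2 * k) := pow_le_pow_right₀ hA hm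
  have hlast : (∫ x, randSum c x ^ (2 * k) ∂torusMeasure ι) / (2 * k).factorial
      ≤ Real.exp (4 * V - 2 * k) := by
    refine (integral_randSum_pow_div_factorial_le c k (Real.exp_pos 1)).trans ?_
    have he : Real.exp 1 ^ 2 ≤ 8 := by nlinarith [Real.exp_one_lt_d9, Real.exp_pos 1]
    have hsum : 0 ≤ ∑ n, ‖c n‖ ^ 2 := Finset.sum_nonneg fun _ _ => sq_nonneg _
    rw [← Real.exp_nat_mul 1 (2 * k), ← Real.exp_sub, Real.exp_le_exp]
    push_cast
    nlinarith
  rw [← integral_exp_randSum]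
  refine (norm_integral_exp_mul_I_sub_le_of_moments
    (fun m => integrable_uniformAverage_of_continuous (by fun_prop) T)
    (fun m => integrable_of_continuous_of_compactSpace (by fun_prop)) k hmoments).trans ?_
  exact add_le_add (le_of_eq (by ring)) (mul_le_mul_of_nonneg_left hlast zero_le_two)

end TrigonometricMoments

section PartialSummation

lemma norm_ofReal_cpow_neg_sub_le {s : ℂ} (hs : 0 ≤ s.re) {a b : ℝ} (ha : 1 ≤ a) (hb : 1 ≤ b) :
    ‖(a : ℂ) ^ (-s) - (b : ℂ) ^ (-s)‖ ≤ ‖s‖ * |a - b| := by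
  rcases eq_or_ne s 0 with rfl | hs0
  · simp
  have hderiv : ∀ y ∈ Set.Ici (1 : ℝ),
      HasDerivWithinAt (fun y : ℝ => (y : ℂ) ^ (-s)) (-s * (y : ℂ) ^ (-s - 1)) (Set.Ici 1) y :=
    fun y hy => (hasDerivAt_ofReal_cpow_const (zero_lt_one.trans_le hy).ne'
      (neg_ne_zero.2 hs0)).hasDerivWithinAt
  have hbound : ∀ y ∈ Set.Ici (1 : ℝ), ‖-s * (y : ℂ) ^ (-s - 1)‖ ≤ ‖s‖ := fun y hy => by
    rw [norm_mul, norm_neg, Complex.norm_cpow_eq_rpow_re_of_pos (zero_lt_one.trans_le hy)]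
    refine mul_le_of_le_one_right (norm_nonneg _) (Real.rpow_le_one_of_one_le_of_nonpos hy ?_)
    simp only [Complex.sub_re, Complex.neg_re, Complex.one_re]
    linarith
  simpa only [Real.norm_eq_abs] using
    (convex_Ici (1 : ℝ)).norm_image_sub_le_of_norm_hasDerivWithin_le hderiv hbound hb ha

lemma norm_inv_sub_inv_le {a b : ℂ} {c : ℝ} (hc : 0 < c) (ha : c ≤ ‖a‖) (hb : c ≤ ‖b‖) :
    ‖a⁻¹ - b⁻¹‖ ≤ ‖a - b‖ / c ^ 2 := by
  have ha0 : a ≠ 0 := norm_pos_iff.1 (hc.trans_le ha)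
  have hb0 : b ≠ 0 := norm_pos_iff.1 (hc.trans_le hb)
  rw [← dist_eq_norm, dist_inv_inv₀ ha0 hb0, dist_eq_norm, sq]
  gcongr

lemma norm_sum_Ico_sub_mul_le {H v : ℕ → ℂ} {e : ℕ → ℝ} {B : ℝ} {M Z : ℕ} (hMZ : M ≤ Z)
    (hB : ∀ n ≥ M, ‖H n * v n‖ ≤ B)
    (he : ∀ n ≥ M, ‖H (n + 1) * (v (n + 1) - v n)‖ ≤ e n - e (n + 1)) (he0 : 0 ≤ e Z) :
    ‖∑ n ∈ Finset.Ico M Z, (H (n + 1) - H n) * v n‖ ≤ 2 * B + e M := by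
  have hparts : ∑ n ∈ Finset.Ico M Z, (H (n + 1) - H n) * v n
      = (H Z * v Z - H M * v M) - ∑ n ∈ Finset.Ico M Z, H (n + 1) * (v (n + 1) - v n) := by
    rw [← Finset.sum_Ico_sub (fun n => H n * v n) hMZ, ← Finset.sum_sub_distrib]
    exact Finset.sum_congr rfl fun n _ => by ring
  have hvar : ‖∑ n ∈ Finset.Ico M Z, H (n + 1) * (v (n + 1) - v n)‖ ≤ e M - e Z := by
    refine (norm_sum_le_of_le _ fun n hn => he n (Finset.mem_Ico.1 hn).1).trans_eq ?_
    rw [← neg_sub (e Z), ← Finset.sum_Ico_sub e hMZ, ← Finset.sum_neg_distrib]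
    exact Finset.sum_congr rfl fun n _ => (neg_sub _ _).symm
  rw [hparts]
  have hends := norm_sub_le (H Z * v Z) (H M * v M)
  linarith [norm_sub_le (H Z * v Z - H M * v M)
    (∑ n ∈ Finset.Ico M Z, H (n + 1) * (v (n + 1) - v n)), hB Z hMZ, hB M le_rfl]

end PartialSummation

section LerchSeries

/-- The `n`-th term `e^{2πi lam n} (n + α)^{-s}` of the Lerch series. -/
noncomputable def lerchTerm (lam α : ℝ) (s : ℂ) (n : ℕ) : ℂ :=
  Complex.exp (2 * π * I * lam) ^ n * ((n + α : ℝ) : ℂ) ^ (-s)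

lemma norm_exp_two_pi_I_mul (x : ℝ) : ‖Complex.exp (2 * π * I * x)‖ = 1 := by
  rw [show (2 * π * I * x : ℂ) = ((2 * π * x : ℝ) : ℂ) * I by push_cast; ring,
    Complex.norm_exp_ofReal_mul_I]

lemma exp_two_pi_I_mul_eq_one_iff {x : ℝ} :
    Complex.exp (2 * π * I * x) = 1 ↔ ∃ k : ℤ, x = k := by
  rw [Complex.exp_eq_one_iff]
  refine exists_congr fun k => ?_
  rw [mul_comm, mul_left_inj' Complex.two_pi_I_ne_zero]
  norm_cast

variable {lam α : ℝ} {s : ℂ}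

lemma norm_lerchTerm (hα : 0 < α) (n : ℕ) : ‖lerchTerm lam α s n‖ = (n + α) ^ (-s.re) := by
  rw [lerchTerm, norm_mul, norm_pow, norm_exp_two_pi_I_mul, one_pow, one_mul,
    Complex.norm_cpow_eq_rpow_re_of_pos (by positivity), Complex.neg_re]

lemma shift_succ_cpow (hα : 0 < α) (n : ℕ) (s : ℂ) :
    (((n + 1 : ℕ) + α : ℝ) : ℂ) ^ s
      = ((n + α : ℝ) : ℂ) ^ s * ((1 + (n + α)⁻¹ : ℝ) : ℂ) ^ s := by
  rw [← Complex.mul_cpow_ofReal_nonneg (by positivity) (by positivity), ← Complex.ofReal_mul]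
  congr 2
  push_cast
  field_simp
  ring

lemma rpow_neg_shift_le_of_le (hα : 0 < α) {a : ℝ} (ha : 0 ≤ a) {m n : ℕ} (hmn : m ≤ n) :
    ((n : ℝ) + α) ^ (-a) ≤ (m + α) ^ (-a) :=
  Real.rpow_le_rpow_of_nonpos (by positivity) (by gcongr) (by linarith)

lemma half_le_norm_mul_cpow_sub_one {c : ℂ} (hc : ‖c‖ = 1) {κ x : ℝ} (hκ : κ ≤ ‖c - 1‖)
    (hs : 0 ≤ s.re) (hx : 0 < x) (hsx : 2 * ‖s‖ ≤ κ * x) :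
    κ / 2 ≤ ‖c * ((1 + x⁻¹ : ℝ) : ℂ) ^ (-s) - 1‖ := by
  set q := ((1 + x⁻¹ : ℝ) : ℂ) ^ (-s)
  have hq : ‖q - 1‖ ≤ κ / 2 := by
    have h := norm_ofReal_cpow_neg_sub_le hs (a := 1 + x⁻¹) (b := 1)
      (by linarith [inv_pos.2 hx]) le_rfl
    rw [Complex.ofReal_one, Complex.one_cpow, add_sub_cancel_left, abs_of_pos (inv_pos.2 hx),
      ← div_eq_mul_inv] at h
    exact h.trans ((div_le_iff₀ hx).2 (by linarith))
  have htri := norm_sub_le (c * q - 1) (c * (q - 1))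
  rw [show c * q - 1 - c * (q - 1) = c - 1 by ring, norm_mul, hc, one_mul] at htri
  linarith

lemma norm_inv_mul_cpow_sub_one_sub_le {c : ℂ} (hc : ‖c‖ = 1) (hs : 0 ≤ s.re) {κ u v : ℝ}
    (hκ : 0 < κ) (hu : 0 ≤ u) (huv : u ≤ v) (hcu : κ / 2 ≤ ‖c * ((1 + u : ℝ) : ℂ) ^ (-s) - 1‖)
    (hcv : κ / 2 ≤ ‖c * ((1 + v : ℝ) : ℂ) ^ (-s) - 1‖) :
    ‖(c * ((1 + u : ℝ) : ℂ) ^ (-s) - 1)⁻¹ - (c * ((1 + v : ℝ) : ℂ) ^ (-s) - 1)⁻¹‖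
      ≤ 4 * ‖s‖ / κ ^ 2 * (v - u) := by
  refine (norm_inv_sub_inv_le (half_pos hκ) hcu hcv).trans ?_
  have hcpow := norm_ofReal_cpow_neg_sub_le hs (a := 1 + u) (b := 1 + v) (by linarith) (by linarith)
  rw [add_sub_add_left_eq_sub, abs_sub_comm, abs_of_nonneg (sub_nonneg.2 huv)] at hcpow
  rw [sub_sub_sub_cancel_right, ← mul_sub, norm_mul, hc, one_mul]
  calc _ ≤ ‖s‖ * (v - u) / (κ / 2) ^ 2 := by gcongr
    _ = _ := by field_simp; ring

lemma norm_sum_Ico_lerchTerm_le (hα : 0 < α) {κ : ℝ} (hκ : 0 < κ)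
    (hlam : κ ≤ ‖Complex.exp (2 * π * I * lam) - 1‖) (hs : 0 < s.re) {M Z : ℕ} (hMZ : M ≤ Z)
    (hM : 2 * ‖s‖ ≤ κ * (M + α)) :
    ‖∑ n ∈ Finset.Ico M Z, lerchTerm lam α s n‖ ≤ 6 / κ * (M + α) ^ (-s.re) := by
  set c := Complex.exp (2 * π * I * lam)
  set q : ℕ → ℂ := fun n => ((1 + (n + α)⁻¹ : ℝ) : ℂ) ^ (-s)
  set A := ((M : ℝ) + α) ^ (-s.re)
  have hx : ∀ n : ℕ, 0 < (n : ℝ) + α := fun n => by positivity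
  have hA0 : 0 ≤ A := Real.rpow_nonneg (hx M).le _
  have hterm : ∀ n ≥ M, ‖lerchTerm lam α s n‖ ≤ A := fun n hn => by
    rw [norm_lerchTerm hα]
    exact rpow_neg_shift_le_of_le hα hs.le hn
  have hd : ∀ n ≥ M, κ / 2 ≤ ‖c * q n - 1‖ := fun n hn =>
    half_le_norm_mul_cpow_sub_one (norm_exp_two_pi_I_mul lam) hlam hs.le (hx n)
      (hM.trans (by gcongr))
  have hv : ∀ n ≥ M, ‖lerchTerm lam α s n * (c * q n - 1)⁻¹‖ ≤ A * (2 / κ) := fun n hn => by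
    rw [norm_mul, norm_inv, ← inv_div κ 2]
    gcongr
    exacts [hterm n hn, hd n hn]
  have hvar : ∀ n ≥ M,
      ‖lerchTerm lam α s (n + 1) * ((c * q (n + 1) - 1)⁻¹ - (c * q n - 1)⁻¹)‖
        ≤ A * (4 * ‖s‖ / κ ^ 2) * ((n : ℝ) + α)⁻¹
          - A * (4 * ‖s‖ / κ ^ 2) * (((n + 1 : ℕ) : ℝ) + α)⁻¹ := fun n hn => by
    have hinv : (((n + 1 : ℕ) : ℝ) + α)⁻¹ ≤ ((n : ℝ) + α)⁻¹ :=
      inv_anti₀ (hx n) (by push_cast; linarith)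
    rw [← mul_sub, mul_assoc, norm_mul]
    exact mul_le_mul (hterm _ (by omega)) (norm_inv_mul_cpow_sub_one_sub_le
      (norm_exp_two_pi_I_mul lam) hs.le hκ (inv_pos.2 (hx (n + 1))).le hinv (hd _ (by omega))
      (hd n hn)) (norm_nonneg _) hA0
  have hstep : ∀ n ∈ Finset.Ico M Z, lerchTerm lam α s n
      = (lerchTerm lam α s (n + 1) - lerchTerm lam α s n) * (c * q n - 1)⁻¹ := fun n hn => by
    have hdn : c * q n - 1 ≠ 0 :=
      norm_pos_iff.1 ((half_pos hκ).trans_le (hd n (Finset.mem_Ico.1 hn).1))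
    rw [eq_mul_inv_iff_mul_eq₀ hdn, lerchTerm, lerchTerm, shift_succ_cpow hα]
    ring
  rw [Finset.sum_congr rfl hstep]
  refine (norm_sum_Ico_sub_mul_le hMZ hv hvar (by positivity)).trans ?_
  have hfinal : 4 * ‖s‖ / κ ^ 2 * ((M : ℝ) + α)⁻¹ ≤ 2 / κ := by
    rw [← div_eq_mul_inv, div_div, div_le_div_iff₀ (by positivity) hκ]
    nlinarith
  calc _ = A * (4 / κ + 4 * ‖s‖ / κ ^ 2 * ((M : ℝ) + α)⁻¹) := by ring
    _ ≤ A * (4 / κ + 2 / κ) := by gcongr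
    _ = 6 / κ * A := by ring

lemma tendsto_sum_lerchTerm (hα : 0 < α) (hlam : ¬ ∃ k : ℤ, lam = k) (hs : 0 < s.re) :
    Tendsto (fun N => ∑ n ∈ Finset.range N, lerchTerm lam α s n) atTop
      (𝓝 (lerchZeta lam α s)) := by
  have hdef : lerchZeta lam α s
      = limUnder atTop fun N : ℕ => ∑ n ∈ Finset.range N, lerchTerm lam α s n := by
    rw [lerchZeta, if_neg hlam]
    congr 1 with N
    refine Finset.sum_congr rfl fun n _ => ?_
    rw [lerchTerm, Complex.cpow_neg, ← Complex.exp_nat_mul, div_eq_mul_inv]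
    push_cast
    ring_nf
  rw [hdef]
  refine CauchySeq.tendsto_limUnder (Metric.cauchySeq_iff'.2 fun ε hε => ?_)
  set κ := ‖Complex.exp (2 * π * I * lam) - 1‖
  have hκ : 0 < κ :=
    norm_pos_iff.2 (sub_ne_zero.2 (mt exp_two_pi_I_mul_eq_one_iff.1 hlam))
  have hshift : Tendsto (fun M : ℕ => (M : ℝ) + α) atTop atTop :=
    tendsto_atTop_add_const_right _ _ tendsto_natCast_atTop_atTop
  have htail : Tendsto (fun M : ℕ => 6 / κ * ((M : ℝ) + α) ^ (-s.re)) atTop (𝓝 0) := by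
    simpa only [mul_zero, Function.comp_def] using
      ((tendsto_rpow_neg_atTop hs).comp hshift).const_mul (6 / κ)
  obtain ⟨M, hMε, hMs⟩ := ((htail.eventually (gt_mem_nhds hε)).and
    ((hshift.const_mul_atTop hκ).eventually_ge_atTop (2 * ‖s‖))).exists
  refine ⟨M, fun Z hZ => ?_⟩
  rw [dist_eq_norm, ← Finset.sum_Ico_eq_sub _ hZ]
  exact (norm_sum_Ico_lerchTerm_le hα hκ le_rfl hs hZ hMs).trans_lt hMε

lemma norm_lerchZeta_sub_sum_le_of_not_int (hα : 0 < α) (hlam : ¬ ∃ k : ℤ, lam = k) {κ : ℝ}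
    (hκ : 0 < κ) (hκlam : κ ≤ ‖Complex.exp (2 * π * I * lam) - 1‖) (hs : 0 < s.re) {M : ℕ}
    (hM : 2 * ‖s‖ ≤ κ * (M + α)) :
    ‖lerchZeta lam α s - ∑ n ∈ Finset.range M, lerchTerm lam α s n‖
      ≤ 6 / κ * (M + α) ^ (-s.re) := by
  refine le_of_tendsto ((tendsto_sum_lerchTerm hα hlam hs).sub_const _).norm ?_
  filter_upwards [eventually_ge_atTop M] with Z hZ
  rw [← Finset.sum_Ico_eq_sub _ hZ]
  exact norm_sum_Ico_lerchTerm_le hα hκ hκlam hs hZ hM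

end LerchSeries

section HurwitzApproximation

/-- The mean `∫₀¹ (1 + uv)^{-s} dv`; for `s ≠ 1` and `u > 0` it equals
`((1 + u)^{1 - s} - 1) / (u (1 - s))`. -/
noncomputable def meanCpow (s : ℂ) (u : ℝ) : ℂ := ∫ v in (0 : ℝ)..1, ((1 + u * v : ℝ) : ℂ) ^ (-s)

variable {s : ℂ}

lemma one_le_one_add_mul {u v : ℝ} (hu : 0 ≤ u) (hv : v ∈ Set.Icc (0 : ℝ) 1) : 1 ≤ 1 + u * v :=
  le_add_of_nonneg_right (mul_nonneg hu hv.1)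

lemma intervalIntegrable_one_add_mul_cpow (s : ℂ) {u : ℝ} (hu : 0 ≤ u) :
    IntervalIntegrable (fun v : ℝ => ((1 + u * v : ℝ) : ℂ) ^ (-s)) volume 0 1 := by
  refine (ContinuousOn.cpow_const (by fun_prop) fun v hv => ?_).intervalIntegrable
  rw [Set.uIcc_of_le zero_le_one] at hv
  exact Complex.ofReal_mem_slitPlane.2 (zero_lt_one.trans_le (one_le_one_add_mul hu hv))

lemma norm_meanCpow_sub_le (hs : 0 ≤ s.re) {u u' : ℝ} (hu : 0 ≤ u) (hu' : 0 ≤ u') :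
    ‖meanCpow s u - meanCpow s u'‖ ≤ ‖s‖ * |u - u'| := by
  have hbound : ∀ v ∈ Set.uIoc (0 : ℝ) 1,
      ‖((1 + u * v : ℝ) : ℂ) ^ (-s) - ((1 + u' * v : ℝ) : ℂ) ^ (-s)‖ ≤ ‖s‖ * |u - u'| := by
    intro v hv
    rw [Set.uIoc_of_le zero_le_one] at hv
    have hv' := Set.Ioc_subset_Icc_self hv
    refine (norm_ofReal_cpow_neg_sub_le hs (one_le_one_add_mul hu hv')
      (one_le_one_add_mul hu' hv')).trans ?_
    rw [add_sub_add_left_eq_sub, ← sub_mul, abs_mul, abs_of_pos hv.1]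
    gcongr
    exact mul_le_of_le_one_right (abs_nonneg _) hv.2
  rw [meanCpow, meanCpow, ← intervalIntegral.integral_sub
    (intervalIntegrable_one_add_mul_cpow s hu) (intervalIntegrable_one_add_mul_cpow s hu')]
  simpa only [sub_zero, abs_one, mul_one]
    using intervalIntegral.norm_integral_le_of_norm_le_const hbound

lemma meanCpow_zero (s : ℂ) : meanCpow s 0 = 1 := by simp [meanCpow]

lemma norm_meanCpow_sub_one_le (hs : 0 ≤ s.re) {u : ℝ} (hu : 0 ≤ u) :
    ‖meanCpow s u - 1‖ ≤ ‖s‖ * u := by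
  simpa only [meanCpow_zero, sub_zero, abs_of_nonneg hu] using norm_meanCpow_sub_le hs hu le_rfl

lemma mul_one_sub_mul_meanCpow (hs : s ≠ 1) {u : ℝ} (hu : 0 ≤ u) :
    (u : ℂ) * ((1 - s) * meanCpow s u) = ((1 + u : ℝ) : ℂ) ^ (1 - s) - 1 := by
  have hderiv : ∀ v ∈ Set.uIcc (0 : ℝ) 1,
      HasDerivAt (fun v : ℝ => ((1 + u * v : ℝ) : ℂ) ^ (1 - s))
        ((u : ℂ) * ((1 - s) * ((1 + u * v : ℝ) : ℂ) ^ (-s))) v := by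
    intro v hv
    rw [Set.uIcc_of_le zero_le_one] at hv
    have hpos := zero_lt_one.trans_le (one_le_one_add_mul hu hv)
    have hinner : HasDerivAt (fun v : ℝ => 1 + u * v) u v := by
      simpa only [mul_one] using ((hasDerivAt_id' v).const_mul u).const_add 1
    refine ((hasDerivAt_ofReal_cpow_const hpos.ne'
      (sub_ne_zero.2 hs.symm)).scomp v hinner).congr_deriv ?_
    rw [Complex.real_smul, sub_sub_cancel_left]
  have hint := intervalIntegral.integral_eq_sub_of_hasDerivAt hderiv
    (((intervalIntegrable_one_add_mul_cpow s hu).const_mul _).const_mul _)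
  rw [intervalIntegral.integral_const_mul, intervalIntegral.integral_const_mul] at hint
  simpa only [meanCpow, mul_one, mul_zero, add_zero, Complex.ofReal_one, Complex.one_cpow]
    using hint

/-- The approximation `∑_{n < Z} (n + α)^{-s} - (Z + α)^{1 - s} / (1 - s)` to the Hurwitz zeta
function, in which the second term is the main term of the Euler–Maclaurin formula. -/
noncomputable def hurwitzApprox (α : ℝ) (s : ℂ) (Z : ℕ) : ℂ :=
  ∑ n ∈ Finset.range Z, ((n + α : ℝ) : ℂ) ^ (-s) - ((Z + α : ℝ) : ℂ) ^ (1 - s) / (1 - s)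

variable {α : ℝ}

lemma shift_cpow_one_sub_succ_sub (hα : 0 < α) (hs : s ≠ 1) (n : ℕ) :
    (((n + 1 : ℕ) + α : ℝ) : ℂ) ^ (1 - s) - ((n + α : ℝ) : ℂ) ^ (1 - s)
      = ((n + α : ℝ) : ℂ) ^ (-s) * ((1 - s) * meanCpow s (n + α)⁻¹) := by
  have hx : 0 < (n : ℝ) + α := by positivity
  have hx0 : ((n + α : ℝ) : ℂ) ≠ 0 := Complex.ofReal_ne_zero.2 hx.ne'
  have hsplit : ((n + α : ℝ) : ℂ) ^ (1 - s) = ((n + α : ℝ) : ℂ) ^ (-s) * ((n + α : ℝ) : ℂ) := by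
    rw [sub_eq_neg_add, Complex.cpow_add _ _ hx0, Complex.cpow_one]
  have hmean := mul_one_sub_mul_meanCpow hs (inv_pos.2 hx).le
  rw [Complex.ofReal_inv, inv_mul_eq_iff_eq_mul₀ hx0] at hmean
  rw [shift_succ_cpow hα, hmean, hsplit]
  ring

lemma hurwitzApprox_succ_sub (hα : 0 < α) (hs : s ≠ 1) (Z : ℕ) :
    hurwitzApprox α s (Z + 1) - hurwitzApprox α s Z
      = ((Z + α : ℝ) : ℂ) ^ (-s) * (1 - meanCpow s (Z + α)⁻¹) := by
  have hs' : 1 - s ≠ 0 := sub_ne_zero.2 hs.symm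
  rw [hurwitzApprox, hurwitzApprox, Finset.sum_range_succ,
    eq_add_of_sub_eq (shift_cpow_one_sub_succ_sub hα hs Z)]
  field_simp
  ring

lemma norm_hurwitzApprox_succ_sub_le (hα : 0 < α) (hs : 0 ≤ s.re) (hs1 : s ≠ 1) (Z : ℕ) :
    ‖hurwitzApprox α s (Z + 1) - hurwitzApprox α s Z‖ ≤ ‖s‖ * (Z + α) ^ (-s.re - 1) := by
  have hx : 0 < (Z : ℝ) + α := by positivity
  rw [hurwitzApprox_succ_sub hα hs1, norm_mul, norm_sub_rev,
    Complex.norm_cpow_eq_rpow_re_of_pos hx, Complex.neg_re, Real.rpow_sub_one hx.ne']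
  calc _ ≤ (Z + α) ^ (-s.re) * (‖s‖ * (Z + α)⁻¹) := by
        gcongr
        exact norm_meanCpow_sub_one_le hs (inv_pos.2 hx).le
    _ = _ := by ring

lemma differentiableAt_hurwitzApprox (hα : 0 < α) (hs : s ≠ 1) (Z : ℕ) :
    DifferentiableAt ℂ (fun s => hurwitzApprox α s Z) s := by
  have hcpow : ∀ (n : ℕ) {f : ℂ → ℂ}, DifferentiableAt ℂ f s →
      DifferentiableAt ℂ (fun s => ((n + α : ℝ) : ℂ) ^ f s) s := fun n _ hf =>
    hf.const_cpow (Or.inl (Complex.ofReal_ne_zero.2 (by positivity)))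
  exact (DifferentiableAt.fun_sum fun n _ => hcpow n (by fun_prop)).sub
    ((hcpow Z (by fun_prop)).div (by fun_prop) (sub_ne_zero.2 hs.symm))

lemma exists_differentiableOn_tendsto_hurwitzApprox (hα : 0 < α) {U : Set ℂ} (hU : IsOpen U)
    (h1 : 1 ∉ U) {δ R : ℝ} (hδ : 0 < δ) (hre : ∀ s ∈ U, δ ≤ s.re) (hR : ∀ s ∈ U, ‖s‖ ≤ R) :
    ∃ F : ℂ → ℂ, DifferentiableOn ℂ F U ∧
      ∀ s ∈ U, Tendsto (hurwitzApprox α s) atTop (𝓝 (F s)) := by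
  have hne : ∀ s ∈ U, s ≠ 1 := fun s hs h => h1 (h ▸ hs)
  have hdiff : ∀ Z, DifferentiableOn ℂ (fun s => hurwitzApprox α s Z) U := fun Z s hs =>
    (differentiableAt_hurwitzApprox hα (hne s hs) Z).differentiableWithinAt
  let increment (n : ℕ) (s : ℂ) := hurwitzApprox α s (n + 1 + 1) - hurwitzApprox α s (n + 1)
  have hbound : ∀ n, ∀ s ∈ U, ‖increment n s‖ ≤ R * ((n + 1 : ℕ) : ℝ) ^ (-δ - 1) := by
    intro n s hs
    have hn : (1 : ℝ) ≤ (n + 1 : ℕ) := by exact_mod_cast n.succ_pos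
    refine (norm_hurwitzApprox_succ_sub_le hα (hδ.le.trans (hre s hs)) (hne s hs) _).trans ?_
    refine mul_le_mul (hR s hs) ?_ (by positivity) ((norm_nonneg s).trans (hR s hs))
    calc (((n + 1 : ℕ) : ℝ) + α) ^ (-s.re - 1) ≤ ((n + 1 : ℕ) : ℝ) ^ (-s.re - 1) :=
          Real.rpow_le_rpow_of_nonpos (by linarith) (by linarith) (by linarith [hre s hs])
      _ ≤ _ := Real.rpow_le_rpow_of_exponent_le hn (by linarith [hre s hs])
  have hsummable : Summable fun n : ℕ => R * ((n + 1 : ℕ) : ℝ) ^ (-δ - 1) :=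
    ((summable_nat_add_iff 1).2 (Real.summable_nat_rpow.2 (by linarith))).mul_left R
  refine ⟨fun s => hurwitzApprox α s 1 + ∑' n, increment n s, (hdiff 1).add
    (Complex.differentiableOn_tsum_of_summable_norm hsummable
      (fun n => (hdiff _).sub (hdiff _)) hU hbound), fun s hs => ?_⟩
  rw [← tendsto_add_atTop_iff_nat 1]
  have hsum := (Summable.of_norm_bounded hsummable fun n => hbound n s hs).hasSum.tendsto_sum_nat
  refine (hsum.const_add (hurwitzApprox α s 1)).congr fun Z => ?_
  rw [Finset.sum_range_sub fun n => hurwitzApprox α s (n + 1)]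
  exact add_sub_cancel _ _

lemma tendsto_hurwitzApprox_of_one_lt_re (hα : α ∈ Set.Ioc (0 : ℝ) 1) (hs : 1 < s.re) :
    Tendsto (hurwitzApprox α s) atTop (𝓝 (HurwitzZeta.hurwitzZeta (α : UnitAddCircle) s)) := by
  have hsum := (HurwitzZeta.hasSum_hurwitzZeta_of_one_lt_re
    (Set.Ioc_subset_Icc_self hα) hs).tendsto_sum_nat
  have hmain : Tendsto (fun Z : ℕ => ((Z + α : ℝ) : ℂ) ^ (1 - s) / (1 - s)) atTop (𝓝 0) := by
    have hnorm : ∀ Z : ℕ, ‖((Z + α : ℝ) : ℂ) ^ (1 - s) / (1 - s)‖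
        = ((Z : ℝ) + α) ^ (-(s.re - 1)) / ‖1 - s‖ := fun Z => by
      have hx : 0 < (Z : ℝ) + α := add_pos_of_nonneg_of_pos Z.cast_nonneg hα.1
      rw [norm_div, Complex.norm_cpow_eq_rpow_re_of_pos hx, Complex.sub_re, Complex.one_re, neg_sub]
    rw [tendsto_zero_iff_norm_tendsto_zero]
    simp only [hnorm]
    simpa only [zero_div, Function.comp_def] using ((tendsto_rpow_neg_atTop (sub_pos.2 hs)).comp
      (tendsto_atTop_add_const_right _ α tendsto_natCast_atTop_atTop)).div_const ‖1 - s‖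
  rw [← sub_zero (HurwitzZeta.hurwitzZeta _ _)]
  refine (hsum.sub hmain).congr fun Z => ?_
  rw [hurwitzApprox]
  congr 1
  refine Finset.sum_congr rfl fun n _ => ?_
  rw [Complex.cpow_neg, one_div]
  push_cast
  rfl

lemma tendsto_hurwitzApprox (hα : α ∈ Set.Ioc (0 : ℝ) 1) (hre : 0 < s.re) (him : 0 < s.im) :
    Tendsto (hurwitzApprox α s) atTop (𝓝 (HurwitzZeta.hurwitzZeta (α : UnitAddCircle) s)) := by
  set U : Set ℂ := {z | s.re / 2 < z.re} ∩ {z | 0 < z.im} ∩ Metric.ball 0 (‖s‖ + 3)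
  have hU : IsOpen U := ((isOpen_lt continuous_const Complex.continuous_re).inter
    (isOpen_lt continuous_const Complex.continuous_im)).inter Metric.isOpen_ball
  have hconvex : Convex ℝ U := ((convex_halfSpace_re_gt _).inter (convex_halfSpace_im_gt _)).inter
    (convex_ball _ _)
  have h1U : (1 : ℂ) ∉ U := fun h => lt_irrefl (0 : ℝ) h.1.2
  obtain ⟨F, hF, hlim⟩ := exists_differentiableOn_tendsto_hurwitzApprox hα.1 hU h1U
    (half_pos hre) (fun z hz => hz.1.1.le) fun z hz => (mem_ball_zero_iff.1 hz.2).le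
  have hζ : DifferentiableOn ℂ (HurwitzZeta.hurwitzZeta (α : UnitAddCircle)) U := fun z hz =>
    (HurwitzZeta.differentiableAt_hurwitzZeta _ fun h => h1U (h ▸ hz)).differentiableWithinAt
  have hsU : s ∈ U := ⟨⟨half_lt_self hre, him⟩, mem_ball_zero_iff.2 (by linarith)⟩
  have hs2U : s + 2 ∈ U := by
    refine ⟨⟨?_, ?_⟩, mem_ball_zero_iff.2 ((norm_add_le s 2).trans_lt (by norm_num))⟩
    · change s.re / 2 < s.re + 2
      linarith
    · change 0 < s.im + 0
      linarith
  have hnhds : {z : ℂ | 1 < z.re} ∩ U ∈ 𝓝 (s + 2) :=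
    ((isOpen_lt continuous_const Complex.continuous_re).inter hU).mem_nhds
      ⟨show 1 < s.re + 2 by linarith, hs2U⟩
  have heq : Set.EqOn F (HurwitzZeta.hurwitzZeta (α : UnitAddCircle)) U :=
    (hF.analyticOnNhd hU).eqOn_of_preconnected_of_eventuallyEq (hζ.analyticOnNhd hU)
      hconvex.isPreconnected hs2U <| by
      filter_upwards [hnhds] with z hz
      exact tendsto_nhds_unique (hlim z hz.2) (tendsto_hurwitzApprox_of_one_lt_re hα hz.1)
  exact heq hsU ▸ hlim s hsU

end HurwitzApproximation

section Truncation

lemma mul_rpow_neg_sub_one_le {a x : ℝ} (ha : 0 ≤ a) (hx : 0 < x) :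
    a * (x + 1) ^ (-a - 1) ≤ x ^ (-a) - (x + 1) ^ (-a) := by
  have hx1 : 0 < x + 1 := by linarith
  have hlog : (x + 1)⁻¹ ≤ Real.log ((x + 1) / x) := by
    refine le_trans (le_of_eq ?_) (Real.one_sub_inv_le_log_of_pos (by positivity))
    field_simp
    ring
  have hbernoulli : 1 + a * (x + 1)⁻¹ ≤ x ^ (-a) / (x + 1) ^ (-a) := by
    calc 1 + a * (x + 1)⁻¹ ≤ Real.log ((x + 1) / x) * a + 1 := by
          linarith [mul_le_mul_of_nonneg_left hlog ha]
      _ ≤ ((x + 1) / x) ^ a := by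
          rw [Real.rpow_def_of_pos (by positivity)]
          exact Real.add_one_le_exp _
      _ = x ^ (-a) / (x + 1) ^ (-a) := by
          rw [Real.div_rpow hx1.le hx.le, Real.rpow_neg hx.le, Real.rpow_neg hx1.le, inv_div_inv]
  rw [le_div_iff₀ (Real.rpow_pos_of_pos hx1 _)] at hbernoulli
  rw [Real.rpow_sub_one hx1.ne', div_eq_mul_inv]
  linarith

lemma rpow_neg_div_le {a x : ℝ} (ha : 1 / 2 ≤ a) (hx : 2 ≤ x) :
    (x + 1) ^ (-a) / x ≤ 3 * (x ^ (-a) - (x + 1) ^ (-a)) := by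
  have hx1 : 0 < x + 1 := by linarith
  have hpow : (x + 1) ^ (-a) / x ≤ 3 / 2 * (x + 1) ^ (-a - 1) := by
    rw [Real.rpow_sub_one hx1.ne', mul_div_assoc', div_le_div_iff₀ (by linarith) hx1]
    nlinarith [Real.rpow_pos_of_pos hx1 (-a)]
  nlinarith [mul_rpow_neg_sub_one_le (by linarith : 0 ≤ a) (by linarith : 0 < x),
    Real.rpow_pos_of_pos hx1 (-a - 1)]

variable {α : ℝ} {s : ℂ}

lemma half_le_norm_meanCpow (hs : 0 ≤ s.re) {u : ℝ} (hu : 0 ≤ u) (hsu : ‖s‖ * u ≤ 1 / 2) :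
    1 / 2 ≤ ‖meanCpow s u‖ := by
  have hdist := (norm_meanCpow_sub_one_le hs hu).trans hsu
  have htri := norm_sub_norm_le 1 (meanCpow s u)
  rw [norm_one, norm_sub_rev] at htri
  linarith

lemma im_le_norm_one_sub (s : ℂ) : s.im ≤ ‖1 - s‖ := by
  simpa only [Complex.sub_im, Complex.one_im, zero_sub, neg_neg] using
    (neg_le_abs _).trans (Complex.abs_im_le_norm (1 - s))

lemma norm_inv_one_sub_mul_norm_le (him : 1 ≤ s.im) : ‖1 - s‖⁻¹ * ‖s‖ ≤ 2 := by
  have him' := im_le_norm_one_sub s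
  have htri := norm_sub_norm_le s 1
  rw [norm_one, norm_sub_rev] at htri
  rw [inv_mul_le_iff₀ (by linarith)]
  linarith

/-- The factor `((meanCpow s u)⁻¹ - 1) / (1 - s)`: with `u = (n + α)⁻¹` it is the ratio of the
`n`-th increments of `hurwitzApprox α s` and of `(n + α)^{1 - s}`. -/
noncomputable def incrementRatio (s : ℂ) (u : ℝ) : ℂ := (1 - s)⁻¹ * ((meanCpow s u)⁻¹ - 1)

lemma norm_incrementRatio_le (hre : 0 ≤ s.re) (him : 1 ≤ s.im) {u : ℝ} (hu : 0 ≤ u)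
    (hsu : ‖s‖ * u ≤ 1 / 2) : ‖incrementRatio s u‖ ≤ 4 * u := by
  have hk := half_le_norm_meanCpow hre hu hsu
  have hk0 : meanCpow s u ≠ 0 := norm_pos_iff.1 (one_half_pos.trans_le hk)
  have hinv : ‖(meanCpow s u)⁻¹ - 1‖ ≤ 2 * (‖s‖ * u) := by
    rw [show (meanCpow s u)⁻¹ - 1 = (1 - meanCpow s u) / meanCpow s u by field_simp, norm_div,
      norm_sub_rev, div_le_iff₀ (one_half_pos.trans_le hk)]
    nlinarith [norm_meanCpow_sub_one_le hre hu, mul_nonneg (norm_nonneg s) hu]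
  calc ‖incrementRatio s u‖ ≤ ‖1 - s‖⁻¹ * (2 * (‖s‖ * u)) := by
        rw [incrementRatio, norm_mul, norm_inv]
        gcongr
    _ = ‖1 - s‖⁻¹ * ‖s‖ * (2 * u) := by ring
    _ ≤ 2 * (2 * u) := by
        gcongr
        exact norm_inv_one_sub_mul_norm_le him
    _ = 4 * u := by ring

lemma norm_incrementRatio_sub_le (hre : 0 ≤ s.re) (him : 1 ≤ s.im) {u u' : ℝ} (hu : 0 ≤ u)
    (hu' : 0 ≤ u') (hsu : ‖s‖ * u ≤ 1 / 2) (hsu' : ‖s‖ * u' ≤ 1 / 2) :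
    ‖incrementRatio s u - incrementRatio s u'‖ ≤ 8 * |u - u'| := by
  have hinv := norm_inv_sub_inv_le one_half_pos (half_le_norm_meanCpow hre hu hsu)
    (half_le_norm_meanCpow hre hu' hsu')
  rw [show ((1 : ℝ) / 2) ^ 2 = 4⁻¹ by norm_num, div_inv_eq_mul] at hinv
  have hmean := norm_meanCpow_sub_le hre hu hu'
  calc ‖incrementRatio s u - incrementRatio s u'‖
      = ‖1 - s‖⁻¹ * ‖(meanCpow s u)⁻¹ - (meanCpow s u')⁻¹‖ := by
        rw [incrementRatio, incrementRatio, ← mul_sub, sub_sub_sub_cancel_right, norm_mul, norm_inv]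
    _ ≤ ‖1 - s‖⁻¹ * (4 * (‖s‖ * |u - u'|)) := by
        gcongr
        linarith
    _ = ‖1 - s‖⁻¹ * ‖s‖ * (4 * |u - u'|) := by ring
    _ ≤ 2 * (4 * |u - u'|) := by
        gcongr
        exact norm_inv_one_sub_mul_norm_le him
    _ = 8 * |u - u'| := by ring

lemma hurwitzApprox_succ_sub_eq_mul_incrementRatio (hα : 0 < α) (hs : s ≠ 1) {n : ℕ}
    (hk : meanCpow s (n + α)⁻¹ ≠ 0) :
    hurwitzApprox α s (n + 1) - hurwitzApprox α s n
      = (((n + 1 : ℕ) + α : ℝ) ^ (1 - s) - ((n + α : ℝ) : ℂ) ^ (1 - s))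
        * incrementRatio s (n + α)⁻¹ := by
  have hs' : 1 - s ≠ 0 := sub_ne_zero.2 hs.symm
  rw [hurwitzApprox_succ_sub hα hs, shift_cpow_one_sub_succ_sub hα hs, incrementRatio]
  generalize meanCpow s (n + α)⁻¹ = k at hk ⊢
  field_simp

lemma norm_cpow_mul_incrementRatio_sub_le (hre : 1 / 2 ≤ s.re) (him : 1 ≤ s.im) {x : ℝ}
    (hx : 2 * ‖s‖ ≤ x) :
    ‖((x + 1 : ℝ) : ℂ) ^ (1 - s) * (incrementRatio s (x + 1)⁻¹ - incrementRatio s x⁻¹)‖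
      ≤ 24 * (x ^ (-s.re) - (x + 1) ^ (-s.re)) := by
  have hx2 : 2 ≤ x := by linarith [(le_abs_self _).trans (Complex.abs_im_le_norm s)]
  have hx0 : 0 < x := by linarith
  have hinv : (x + 1)⁻¹ ≤ x⁻¹ := inv_anti₀ hx0 (by linarith)
  have hsx : ‖s‖ * x⁻¹ ≤ 1 / 2 := by
    rw [← div_eq_mul_inv, div_le_iff₀ hx0]
    linarith
  have hratio := norm_incrementRatio_sub_le (by linarith) him (u := (x + 1)⁻¹) (by positivity)
    (inv_pos.2 hx0).le ((mul_le_mul_of_nonneg_left hinv (norm_nonneg s)).trans hsx) hsx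
  rw [abs_sub_comm, abs_of_nonneg (sub_nonneg.2 hinv)] at hratio
  have hcpow : ‖((x + 1 : ℝ) : ℂ) ^ (1 - s)‖ = (x + 1) ^ (-s.re) * (x + 1) := by
    rw [Complex.norm_cpow_eq_rpow_re_of_pos (by linarith), ← Real.rpow_add_one (by linarith),
      Complex.sub_re, Complex.one_re, sub_eq_neg_add]
  rw [norm_mul, hcpow]
  calc _ ≤ (x + 1) ^ (-s.re) * (x + 1) * (8 * (x⁻¹ - (x + 1)⁻¹)) := by gcongr
    _ = 8 * ((x + 1) ^ (-s.re) / x) := by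
        field_simp
        ring
    _ ≤ 8 * (3 * (x ^ (-s.re) - (x + 1) ^ (-s.re))) := by
        gcongr
        exact rpow_neg_div_le hre hx2
    _ = _ := by ring

lemma norm_hurwitzApprox_sub_hurwitzApprox_le (hα : 0 < α) (hre : 1 / 2 ≤ s.re) (him : 1 ≤ s.im)
    {M Z : ℕ} (hMZ : M ≤ Z) (hM : 2 * ‖s‖ ≤ M + α) :
    ‖hurwitzApprox α s Z - hurwitzApprox α s M‖ ≤ 32 * (M + α) ^ (-s.re) := by
  have hre0 : 0 ≤ s.re := by linarith
  have hx : ∀ n : ℕ, 0 < (n : ℝ) + α := fun n => by positivity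
  have hs1 : s ≠ 1 := fun h => by norm_num [h] at him
  have hsx : ∀ n ≥ M, 2 * ‖s‖ ≤ n + α := fun n hn => hM.trans (by gcongr)
  have hsx' : ∀ n ≥ M, ‖s‖ * ((n : ℝ) + α)⁻¹ ≤ 1 / 2 := fun n hn => by
    rw [← div_eq_mul_inv, div_le_iff₀ (hx n)]
    linarith [hsx n hn]
  have hinv : ∀ n : ℕ, 0 ≤ ((n : ℝ) + α)⁻¹ := fun n => (inv_pos.2 (hx n)).le
  have hG : ∀ n : ℕ, ‖((n + α : ℝ) : ℂ) ^ (1 - s)‖ = (n + α) ^ (-s.re) * (n + α) := fun n => by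
    rw [Complex.norm_cpow_eq_rpow_re_of_pos (hx n), ← Real.rpow_add_one (hx n).ne', Complex.sub_re,
      Complex.one_re, sub_eq_neg_add]
  have hbound : ∀ n ≥ M, ‖((n + α : ℝ) : ℂ) ^ (1 - s) * incrementRatio s (n + α)⁻¹‖
      ≤ 4 * (M + α) ^ (-s.re) := fun n hn => by
    have hratio := norm_incrementRatio_le hre0 him (hinv n) (hsx' n hn)
    calc _ ≤ (n + α) ^ (-s.re) * (n + α) * (4 * (n + α)⁻¹) := by
          rw [norm_mul, hG]
          gcongr
      _ = 4 * (n + α) ^ (-s.re) := by field_simp [(hx n).ne']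
      _ ≤ 4 * (M + α) ^ (-s.re) := by
          gcongr 4 * ?_
          exact rpow_neg_shift_le_of_le hα hre0 hn
  have hvar : ∀ n ≥ M, ‖(((n + 1 : ℕ) + α : ℝ) : ℂ) ^ (1 - s)
        * (incrementRatio s ((n + 1 : ℕ) + α)⁻¹ - incrementRatio s (n + α)⁻¹)‖
      ≤ 24 * ((n : ℝ) + α) ^ (-s.re) - 24 * ((n + 1 : ℕ) + α) ^ (-s.re) := fun n hn => by
    rw [← mul_sub, Nat.cast_succ, add_right_comm]
    exact norm_cpow_mul_incrementRatio_sub_le hre him (hsx n hn)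
  rw [← Finset.sum_Ico_sub _ hMZ, Finset.sum_congr rfl fun n hn =>
    hurwitzApprox_succ_sub_eq_mul_incrementRatio hα hs1 <| norm_pos_iff.1 <|
      one_half_pos.trans_le <| half_le_norm_meanCpow hre0 (hinv n) (hsx' n (Finset.mem_Ico.1 hn).1)]
  refine (norm_sum_Ico_sub_mul_le (H := fun n => ((n + α : ℝ) : ℂ) ^ (1 - s)) hMZ hbound hvar
    (by positivity)).trans_eq ?_
  ring

lemma norm_hurwitzZeta_sub_sum_le (hα : α ∈ Set.Ioc (0 : ℝ) 1) (hre : 1 / 2 ≤ s.re)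
    (him : 1 ≤ s.im) {M : ℕ} (hM : 2 * ‖s‖ ≤ M + α) :
    ‖HurwitzZeta.hurwitzZeta (α : UnitAddCircle) s
        - ∑ n ∈ Finset.range M, ((n + α : ℝ) : ℂ) ^ (-s)‖
      ≤ 32 * (M + α) ^ (-s.re) + (M + α) ^ (1 - s.re) / s.im := by
  have hx : 0 < (M : ℝ) + α := add_pos_of_nonneg_of_pos M.cast_nonneg hα.1
  have happrox : ‖HurwitzZeta.hurwitzZeta (α : UnitAddCircle) s - hurwitzApprox α s M‖
      ≤ 32 * (M + α) ^ (-s.re) := by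
    refine le_of_tendsto
      ((tendsto_hurwitzApprox hα (by linarith) (by linarith)).sub_const _).norm ?_
    filter_upwards [eventually_ge_atTop M] with Z hZ
    exact norm_hurwitzApprox_sub_hurwitzApprox_le hα.1 hre him hZ hM
  have hmain : ‖((M + α : ℝ) : ℂ) ^ (1 - s) / (1 - s)‖ ≤ (M + α) ^ (1 - s.re) / s.im := by
    rw [norm_div, Complex.norm_cpow_eq_rpow_re_of_pos hx, Complex.sub_re, Complex.one_re]
    gcongr
    exact im_le_norm_one_sub s
  refine le_trans (le_of_eq_of_le (congrArg norm ?_) (norm_sub_le _ _))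
    (add_le_add happrox hmain)
  rw [hurwitzApprox]
  ring

/-- A bound for the inverse distance of `e^{2πi lam}` to `1`. For integral `lam` it is `1`, because
`0⁻¹ = 0`. -/
noncomputable def lamBound (lam : ℝ) : ℝ := max 1 ‖Complex.exp (2 * π * I * lam) - 1‖⁻¹

lemma one_le_lamBound (lam : ℝ) : 1 ≤ lamBound lam := le_max_left _ _

lemma lerchTerm_of_int {lam : ℝ} (hlam : ∃ k : ℤ, lam = k) (α : ℝ) (s : ℂ) (n : ℕ) :
    lerchTerm lam α s n = ((n + α : ℝ) : ℂ) ^ (-s) := by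
  rw [lerchTerm, exp_two_pi_I_mul_eq_one_iff.2 hlam, one_pow, one_mul]

lemma lerchZeta_of_int {lam : ℝ} (hlam : ∃ k : ℤ, lam = k) (α : ℝ) :
    lerchZeta lam α = HurwitzZeta.hurwitzZeta (α : UnitAddCircle) :=
  funext fun _ => if_pos hlam

lemma norm_lerchZeta_sub_sum_le (hα : α ∈ Set.Ioc (0 : ℝ) 1) {lam K : ℝ} (hK : lamBound lam ≤ K)
    (hre : 1 / 2 ≤ s.re) (him : 1 ≤ s.im) {M : ℕ} (hM : 2 * ‖s‖ * K ≤ M + α) :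
    ‖lerchZeta lam α s - ∑ n ∈ Finset.range M, lerchTerm lam α s n‖
      ≤ 32 * K * (M + α) ^ (-s.re) + (M + α) ^ (1 - s.re) / s.im := by
  have hK1 : 1 ≤ K := (one_le_lamBound lam).trans hK
  have hx : 0 < (M : ℝ) + α := add_pos_of_nonneg_of_pos M.cast_nonneg hα.1
  by_cases hlam : ∃ k : ℤ, lam = k
  · simp only [lerchTerm_of_int hlam, lerchZeta_of_int hlam]
    refine (norm_hurwitzZeta_sub_sum_le hα hre him ?_).trans ?_
    · exact (le_mul_of_one_le_right (by positivity) hK1).trans hM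
    · gcongr
      linarith
  · have hK0 : 0 < K := by linarith
    have hdist : K⁻¹ ≤ ‖Complex.exp (2 * π * I * lam) - 1‖ :=
      inv_le_of_inv_le₀
        (norm_pos_iff.2 (sub_ne_zero.2 (mt exp_two_pi_I_mul_eq_one_iff.1 hlam)))
        ((le_max_right _ _).trans hK)
    refine (norm_lerchZeta_sub_sum_le_of_not_int hα.1 hlam (inv_pos.2 hK0) hdist (by linarith)
      (by rw [inv_mul_eq_div, le_div_iff₀ hK0]; exact hM)).trans ?_
    rw [div_inv_eq_mul]
    refine le_add_of_le_of_nonneg ?_ (div_nonneg (by positivity) (by linarith))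
    gcongr
    norm_num

lemma ae_uniformAverage_mem_Ioc (T : ℝ) : ∀ᵐ t ∂uniformAverage T, t ∈ Set.Ioc 0 T :=
  Measure.ae_smul_measure (ae_restrict_mem measurableSet_Ioc) _

lemma aestronglyMeasurable_lerchZeta (hα : 0 < α) (lam : ℝ) {σ : ℝ} (hσ : 0 < σ) (T : ℝ) :
    AEStronglyMeasurable (fun t : ℝ => lerchZeta lam α (σ + t * I)) (uniformAverage T) := by
  by_cases hlam : ∃ k : ℤ, lam = k
  · rw [lerchZeta_of_int hlam]
    refine AEStronglyMeasurable.mono_ac Measure.smul_absolutelyContinuous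
      (ContinuousOn.aestronglyMeasurable (fun t ht => ?_) measurableSet_Ioc)
    have hne : (σ + t * I : ℂ) ≠ 1 := fun h => ht.1.ne' <| by simpa using congrArg Complex.im h
    exact ((HurwitzZeta.differentiableAt_hurwitzZeta _ hne).continuousAt.comp
      (f := fun t : ℝ => (σ + t * I : ℂ)) (by fun_prop)).continuousWithinAt
  · refine aestronglyMeasurable_of_tendsto_ae atTop
      (f := fun (N : ℕ) (t : ℝ) => ∑ n ∈ Finset.range N, lerchTerm lam α (σ + t * I) n)
      (fun N => Continuous.aestronglyMeasurable (continuous_finsetSum _ fun n _ => ?_))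
      (ae_of_all _ fun t => tendsto_sum_lerchTerm hα hlam (by simpa using hσ))
    exact continuous_const.mul (Continuous.const_cpow (by fun_prop)
      (Or.inl (Complex.ofReal_ne_zero.2 (by positivity))))

end Truncation

section MeanValue

lemma abs_sub_div_le_abs_log_sub {α : ℝ} (hα : α ∈ Set.Ioc (0 : ℝ) 1) {Y m n : ℕ} (hm : m < Y)
    (hn : n < Y) : |(m : ℝ) - n| / Y ≤ |Real.log (m + α) - Real.log (n + α)| := by
  wlog hnm : n ≤ m generalizing m n
  · rw [abs_sub_comm, abs_sub_comm (Real.log _)]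
    exact this hn hm (le_of_not_ge hnm)
  have hm0 : 0 < (m : ℝ) + α := add_pos_of_nonneg_of_pos m.cast_nonneg hα.1
  have hn0 : 0 < (n : ℝ) + α := add_pos_of_nonneg_of_pos n.cast_nonneg hα.1
  have hdiff : 0 ≤ (m : ℝ) - n := sub_nonneg.2 (Nat.cast_le.2 hnm)
  have hmY : (m : ℝ) + 1 ≤ Y := by exact_mod_cast hm
  calc |(m : ℝ) - n| / Y ≤ (m - n) / (m + α) := by
        rw [abs_of_nonneg hdiff]
        gcongr
        linarith [hα.2]
    _ = 1 - ((m + α) / (n + α))⁻¹ := by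
        rw [inv_div, one_sub_div hm0.ne', add_sub_add_right_eq_sub]
    _ ≤ Real.log ((m + α) / (n + α)) := Real.one_sub_inv_le_log_of_pos (div_pos hm0 hn0)
    _ ≤ |Real.log (m + α) - Real.log (n + α)| := by
        rw [Real.log_div hm0.ne' hn0.ne']
        exact le_abs_self _

lemma sum_range_inv_succ_le {k Y : ℕ} (hk : k ≤ Y) :
    ∑ j ∈ Finset.range k, ((j : ℝ) + 1)⁻¹ ≤ 1 + Real.log Y :=
  calc ∑ j ∈ Finset.range k, ((j : ℝ) + 1)⁻¹ ≤ ∑ j ∈ Finset.range Y, ((j : ℝ) + 1)⁻¹ :=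
        Finset.sum_le_sum_of_subset_of_nonneg (Finset.range_subset_range.2 hk)
          fun j _ _ => by positivity
    _ = (harmonic Y : ℚ) := by simp [harmonic]
    _ ≤ 1 + Real.log Y := harmonic_le_one_add_log Y

-- The term `n = m` contributes `0⁻¹ = 0`.
lemma sum_range_inv_abs_sub_le {Y m : ℕ} (hm : m < Y) :
    ∑ n ∈ Finset.range Y, |(m : ℝ) - n|⁻¹ ≤ 2 * (1 + Real.log Y) := by
  have hbelow : ∑ n ∈ Finset.range m, |(m : ℝ) - n|⁻¹ = ∑ j ∈ Finset.range m, ((j : ℝ) + 1)⁻¹ := by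
    rw [← Finset.sum_range_reflect]
    refine Finset.sum_congr rfl fun j hj => ?_
    have hj' := Finset.mem_range.1 hj
    rw [Nat.sub_sub, Nat.cast_sub (by omega), sub_sub_cancel, add_comm 1 j, Nat.cast_succ,
      abs_of_pos (by positivity)]
  have habove : ∑ n ∈ Finset.Ico (m + 1) Y, |(m : ℝ) - n|⁻¹
      = ∑ j ∈ Finset.range (Y - (m + 1)), ((j : ℝ) + 1)⁻¹ := by
    rw [Finset.sum_Ico_eq_sum_range]
    refine Finset.sum_congr rfl fun j _ => ?_
    rw [abs_sub_comm, show ((m + 1 + j : ℕ) : ℝ) - m = j + 1 by push_cast; ring,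
      abs_of_pos (by positivity)]
  rw [← Finset.sum_range_add_sum_Ico _ (show m + 1 ≤ Y by omega), Finset.sum_range_succ, sub_self,
    abs_zero, inv_zero, add_zero, two_mul, hbelow, habove]
  exact add_le_add (sum_range_inv_succ_le hm.le) (sum_range_inv_succ_le (Nat.sub_le _ _))

lemma integral_norm_sq_sum_exp_eq {ι : Type*} (s : Finset ι) (a : ι → ℂ) (ω : ι → ℝ) (T : ℝ) :
    ((∫ t, ‖∑ n ∈ s, a n * Complex.exp (((-(t * ω n) : ℝ) : ℂ) * I)‖ ^ 2 ∂uniformAverage T : ℝ) : ℂ)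
      = ∑ m ∈ s, ∑ n ∈ s, a m * (starRingEnd ℂ) (a n)
        * ∫ t, Complex.exp (((-(t * (ω m - ω n)) : ℝ) : ℂ) * I) ∂uniformAverage T := by
  have hsq (t : ℝ) : ((‖∑ n ∈ s, a n * Complex.exp (((-(t * ω n) : ℝ) : ℂ) * I)‖ ^ 2 : ℝ) : ℂ)
      = ∑ m ∈ s, ∑ n ∈ s, a m * (starRingEnd ℂ) (a n)
        * Complex.exp (((-(t * (ω m - ω n)) : ℝ) : ℂ) * I) := by
    rw [Complex.ofReal_pow, ← Complex.mul_conj', map_sum, Finset.sum_mul_sum]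
    refine Finset.sum_congr rfl fun m _ => Finset.sum_congr rfl fun n _ => ?_
    have hsplit : ((-(t * (ω m - ω n)) : ℝ) : ℂ) * I
        = ((-(t * ω m) : ℝ) : ℂ) * I + ((-(t * ω n) : ℝ) : ℂ) * -I := by push_cast; ring
    rw [map_mul, ← Complex.exp_conj, map_mul, Complex.conj_I, Complex.conj_ofReal, hsplit,
      Complex.exp_add]
    ring
  rw [← integral_complex_ofReal]
  simp only [hsq]
  rw [integral_finsetSum _ fun m _ => integrable_uniformAverage_of_continuous (by fun_prop) T]
  refine Finset.sum_congr rfl fun m _ => ?_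
  rw [integral_finsetSum _ fun n _ => integrable_uniformAverage_of_continuous (by fun_prop) T]
  exact Finset.sum_congr rfl fun n _ => integral_const_mul _ _

lemma sum_sum_mul_le_of_symm {ι : Type*} (s : Finset ι) (x : ι → ℝ) {W : ι → ι → ℝ}
    (hW : ∀ m n, W m n = W n m) (hW0 : ∀ m n, 0 ≤ W m n) :
    ∑ m ∈ s, ∑ n ∈ s, x m * x n * W m n ≤ ∑ m ∈ s, x m ^ 2 * ∑ n ∈ s, W m n := by
  have hswap : ∑ m ∈ s, ∑ n ∈ s, x n ^ 2 * W m n = ∑ m ∈ s, ∑ n ∈ s, x m ^ 2 * W m n := by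
    rw [Finset.sum_comm]
    simp only [hW]
  have hamgm : ∑ m ∈ s, ∑ n ∈ s, 2 * (x m * x n * W m n)
      ≤ ∑ m ∈ s, ∑ n ∈ s, (x m ^ 2 * W m n + x n ^ 2 * W m n) :=
    Finset.sum_le_sum fun m _ => Finset.sum_le_sum fun n _ => by
      nlinarith [mul_nonneg (sq_nonneg (x m - x n)) (hW0 m n)]
  simp only [Finset.sum_add_distrib, ← Finset.mul_sum] at hamgm hswap ⊢
  linarith

lemma norm_integral_exp_log_sub_log_le {α T : ℝ} (hα : α ∈ Set.Ioc (0 : ℝ) 1) (hT : 0 < T)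
    {Y m n : ℕ} (hm : m < Y) (hn : n < Y) :
    ‖∫ t, Complex.exp (((-(t * (Real.log (m + α) - Real.log (n + α))) : ℝ) : ℂ) * I)
        ∂uniformAverage T‖
      ≤ (if m = n then 1 else 0) + 2 * Y / T * |(m : ℝ) - n|⁻¹ := by
  have := isProbabilityMeasure_uniformAverage hT
  split_ifs with hmn
  · simp [hmn]
  have hY : (0 : ℝ) < Y := Nat.cast_pos.2 (by omega)
  have hdiff : 0 < |(m : ℝ) - n| := abs_pos.2 (sub_ne_zero.2 (Nat.cast_injective.ne hmn))
  have hlog := abs_sub_div_le_abs_log_sub hα hm hn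
  refine (norm_integral_uniformAverage_exp_le hT
    (abs_pos.1 ((div_pos hdiff hY).trans_le hlog))).trans ?_
  calc 2 / (T * |Real.log (m + α) - Real.log (n + α)|) ≤ 2 / (T * (|(m : ℝ) - n| / Y)) := by gcongr
    _ = 0 + 2 * Y / T * |(m : ℝ) - n|⁻¹ := by field_simp; ring

lemma integral_norm_sq_dirichlet_le {α T : ℝ} (hα : α ∈ Set.Ioc (0 : ℝ) 1) (hT : 0 < T) (N Y : ℕ)
    (a : ℕ → ℂ) :
    ∫ t, ‖∑ n ∈ Finset.Ico N Y, a n * Complex.exp (((-(t * Real.log (n + α)) : ℝ) : ℂ) * I)‖ ^ 2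
        ∂uniformAverage T
      ≤ (1 + 4 * Y * (1 + Real.log Y) / T) * ∑ n ∈ Finset.Ico N Y, ‖a n‖ ^ 2 := by
  let W (m n : ℕ) : ℝ := (if m = n then 1 else 0) + 2 * Y / T * |(m : ℝ) - n|⁻¹
  have hWsymm (m n : ℕ) : W m n = W n m := by simp only [W, eq_comm, abs_sub_comm]
  have hW0 (m n : ℕ) : 0 ≤ W m n := by positivity
  have hWsum : ∀ m ∈ Finset.Ico N Y,
      ∑ n ∈ Finset.Ico N Y, W m n ≤ 1 + 4 * Y * (1 + Real.log Y) / T := fun m hm => by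
    have hmY := (Finset.mem_Ico.1 hm).2
    calc ∑ n ∈ Finset.Ico N Y, W m n ≤ ∑ n ∈ Finset.range Y, W m n :=
          Finset.sum_le_sum_of_subset_of_nonneg (fun n hn => Finset.mem_range.2
            (Finset.mem_Ico.1 hn).2) fun n _ _ => hW0 m n
      _ = 1 + 2 * Y / T * ∑ n ∈ Finset.range Y, |(m : ℝ) - n|⁻¹ := by
          rw [Finset.sum_add_distrib, ← Finset.mul_sum, Finset.sum_ite_eq,
            if_pos (Finset.mem_range.2 hmY)]
      _ ≤ 1 + 2 * Y / T * (2 * (1 + Real.log Y)) := by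
          gcongr
          exact sum_range_inv_abs_sub_le hmY
      _ = _ := by ring
  refine (le_abs_self _).trans ?_
  rw [← Real.norm_eq_abs, ← Complex.norm_real, integral_norm_sq_sum_exp_eq]
  calc _ ≤ ∑ m ∈ Finset.Ico N Y, ∑ n ∈ Finset.Ico N Y, ‖a m‖ * ‖a n‖ * W m n := by
        refine norm_sum_le_of_le _ fun m hm => norm_sum_le_of_le _ fun n hn => ?_
        rw [norm_mul, norm_mul, RCLike.norm_conj]
        gcongr
        exact norm_integral_exp_log_sub_log_le hα hT (Finset.mem_Ico.1 hm).2 (Finset.mem_Ico.1 hn).2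
    _ ≤ ∑ m ∈ Finset.Ico N Y, ‖a m‖ ^ 2 * ∑ n ∈ Finset.Ico N Y, W m n :=
        sum_sum_mul_le_of_symm _ _ hWsymm hW0
    _ ≤ _ := by
        rw [Finset.mul_sum]
        refine Finset.sum_le_sum fun m hm => ?_
        rw [mul_comm]
        exact mul_le_mul_of_nonneg_right (hWsum m hm) (sq_nonneg _)

end MeanValue

section SquareSums

variable {α σ ε : ℝ}

lemma sum_Ico_rpow_le {a : ℝ} (ha : 0 < a) {N : ℕ} (hN : 2 ≤ N) (M : ℕ) :
    ∑ n ∈ Finset.Ico N M, (n : ℝ) ^ (-1 - a) ≤ ((N : ℝ) - 1) ^ (-a) / a := by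
  have hN' : (2 : ℝ) ≤ N := Nat.ofNat_le_cast.2 hN
  rcases le_total M N with hMN | hNM
  · rw [Finset.Ico_eq_empty (by omega), Finset.sum_empty]
    exact div_nonneg (Real.rpow_nonneg (by linarith) _) ha.le
  have hM' : (2 : ℝ) ≤ M := hN'.trans (Nat.cast_le.2 hNM)
  rw [le_div_iff₀ ha, Finset.sum_mul]
  calc ∑ n ∈ Finset.Ico N M, (n : ℝ) ^ (-1 - a) * a
      ≤ ∑ n ∈ Finset.Ico N M, (-((n + 1 : ℕ) - 1 : ℝ) ^ (-a) - -((n : ℝ) - 1) ^ (-a)) := by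
        refine Finset.sum_le_sum fun n hn => ?_
        have hn' : (2 : ℝ) ≤ n := hN'.trans (Nat.cast_le.2 (Finset.mem_Ico.1 hn).1)
        have hterm := mul_rpow_neg_sub_one_le ha.le (x := (n : ℝ) - 1) (by linarith)
        rw [sub_add_cancel, neg_sub_comm] at hterm
        push_cast
        rw [add_sub_cancel_right]
        linarith
    _ = ((N : ℝ) - 1) ^ (-a) - ((M : ℝ) - 1) ^ (-a) := by
        rw [Finset.sum_Ico_sub (fun n : ℕ => -((n : ℝ) - 1) ^ (-a)) hNM]
        ring
    _ ≤ ((N : ℝ) - 1) ^ (-a) := sub_le_self _ (Real.rpow_nonneg (by linarith) _)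

lemma circleRadius_sq (hα : 0 < α) (σ : ℝ) (n : ℕ) :
    circleRadius σ α n ^ 2 = (n + α) ^ (-(2 * σ)) := by
  rw [circleRadius, ← Real.rpow_mul_natCast (by positivity)]
  congr 1
  push_cast
  ring

lemma circleRadius_sq_le (hα : 0 < α) (hε : 0 ≤ ε) (hσ : 1 / 2 + ε ≤ σ) {n : ℕ} (hn : 1 ≤ n) :
    circleRadius σ α n ^ 2 ≤ (n : ℝ) ^ (-1 - 2 * ε) := by
  have hn1 : (1 : ℝ) ≤ n := Nat.one_le_cast.2 hn
  rw [circleRadius_sq hα]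
  calc ((n : ℝ) + α) ^ (-(2 * σ)) ≤ (n : ℝ) ^ (-(2 * σ)) :=
        Real.rpow_le_rpow_of_nonpos (by linarith) (by linarith) (by linarith)
    _ ≤ _ := Real.rpow_le_rpow_of_exponent_le hn1 (by linarith)

lemma sum_circleRadius_sq_tail_le (hα : 0 < α) (hε : 0 < ε) (hσ : 1 / 2 + ε ≤ σ) {N : ℕ}
    (hN : 2 ≤ N) (M : ℕ) :
    ∑ n ∈ Finset.Ico N M, circleRadius σ α n ^ 2 ≤ ((N : ℝ) - 1) ^ (-(2 * ε)) / (2 * ε) :=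
  (Finset.sum_le_sum fun n hn => circleRadius_sq_le hα hε.le hσ
    (one_le_two.trans (hN.trans (Finset.mem_Ico.1 hn).1))).trans
      (sum_Ico_rpow_le (by positivity) hN M)

lemma sum_circleRadius_sq_le (hα : 0 < α) (hε : 0 < ε) (hσ : 1 / 2 + ε ≤ σ) {N : ℕ} (hN : 2 ≤ N) :
    ∑ n ∈ Finset.range N, circleRadius σ α n ^ 2 ≤ α ^ (-(2 * σ)) + 1 + 1 / (2 * ε) := by
  have hzero : circleRadius σ α 0 ^ 2 = α ^ (-(2 * σ)) := by
    rw [circleRadius_sq hα, Nat.cast_zero, zero_add]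
  have hone : circleRadius σ α 1 ^ 2 ≤ 1 := by
    simpa using circleRadius_sq_le hα hε.le hσ le_rfl
  have htail := sum_circleRadius_sq_tail_le hα hε hσ le_rfl N
  rw [Nat.cast_ofNat, show (2 : ℝ) - 1 = 1 by norm_num, Real.one_rpow] at htail
  rw [← Finset.sum_range_add_sum_Ico _ hN, Finset.sum_range_succ, Finset.sum_range_one, hzero]
  gcongr

end SquareSums

section CharacteristicFunctions

variable {lam α K σ T : ℝ}

lemma lerchTerm_vertical (hα : 0 < α) (lam σ t : ℝ) (n : ℕ) :
    lerchTerm lam α (σ + t * I) n = Complex.exp (2 * π * I * lam) ^ n * (circleRadius σ α n : ℂ)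
      * Complex.exp (((-(t * Real.log (n + α)) : ℝ) : ℂ) * I) := by
  have hx : 0 < (n : ℝ) + α := by positivity
  have hx' : ((n + α : ℝ) : ℂ) ≠ 0 := Complex.ofReal_ne_zero.2 hx.ne'
  have hphase : ((n + α : ℝ) : ℂ) ^ (-(t * I))
      = Complex.exp (((-(t * Real.log (n + α)) : ℝ) : ℂ) * I) := by
    rw [Complex.cpow_def_of_ne_zero hx', ← Complex.ofReal_log hx.le]
    congr 1
    push_cast
    ring
  rw [lerchTerm, neg_add, Complex.cpow_add _ _ hx', hphase, circleRadius, Complex.ofReal_cpow hx.le,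
    Complex.ofReal_neg σ, ← mul_assoc]

lemma continuous_sum_lerchTerm (hα : 0 < α) (lam σ : ℝ) (F : Finset ℕ) :
    Continuous fun t : ℝ => ∑ n ∈ F, lerchTerm lam α (σ + t * I) n := by
  simp only [lerchTerm_vertical hα]
  fun_prop

lemma norm_phase_mul_circleRadius (hα : 0 < α) (lam σ : ℝ) (n : ℕ) :
    ‖Complex.exp (2 * π * I * lam) ^ n * (circleRadius σ α n : ℂ)‖ = circleRadius σ α n := by
  rw [norm_mul, norm_pow, norm_exp_two_pi_I_mul, one_pow, one_mul, Complex.norm_real,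
    Real.norm_of_nonneg (circleRadius_pos hα σ n).le]

lemma norm_exp_inner_sub_le (v z w : ℂ) :
    ‖Complex.exp ((⟪z, v⟫ : ℝ) * I) - Complex.exp ((⟪w, v⟫ : ℝ) * I)‖ ≤ ‖v‖ * ‖z - w‖ := by
  refine (norm_exp_mul_I_sub_exp_mul_I_le _ _).trans ?_
  rw [← inner_sub_left, mul_comm]
  exact abs_real_inner_le_norm _ _

lemma integrable_exp_inner {X : Type*} [MeasurableSpace X] {μ : Measure X} [IsFiniteMeasure μ]
    {f : X → ℂ} (hf : AEStronglyMeasurable f μ) (v : ℂ) :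
    Integrable (fun x => Complex.exp ((⟪f x, v⟫ : ℝ) * I)) μ :=
  .of_bound ((by fun_prop : Continuous fun z : ℂ =>
    Complex.exp ((⟪z, v⟫ : ℝ) * I)).comp_aestronglyMeasurable hf) 1
      (ae_of_all _ fun _ => (Complex.norm_exp_ofReal_mul_I _).le)

lemma integral_le_sqrt_integral_sq {X : Type*} [MeasurableSpace X] {μ : Measure X}
    [IsProbabilityMeasure μ] {f : X → ℝ} (hf : MemLp f 2 μ) :
    ∫ x, f x ∂μ ≤ √(∫ x, f x ^ 2 ∂μ) := by
  have hvar := ProbabilityTheory.variance_nonneg f μ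
  rw [ProbabilityTheory.variance_eq_sub hf, sub_nonneg] at hvar
  exact Real.le_sqrt_of_sq_le hvar

lemma uniformAverage_real_Iio_le (hT : 0 < T) {a : ℝ} (ha : 0 ≤ a) :
    (uniformAverage T).real (Set.Iio a) ≤ a / T := by
  rw [uniformAverage, measureReal_ennreal_smul_apply, ENNReal.toReal_ofReal (by positivity),
    inv_mul_eq_div, measureReal_restrict_apply measurableSet_Iio]
  gcongr
  calc volume.real (Set.Iio a ∩ Set.Ioc 0 T) ≤ volume.real (Set.Ico 0 a) :=
        measureReal_mono (fun t ht => ⟨ht.2.1.le, ht.1⟩) (by simp)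
    _ = a := by rw [Real.volume_real_Ico_of_le ha, sub_zero]

lemma norm_integral_exp_inner_sub_le_of_approx (hT : 0 < T) {f g : ℝ → ℂ} {h : ℝ → ℝ} {a : ℝ}
    (hf : AEStronglyMeasurable f (uniformAverage T))
    (hg : AEStronglyMeasurable g (uniformAverage T)) (hh : Integrable h (uniformAverage T))
    (hh0 : ∀ t, 0 ≤ h t) (ha : 0 ≤ a) (hfg : ∀ t ∈ Set.Ioc 0 T, a ≤ t → ‖f t - g t‖ ≤ h t) (v : ℂ) :
    ‖∫ t, Complex.exp ((⟪f t, v⟫ : ℝ) * I) ∂uniformAverage T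
      - ∫ t, Complex.exp ((⟪g t, v⟫ : ℝ) * I) ∂uniformAverage T‖
      ≤ 2 * (a / T) + ‖v‖ * ∫ t, h t ∂uniformAverage T := by
  have := isProbabilityMeasure_uniformAverage hT
  have hsmall : Integrable ((Set.Iio a).indicator fun _ : ℝ => (2 : ℝ)) (uniformAverage T) :=
    (integrable_const _).indicator measurableSet_Iio
  have hlarge : Integrable (fun t => ‖v‖ * h t) (uniformAverage T) := hh.const_mul _
  rw [← integral_sub (integrable_exp_inner hf v) (integrable_exp_inner hg v)]
  refine (norm_integral_le_of_norm_le (hsmall.add hlarge) ?_).trans ?_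
  · filter_upwards [ae_uniformAverage_mem_Ioc T] with t ht
    rw [Pi.add_apply]
    rcases lt_or_ge t a with hta | hat
    · rw [Set.indicator_of_mem (Set.mem_Iio.2 hta)]
      refine le_add_of_le_of_nonneg ((norm_sub_le _ _).trans_eq ?_)
        (mul_nonneg (norm_nonneg v) (hh0 t))
      rw [Complex.norm_exp_ofReal_mul_I, Complex.norm_exp_ofReal_mul_I, one_add_one_eq_two]
    · rw [Set.indicator_of_notMem (Set.notMem_Iio.2 hat), zero_add]
      exact (norm_exp_inner_sub_le v _ _).trans
        (mul_le_mul_of_nonneg_left (hfg t ht hat) (norm_nonneg v))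
  · simp only [Pi.add_apply]
    rw [integral_add hsmall hlarge, integral_const_mul,
      integral_indicator_const _ measurableSet_Iio, smul_eq_mul, mul_comm _ (2 : ℝ)]
    gcongr
    exact uniformAverage_real_Iio_le hT ha

lemma integral_norm_sum_lerchTerm_le (hα : α ∈ Set.Ioc (0 : ℝ) 1) (hT : 0 < T) (lam σ : ℝ)
    (N M : ℕ) :
    ∫ t, ‖∑ n ∈ Finset.Ico N M, lerchTerm lam α (σ + t * I) n‖ ∂uniformAverage T
      ≤ √((1 + 4 * M * (1 + Real.log M) / T) * ∑ n ∈ Finset.Ico N M, circleRadius σ α n ^ 2) := by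
  have := isProbabilityMeasure_uniformAverage hT
  have hcont := (continuous_sum_lerchTerm hα.1 lam σ (Finset.Ico N M)).norm
  refine (integral_le_sqrt_integral_sq ((memLp_two_iff_integrable_sq
    hcont.aestronglyMeasurable).2 (integrable_uniformAverage_of_continuous (hcont.pow 2) T))).trans
    (Real.sqrt_le_sqrt ?_)
  have hmean := integral_norm_sq_dirichlet_le hα hT N M fun n =>
    Complex.exp (2 * π * I * lam) ^ n * (circleRadius σ α n : ℂ)
  simpa only [← lerchTerm_vertical hα.1, norm_phase_mul_circleRadius hα.1] using hmean

lemma norm_lerchZeta_sub_sum_vertical_le (hα : α ∈ Set.Ioc (0 : ℝ) 1) (hK : lamBound lam ≤ K)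
    (hσ : 1 / 2 ≤ σ) {a t : ℝ} (ha : 1 ≤ a) (hat : a ≤ t) {M : ℕ}
    (hM : 2 * (σ + t) * K ≤ M + α) :
    ‖lerchZeta lam α (σ + t * I) - ∑ n ∈ Finset.range M, lerchTerm lam α (σ + t * I) n‖
      ≤ 32 * K * (M + α) ^ (-σ) + (M + α) ^ (1 - σ) / a := by
  have hα0 := hα.1
  have hK0 : 0 ≤ K := zero_le_one.trans ((one_le_lamBound lam).trans hK)
  have hre : (σ + t * I : ℂ).re = σ := by simp
  have him : (σ + t * I : ℂ).im = t := by simp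
  have hnorm : ‖(σ + t * I : ℂ)‖ ≤ σ + t := by
    refine (norm_add_le _ _).trans_eq ?_
    rw [norm_mul, Complex.norm_I, mul_one, Complex.norm_real, Complex.norm_real,
      Real.norm_of_nonneg (by linarith), Real.norm_of_nonneg (by linarith)]
  have happrox := norm_lerchZeta_sub_sum_le (M := M) hα hK (hre.symm ▸ hσ)
    (him.symm ▸ ha.trans hat) (le_trans (by gcongr) hM)
  rw [hre, him] at happrox
  refine happrox.trans ?_
  gcongr

lemma norm_integral_exp_lerchZeta_sub_sum_le (hα : α ∈ Set.Ioc (0 : ℝ) 1) (hK : lamBound lam ≤ K)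
    (hσ : 1 / 2 ≤ σ) (hT : 1 ≤ T) {N M : ℕ} (hNM : N ≤ M) (hM : 2 * (σ + T) * K ≤ M + α) (v : ℂ) :
    ‖∫ t : ℝ, Complex.exp ((⟪lerchZeta lam α (σ + t * I), v⟫ : ℝ) * I) ∂uniformAverage T
      - ∫ t : ℝ, Complex.exp ((⟪∑ n ∈ Finset.range N, lerchTerm lam α (σ + t * I) n, v⟫ : ℝ) * I)
        ∂uniformAverage T‖
      ≤ 2 * T ^ (-(1 / 4) : ℝ) + ‖v‖ * (√((1 + 4 * M * (1 + Real.log M) / T)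
          * ∑ n ∈ Finset.Ico N M, circleRadius σ α n ^ 2)
        + (32 * K * (M + α) ^ (-σ) + (M + α) ^ (1 - σ) / T ^ (3 / 4 : ℝ))) := by
  have hT0 : 0 < T := by linarith
  have hα0 := hα.1
  have := isProbabilityMeasure_uniformAverage hT0
  have hK0 : 0 ≤ K := zero_le_one.trans ((one_le_lamBound lam).trans hK)
  let tail (t : ℝ) : ℂ := ∑ n ∈ Finset.Ico N M, lerchTerm lam α (σ + t * I) n
  let err : ℝ := 32 * K * (M + α) ^ (-σ) + (M + α) ^ (1 - σ) / T ^ (3 / 4 : ℝ)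
  have hcut : 1 ≤ T ^ (3 / 4 : ℝ) := Real.one_le_rpow hT (by norm_num)
  have herr : 0 ≤ err := by positivity
  have htail : Integrable (fun t => ‖tail t‖) (uniformAverage T) :=
    integrable_uniformAverage_of_continuous (continuous_sum_lerchTerm hα0 lam σ _).norm T
  have happrox : ∀ t ∈ Set.Ioc 0 T, T ^ (3 / 4 : ℝ) ≤ t → ‖lerchZeta lam α (σ + t * I)
      - ∑ n ∈ Finset.range N, lerchTerm lam α (σ + t * I) n‖ ≤ ‖tail t‖ + err := fun t ht hct => by
    rw [← sub_add_sub_cancel _ (∑ n ∈ Finset.range M, lerchTerm lam α (σ + t * I) n),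
      ← Finset.sum_Ico_eq_sub _ hNM, add_comm ‖tail t‖]
    refine (norm_add_le _ _).trans (add_le_add_left ?_ _)
    refine norm_lerchZeta_sub_sum_vertical_le hα hK hσ hcut hct (le_trans ?_ hM)
    have := ht.2
    gcongr
  refine (norm_integral_exp_inner_sub_le_of_approx hT0
    (aestronglyMeasurable_lerchZeta hα0 lam (by linarith) T)
    (continuous_sum_lerchTerm hα0 lam σ _).aestronglyMeasurable (htail.add (integrable_const err))
    (fun t => add_nonneg (norm_nonneg _) herr) (zero_le_one.trans hcut) happrox v).trans ?_
  rw [integral_add' htail (integrable_const _), integral_const, probReal_univ, one_smul,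
    ← Real.rpow_sub_one hT0.ne', show (3 / 4 - 1 : ℝ) = -(1 / 4) by norm_num]
  gcongr
  exact integral_norm_sum_lerchTerm_le hα hT0 lam σ N M

lemma inner_sum_lerchTerm_eq_trigSum (hα : 0 < α) (lam σ t : ℝ) (N : ℕ) (v : ℂ) :
    ⟪∑ n ∈ Finset.range N, lerchTerm lam α (σ + t * I) n, v⟫
      = trigSum (fun n : Fin N => (starRingEnd ℂ) v *
          (Complex.exp (2 * π * I * lam) ^ (n : ℕ) * (circleRadius σ α n : ℂ)))
        (fun n : Fin N => Real.log (n + α)) t := by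
  rw [sum_inner, trigSum, Finset.sum_range]
  refine Finset.sum_congr rfl fun n _ => ?_
  rw [lerchTerm_vertical hα, real_inner_comm, Complex.inner]
  congr 1
  ring

/-- The spacing condition with exponent `Ω` for the numbers `log (n + α)`, `n ≤ X`: condition (2)
in the definition of the admissible set at a single `X`. -/
def SpacedAt (α Ω X : ℝ) : Prop :=
  ∀ (N : ℕ) (n : Fin N → ℕ) (ε : Fin N → ℝ),
    (∀ j, (n j : ℝ) ≤ X) → (∀ j, ε j = 1 ∨ ε j = -1) →
    ∑ j, ε j * Real.log (n j + α) ≠ 0 →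
    X ^ (-(Ω * (N : ℝ) ^ 2)) ≤ |∑ j, ε j * Real.log (n j + α)|

lemma SpacedAt.le_abs_frequency {Ω : ℝ} (hΩ : 0 ≤ Ω) {N : ℕ} (hN : 1 ≤ N) (h : SpacedAt α Ω N)
    {m k : ℕ} (hm : m ≤ k) (p : Fin m → Fin N × ℤˣ)
    (hp : frequency (fun n : Fin N => Real.log (n + α)) p ≠ 0) :
    (N : ℝ) ^ (-(Ω * (k : ℝ) ^ 2)) ≤ |frequency (fun n : Fin N => Real.log (n + α)) p| := by
  have hmk : (m : ℝ) ≤ k := Nat.cast_le.2 hm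
  refine (Real.rpow_le_rpow_of_exponent_le (Nat.one_le_cast.2 hN) ?_).trans
    (h m (fun j => (p j).1) (fun j => ((p j).2 : ℤ)) (fun j => Nat.cast_le.2 (p j).1.2.le)
      (fun j => ?_) hp)
  · gcongr
  · rcases Int.units_eq_one_or (p j).2 with hj | hj <;> simp [hj]

lemma norm_integral_exp_sum_lerchTerm_sub_prod_le {Ω A V : ℝ} (hα : 0 < α)
    (hind : LinearIndependent ℚ fun n : ℕ => Real.log (n + α)) (hΩ : 0 ≤ Ω) (lam σ : ℝ)
    (hT : 0 < T) {N : ℕ} (hN : 1 ≤ N) (hspace : SpacedAt α Ω N) (v : ℂ) (k : ℕ) (hA1 : 1 ≤ A)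
    (hA : ‖v‖ * ∑ n ∈ Finset.range N, circleRadius σ α n ≤ A)
    (hV : ‖v‖ ^ 2 * ∑ n ∈ Finset.range N, circleRadius σ α n ^ 2 ≤ V) :
    ‖∫ t : ℝ, Complex.exp ((⟪∑ n ∈ Finset.range N, lerchTerm lam α (σ + t * I) n, v⟫ : ℝ) * I)
        ∂uniformAverage T
      - ∏ n ∈ Finset.range N, besselJZero (‖v‖ * circleRadius σ α n)‖
      ≤ 6 * A ^ (2 * k) / (T * (N : ℝ) ^ (-(Ω * ((2 * k : ℕ) : ℝ) ^ 2)))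
        + 2 * Real.exp (4 * V - 2 * k) := by
  simp only [inner_sum_lerchTerm_eq_trigSum hα]
  let c (n : Fin N) : ℂ := (starRingEnd ℂ) v *
    (Complex.exp (2 * π * I * lam) ^ (n : ℕ) * (circleRadius σ α n : ℂ))
  have hc (n : Fin N) : ‖c n‖ = ‖v‖ * circleRadius σ α n := by
    rw [norm_mul, norm_phase_mul_circleRadius hα, RCLike.norm_conj]
  have : (0 : ℝ) < N := Nat.cast_pos.2 hN
  have hcA : ∑ n, ‖c n‖ ≤ A := by
    simpa only [hc, ← Finset.mul_sum, ← Finset.sum_range (fun n => circleRadius σ α n)] using hA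
  have hcV : ∑ n, ‖c n‖ ^ 2 ≤ V := by
    simpa only [hc, mul_pow, ← Finset.mul_sum, ← Finset.sum_range (fun n => circleRadius σ α n ^ 2)]
      using hV
  rw [Finset.prod_range]
  simp only [← hc]
  exact norm_integral_exp_trigSum_sub_le (hind.comp _ Fin.val_injective) c hT (by positivity) k
    (fun m hm p hp => hspace.le_abs_frequency hΩ hN hm p hp) hcA hA1 hcV

lemma norm_integral_exp_lerchZeta_sub_charFun_le {Ω B A V : ℝ} (hα : α ∈ Set.Ioc (0 : ℝ) 1)
    (hind : LinearIndependent ℚ fun n : ℕ => Real.log (n + α)) (hΩ : 0 ≤ Ω)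
    (hK : lamBound lam ≤ K) (hσ : 1 / 2 ≤ σ) (hT : 1 ≤ T) {N M : ℕ} (hN : 1 ≤ N) (hNM : N ≤ M)
    (hspace : SpacedAt α Ω N) (hM : 2 * (σ + T) * K ≤ M + α)
    (hB : ∀ M, ∑ n ∈ Finset.Ico N M, circleRadius σ α n ^ 2 ≤ B) (v : ℂ) (k : ℕ) (hA1 : 1 ≤ A)
    (hA : ‖v‖ * ∑ n ∈ Finset.range N, circleRadius σ α n ≤ A)
    (hV : ‖v‖ ^ 2 * ∑ n ∈ Finset.range N, circleRadius σ α n ^ 2 ≤ V)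
    {φ : ProbabilityMeasure ℂ} (hφ : Tendsto (partialConv σ α) atTop (𝓝 φ)) :
    ‖∫ t : ℝ, Complex.exp ((⟪lerchZeta lam α (σ + t * I), v⟫ : ℝ) * I) ∂uniformAverage T
      - charFun (φ : Measure ℂ) v‖
      ≤ (2 * T ^ (-(1 / 4) : ℝ) + ‖v‖ * (√((1 + 4 * M * (1 + Real.log M) / T) * B)
        + (32 * K * (M + α) ^ (-σ) + (M + α) ^ (1 - σ) / T ^ (3 / 4 : ℝ))))
      + (6 * A ^ (2 * k) / (T * (N : ℝ) ^ (-(Ω * ((2 * k : ℕ) : ℝ) ^ 2)))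
        + 2 * Real.exp (4 * V - 2 * k))
      + ‖v‖ ^ 2 / 2 * B := by
  have hT0 : 0 < T := by linarith
  have : (0 : ℝ) ≤ Real.log M := Real.log_natCast_nonneg M
  have htrunc := norm_integral_exp_lerchZeta_sub_sum_le hα hK hσ hT hNM hM v
  have hmoment := norm_integral_exp_sum_lerchTerm_sub_prod_le hα.1 hind hΩ lam σ hT0 hN hspace v k
    hA1 hA hV
  have hlimit := norm_charFun_sub_prod_besselJZero_le hα.1 hφ hB v
  rw [norm_sub_rev] at hlimit
  refine (norm_sub_le_norm_sub_add_norm_sub _ _ _).trans (add_le_add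
    ((norm_sub_le_norm_sub_add_norm_sub _ _ _).trans (add_le_add (htrunc.trans ?_) hmoment)) hlimit)
  gcongr
  exact hB M

end CharacteristicFunctions

section Truncation

variable {l α σ : ℝ}

/-- The length at which the Lerch series is truncated for times up to `T = exp l`. The factor `l`
leaves room for the constant `lamBound`. -/
noncomputable def truncationLength (l : ℝ) : ℕ := ⌈4 * Real.exp l * l⌉₊

lemma le_truncationLength (l : ℝ) : 4 * Real.exp l * l ≤ truncationLength l := Nat.le_ceil _

lemma truncationLength_le (hl : 1 ≤ l) : (truncationLength l : ℝ) ≤ 5 * Real.exp l * l := by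
  have hexp : 1 ≤ Real.exp l := Real.one_le_exp (by linarith)
  have hceil := Nat.ceil_lt_add_one (show 0 ≤ 4 * Real.exp l * l by positivity)
  rw [truncationLength]
  nlinarith

lemma log_truncationLength_le (hl : 3 ≤ l) : Real.log (truncationLength l) ≤ 3 * l := by
  have hpos : (0 : ℝ) < truncationLength l :=
    lt_of_lt_of_le (by positivity) (le_truncationLength l)
  have hlog5 := Real.log_le_sub_one_of_pos (show (0 : ℝ) < 5 by norm_num)
  have hlogl := Real.log_le_sub_one_of_pos (show 0 < l by linarith)
  have hlog := Real.log_le_log hpos (truncationLength_le (by linarith))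
  rw [Real.log_mul (by positivity) (by positivity), Real.log_mul (by norm_num) (by positivity),
    Real.log_exp] at hlog
  linarith

lemma meanSquareFactor_truncationLength_le (hl : 3 ≤ l) :
    1 + 4 * truncationLength l * (1 + Real.log (truncationLength l)) / Real.exp l
      ≤ 100 * l ^ 2 := by
  have : 0 ≤ Real.log (truncationLength l) := Real.log_natCast_nonneg _
  have hlog := log_truncationLength_le hl
  have hlen := truncationLength_le (l := l) (by linarith)
  calc _ ≤ 1 + 4 * (5 * Real.exp l * l) * (1 + 3 * l) / Real.exp l := by gcongr
    _ = 1 + 20 * l * (1 + 3 * l) := by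
        field_simp
        ring
    _ ≤ 100 * l ^ 2 := by nlinarith

lemma truncationLength_add_rpow_neg_le (hl : 1 ≤ l) (hα : 0 ≤ α) (hσ : 1 / 2 ≤ σ) :
    (truncationLength l + α) ^ (-σ) ≤ Real.exp (-(l / 4)) := by
  have hlen : Real.exp l ≤ truncationLength l + α := by
    nlinarith [le_truncationLength l, Real.exp_pos l]
  calc (truncationLength l + α) ^ (-σ) ≤ Real.exp l ^ (-σ) :=
        Real.rpow_le_rpow_of_nonpos (Real.exp_pos l) hlen (by linarith)
    _ = Real.exp (-(l * σ)) := by rw [← Real.exp_mul, mul_neg]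
    _ ≤ Real.exp (-(l / 4)) := Real.exp_le_exp.2 (by nlinarith)

lemma truncationLength_add_rpow_one_sub_div_le (hl : 1 ≤ l) (hα : α ∈ Set.Icc (0 : ℝ) 1)
    (hσ : 1 / 2 ≤ σ) :
    (truncationLength l + α) ^ (1 - σ) / Real.exp l ^ (3 / 4 : ℝ)
      ≤ 6 * l * Real.exp (-(l / 4)) := by
  have hexp : 1 ≤ Real.exp l := Real.one_le_exp (by linarith)
  have hlower : 1 ≤ truncationLength l + α := by
    nlinarith [le_truncationLength l, hα.1]
  have hupper : truncationLength l + α ≤ Real.exp l * (6 * l) := by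
    nlinarith [truncationLength_le hl, hα.2]
  calc (truncationLength l + α) ^ (1 - σ) / Real.exp l ^ (3 / 4 : ℝ)
      ≤ (Real.exp l * (6 * l)) ^ (1 / 2 : ℝ) / Real.exp l ^ (3 / 4 : ℝ) := by
        gcongr
        exact (Real.rpow_le_rpow_of_exponent_le hlower (by linarith)).trans
          (Real.rpow_le_rpow (by linarith) hupper (by norm_num))
    _ = (6 * l) ^ (1 / 2 : ℝ) * (Real.exp l ^ (1 / 2 : ℝ) / Real.exp l ^ (3 / 4 : ℝ)) := by
        rw [Real.mul_rpow (Real.exp_pos l).le (by positivity)]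
        ring
    _ = (6 * l) ^ (1 / 2 : ℝ) * Real.exp (-(l / 4)) := by
        rw [← Real.rpow_sub (Real.exp_pos l), ← Real.exp_mul]
        ring_nf
    _ ≤ 6 * l * Real.exp (-(l / 4)) := by
        gcongr
        exact Real.rpow_le_self_of_one_le (by linarith) (by norm_num)

lemma truncation_error_le (hl : 3 ≤ l) (hα : α ∈ Set.Icc (0 : ℝ) 1) (hσ : 1 / 2 ≤ σ) {y b : ℝ}
    (hy : y ≤ l / 4) (hb : b ≤ l) :
    √((1 + 4 * truncationLength l * (1 + Real.log (truncationLength l)) / Real.exp l)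
          * (Real.exp (-2 * y) * b))
        + (32 * l * (truncationLength l + α) ^ (-σ)
          + (truncationLength l + α) ^ (1 - σ) / Real.exp l ^ (3 / 4 : ℝ))
      ≤ 48 * l ^ 2 * Real.exp (-y) := by
  have hexp : Real.exp (-(l / 4)) ≤ Real.exp (-y) := Real.exp_le_exp.2 (by linarith)
  have hmean : √((1 + 4 * truncationLength l * (1 + Real.log (truncationLength l)) / Real.exp l)
      * (Real.exp (-2 * y) * b)) ≤ 10 * l ^ 2 * Real.exp (-y) := by
    have hsq : Real.exp (-2 * y) = Real.exp (-y) ^ 2 := by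
      rw [← Real.exp_nat_mul]
      ring_nf
    refine (Real.sqrt_le_left (by positivity)).2 ?_
    calc _ ≤ 100 * l ^ 2 * (Real.exp (-y) ^ 2 * l ^ 2) := by
          rw [hsq]
          refine (mul_le_mul_of_nonneg_left (b := Real.exp (-y) ^ 2 * b) ?_ ?_).trans
            (mul_le_mul_of_nonneg_right (meanSquareFactor_truncationLength_le hl) (by positivity))
          · gcongr
            nlinarith
          · have : 0 ≤ Real.log (truncationLength l) := Real.log_natCast_nonneg _
            positivity
      _ = _ := by ring
  have hdecay := truncationLength_add_rpow_neg_le (l := l) (by linarith) hα.1 hσ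
  have hgrowth := truncationLength_add_rpow_one_sub_div_le (l := l) (by linarith) hα hσ
  calc _ ≤ 10 * l ^ 2 * Real.exp (-y)
          + (32 * l * Real.exp (-y) + 6 * l * Real.exp (-y)) := by
        gcongr
        · exact hdecay.trans hexp
        · exact hgrowth.trans (by gcongr)
    _ = (10 * l ^ 2 + 38 * l) * Real.exp (-y) := by ring
    _ ≤ 48 * l ^ 2 * Real.exp (-y) := by
        gcongr
        nlinarith

end Truncation

section LargeTime

variable {α θ δ Ω l σ : ℝ}

/-- The length of the Dirichlet polynomial whose characteristic function is computed through its
moments, as a function of `l = log T`. -/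
noncomputable def polyLength (θ l : ℝ) : ℕ := ⌈Real.exp (l ^ (3 * θ / 2))⌉₊ + 1

/-- The conditions on `l = log T` under which the characteristic function of the Lerch zeta-function
on `[0, T]` is compared with that of the limit law. -/
structure LargeEnough (α θ δ Ω l : ℝ) : Prop where
  three_le : 3 ≤ l
  log_le : Real.log (6 * l) ≤ l ^ (3 * θ / 2)
  two_le : 2 ≤ l ^ (3 * θ / 2)
  le_rpow_quarter : 48 ≤ l ^ (θ / 4)
  mul_rpow_le : (8 + 32 * Ω) * l ^ (4 * δ + 4 * θ) ≤ l / 2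
  rpow_half_le : l ^ (θ / 2) ≤ l / 4
  cube_le : 108 * l ^ 3 ≤ Real.exp (l ^ (θ / 2) / 2)
  spacedAt : SpacedAt α Ω (polyLength θ l)
  neg_log_le : -Real.log α ≤ θ * √(Real.log l)

lemma exp_le_polyLength_sub_one (θ l : ℝ) :
    Real.exp (l ^ (3 * θ / 2)) ≤ (polyLength θ l : ℝ) - 1 := by
  rw [polyLength, Nat.cast_succ, add_sub_cancel_right]
  exact Nat.le_ceil _

lemma tendsto_polyLength (hθ : 0 < θ) :
    Tendsto (fun l : ℝ => (polyLength θ l : ℝ)) atTop atTop :=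
  tendsto_atTop_mono (fun l => (exp_le_polyLength_sub_one θ l).trans (sub_le_self _ zero_le_one))
    (Real.tendsto_exp_atTop.comp (tendsto_rpow_atTop (by positivity)))

lemma eventually_mul_rpow_le (c : ℝ) {p d : ℝ} (hp : p < 1) (hd : 0 < d) :
    ∀ᶠ l : ℝ in atTop, c * l ^ p ≤ d * l := by
  filter_upwards [eventually_gt_atTop 0,
    (tendsto_rpow_atTop (sub_pos.2 hp)).eventually_ge_atTop (c / d)] with l hl hpow
  calc c * l ^ p ≤ d * l ^ (1 - p) * l ^ p := by
        gcongr
        exact (div_le_iff₀' hd).1 hpow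
    _ = d * l := by rw [mul_assoc, ← Real.rpow_add hl, sub_add_cancel, Real.rpow_one]

lemma eventually_add_mul_log_le_rpow (c a : ℝ) {p d : ℝ} (hp : 0 < p) (hd : 0 < d) :
    ∀ᶠ l : ℝ in atTop, c + a * Real.log l ≤ d * l ^ p := by
  have hconst : (fun _ : ℝ => c) =o[atTop] fun l : ℝ => l ^ p :=
    (Asymptotics.isLittleO_const_left.2 <| Or.inr <|
      tendsto_norm_atTop_atTop.comp (tendsto_rpow_atTop hp))
  filter_upwards [(hconst.add ((isLittleO_log_rpow_atTop hp).const_mul_left a)).bound hd,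
    eventually_ge_atTop 0] with l hbound hl
  rw [Real.norm_of_nonneg (Real.rpow_nonneg hl p)] at hbound
  exact (le_abs_self _).trans hbound

lemma eventually_largeEnough (hθ : 0 < θ) (hδ : 0 < δ) (hθδ : θ + δ < 1 / 4)
    (hspaced : ∀ᶠ X : ℝ in atTop, SpacedAt α Ω X) :
    ∀ᶠ l : ℝ in atTop, LargeEnough α θ δ Ω l := by
  have hlog_alpha : ∀ᶠ l : ℝ in atTop, -Real.log α ≤ θ * √(Real.log l) :=
    ((Real.tendsto_sqrt_atTop.comp Real.tendsto_log_atTop).const_mul_atTop hθ).eventually_ge_atTop _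
  filter_upwards [eventually_ge_atTop 3,
    eventually_add_mul_log_le_rpow (Real.log 6) 1 (p := 3 * θ / 2) (by positivity) one_pos,
    (tendsto_rpow_atTop (y := 3 * θ / 2) (by positivity)).eventually_ge_atTop 2,
    (tendsto_rpow_atTop (y := θ / 4) (by positivity)).eventually_ge_atTop 48,
    eventually_mul_rpow_le (8 + 32 * Ω) (p := 4 * δ + 4 * θ) (by linarith) one_half_pos,
    eventually_mul_rpow_le 1 (p := θ / 2) (d := 1 / 4) (by linarith) (by norm_num),
    eventually_add_mul_log_le_rpow (Real.log 108) 3 (p := θ / 2) (by positivity) one_half_pos,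
    (tendsto_polyLength hθ).eventually hspaced, hlog_alpha]
    with l three_le log_le two_le quarter exponent half cube spaced log_alpha
  have hl0 : 0 < l := by linarith
  refine ⟨three_le, ?_, two_le, quarter, by linarith, by linarith, ?_, spaced, log_alpha⟩
  · rw [Real.log_mul (by norm_num) hl0.ne']
    linarith
  · rw [← Real.log_le_iff_le_exp (by positivity), Real.log_mul (by norm_num) (by positivity),
      Real.log_pow]
    push_cast
    linarith

end LargeTime

section ParameterEstimates

variable {l α θ δ Ω σ : ℝ} {v : ℂ}

lemma circleRadius_le (hα : 0 < α) (hσ : 0 ≤ σ) (n : ℕ) : circleRadius σ α n ≤ α ^ (-σ) :=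
  Real.rpow_le_rpow_of_nonpos hα (by linarith [n.cast_nonneg (α := ℝ)]) (neg_nonpos.2 hσ)

lemma rpow_neg_two_mul_le (hα : α ∈ Set.Ioc (0 : ℝ) 1) (hl : 1 ≤ l) (hσ0 : 0 ≤ σ)
    (hσ : 2 * σ ≤ √(Real.log l)) (hlog : -Real.log α ≤ θ * √(Real.log l)) :
    α ^ (-(2 * σ)) ≤ l ^ θ := by
  have hlog0 : 0 ≤ -Real.log α := neg_nonneg.2 (Real.log_nonpos hα.1.le hα.2)
  rw [Real.rpow_def_of_pos hα.1, Real.rpow_def_of_pos (by linarith), Real.exp_le_exp]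
  calc Real.log α * -(2 * σ) = -Real.log α * (2 * σ) := by ring
    _ ≤ θ * √(Real.log l) * √(Real.log l) :=
        mul_le_mul hlog hσ (by positivity) (hlog0.trans hlog)
    _ = Real.log l * θ := by rw [mul_assoc, Real.mul_self_sqrt (Real.log_nonneg hl), mul_comm]

lemma two_mul_add_exp_mul_le_truncationLength (hl : 1 ≤ l) (hσ : 2 * σ ≤ √(Real.log l)) :
    2 * (σ + Real.exp l) * l ≤ truncationLength l := by
  have hsqrt : √(Real.log l) ≤ l :=
    Real.sqrt_le_iff.2 ⟨by linarith, by
      nlinarith [Real.log_le_sub_one_of_pos (show 0 < l by linarith)]⟩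
  nlinarith [le_truncationLength l, Real.add_one_le_exp l]

lemma two_le_polyLength (θ l : ℝ) : 2 ≤ polyLength θ l :=
  Nat.succ_le_succ (Nat.one_le_ceil_iff.2 (Real.exp_pos _))

lemma polyLength_le (hl : 0 ≤ l) : (polyLength θ l : ℝ) ≤ 3 * Real.exp (l ^ (3 * θ / 2)) := by
  have hceil := Nat.ceil_lt_add_one (Real.exp_pos (l ^ (3 * θ / 2))).le
  have hexp : 1 ≤ Real.exp (l ^ (3 * θ / 2)) := Real.one_le_exp (by positivity)
  rw [polyLength, Nat.cast_succ]
  linarith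

lemma polyLength_le_truncationLength (hl : 1 ≤ l) (hθ : 3 * θ / 2 ≤ 1) :
    polyLength θ l ≤ truncationLength l := by
  have hlen : (polyLength θ l : ℝ) ≤ truncationLength l := by
    calc (polyLength θ l : ℝ) ≤ 3 * Real.exp (l ^ (3 * θ / 2)) := polyLength_le (by linarith)
      _ ≤ 3 * Real.exp l := by gcongr; exact Real.rpow_le_self_of_one_le hl hθ
      _ ≤ 4 * Real.exp l * l := by nlinarith [Real.exp_pos l]
      _ ≤ truncationLength l := le_truncationLength l
  exact_mod_cast hlen

lemma LargeEnough.polyLength_le_exp (h : LargeEnough α θ δ Ω l) :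
    (polyLength θ l : ℝ) ≤ Real.exp (2 * l ^ (3 * θ / 2)) := by
  have hthree : 3 ≤ Real.exp (l ^ (3 * θ / 2)) := by
    linarith [Real.add_one_le_exp (l ^ (3 * θ / 2)), h.two_le]
  calc (polyLength θ l : ℝ) ≤ 3 * Real.exp (l ^ (3 * θ / 2)) :=
        polyLength_le (by linarith [h.three_le])
    _ ≤ Real.exp (l ^ (3 * θ / 2)) * Real.exp (l ^ (3 * θ / 2)) := by gcongr
    _ = Real.exp (2 * l ^ (3 * θ / 2)) := by rw [← Real.exp_add, two_mul]

lemma sum_circleRadius_sq_polyLength_tail_le (hα : 0 < α) (hl : 0 < l)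
    (hσ : 1 / 2 + l ^ (-θ) ≤ σ) (M : ℕ) :
    ∑ n ∈ Finset.Ico (polyLength θ l) M, circleRadius σ α n ^ 2
      ≤ Real.exp (-2 * l ^ (θ / 2)) * l ^ θ := by
  have hpow : ((polyLength θ l : ℝ) - 1) ^ (-(2 * l ^ (-θ))) ≤ Real.exp (-2 * l ^ (θ / 2)) := by
    calc _ ≤ Real.exp (l ^ (3 * θ / 2)) ^ (-(2 * l ^ (-θ))) :=
          Real.rpow_le_rpow_of_nonpos (Real.exp_pos _) (exp_le_polyLength_sub_one θ l)
            (neg_nonpos.2 (by positivity))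
      _ = Real.exp (-2 * (l ^ (3 * θ / 2) * l ^ (-θ))) := by
          rw [← Real.exp_mul]
          ring_nf
      _ = Real.exp (-2 * l ^ (θ / 2)) := by
          rw [← Real.rpow_add hl]
          ring_nf
  calc _ ≤ ((polyLength θ l : ℝ) - 1) ^ (-(2 * l ^ (-θ))) / (2 * l ^ (-θ)) :=
        sum_circleRadius_sq_tail_le hα (by positivity) hσ (two_le_polyLength θ l) M
    _ ≤ Real.exp (-2 * l ^ (θ / 2)) / l ^ (-θ) := by
        gcongr
        linarith [Real.rpow_pos_of_pos hl (-θ)]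
    _ = Real.exp (-2 * l ^ (θ / 2)) * l ^ θ := by
        rw [Real.rpow_neg hl.le, div_inv_eq_mul]

lemma LargeEnough.norm_mul_sum_circleRadius_le (h : LargeEnough α θ δ Ω l)
    (hα : α ∈ Set.Ioc (0 : ℝ) 1) (hθδ : δ + θ ≤ 1) (hσ : 0 ≤ σ) (hσl : 2 * σ ≤ √(Real.log l))
    (hv : ‖v‖ ≤ 2 * l ^ δ) :
    ‖v‖ * ∑ n ∈ Finset.range (polyLength θ l), circleRadius σ α n
      ≤ Real.exp (2 * l ^ (3 * θ / 2)) := by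
  have hl1 : 1 ≤ l := by linarith [h.three_le]
  have hl0 : 0 < l := by linarith
  have hradius (n : ℕ) : circleRadius σ α n ≤ l ^ θ :=
    calc circleRadius σ α n ≤ α ^ (-σ) := circleRadius_le hα.1 hσ n
      _ ≤ α ^ (-(2 * σ)) := Real.rpow_le_rpow_of_exponent_ge hα.1 hα.2 (by linarith)
      _ ≤ l ^ θ := rpow_neg_two_mul_le hα hl1 hσ hσl h.neg_log_le
  have hsum : ∑ n ∈ Finset.range (polyLength θ l), circleRadius σ α n ≤ polyLength θ l * l ^ θ := by
    simpa using Finset.sum_le_card_nsmul (Finset.range (polyLength θ l)) _ _ fun n _ => hradius n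
  have hexp : 6 * l ≤ Real.exp (l ^ (3 * θ / 2)) :=
    (Real.log_le_iff_le_exp (by positivity)).1 h.log_le
  calc _ ≤ 2 * l ^ δ * (3 * Real.exp (l ^ (3 * θ / 2)) * l ^ θ) := by
        refine mul_le_mul hv (hsum.trans ?_)
          (Finset.sum_nonneg fun n _ => (circleRadius_pos hα.1 σ n).le) (by positivity)
        gcongr
        exact polyLength_le hl0.le
    _ = 6 * l ^ (δ + θ) * Real.exp (l ^ (3 * θ / 2)) := by
        rw [Real.rpow_add hl0]
        ring
    _ ≤ Real.exp (l ^ (3 * θ / 2)) * Real.exp (l ^ (3 * θ / 2)) := by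
        gcongr
        linarith [Real.rpow_le_self_of_one_le hl1 hθδ]
    _ = Real.exp (2 * l ^ (3 * θ / 2)) := by rw [← Real.exp_add, two_mul]

lemma norm_sq_le_of_le_two_mul_rpow (hl : 0 < l) (hv : ‖v‖ ≤ 2 * l ^ δ) :
    ‖v‖ ^ 2 ≤ 4 * l ^ (2 * δ) := by
  calc ‖v‖ ^ 2 ≤ (2 * l ^ δ) ^ 2 := by gcongr
    _ = 4 * l ^ (2 * δ) := by
        rw [mul_comm 2 δ, Real.rpow_mul hl.le, Real.rpow_two]
        ring

lemma LargeEnough.norm_sq_mul_sum_circleRadius_sq_le (h : LargeEnough α θ δ Ω l)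
    (hα : α ∈ Set.Ioc (0 : ℝ) 1) (hθ : 0 ≤ θ) (hσ : 1 / 2 + l ^ (-θ) ≤ σ)
    (hσl : 2 * σ ≤ √(Real.log l)) (hv : ‖v‖ ≤ 2 * l ^ δ) :
    ‖v‖ ^ 2 * ∑ n ∈ Finset.range (polyLength θ l), circleRadius σ α n ^ 2
      ≤ 12 * l ^ (2 * δ + θ) := by
  have hl1 : 1 ≤ l := by linarith [h.three_le]
  have hl0 : 0 < l := by linarith
  have hε : 0 < l ^ (-θ) := by positivity
  have hinv : 1 / (2 * l ^ (-θ)) = l ^ θ / 2 := by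
    rw [Real.rpow_neg hl0.le]
    field_simp
  have hsum : ∑ n ∈ Finset.range (polyLength θ l), circleRadius σ α n ^ 2 ≤ 3 * l ^ θ := by
    refine (sum_circleRadius_sq_le hα.1 hε hσ (two_le_polyLength θ l)).trans ?_
    linarith [rpow_neg_two_mul_le hα hl1 (by linarith) hσl h.neg_log_le,
      Real.one_le_rpow hl1 hθ]
  calc _ ≤ 4 * l ^ (2 * δ) * (3 * l ^ θ) :=
        mul_le_mul (norm_sq_le_of_le_two_mul_rpow hl0 hv) hsum
          (Finset.sum_nonneg fun _ _ => sq_nonneg _) (by positivity)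
    _ = 12 * l ^ (2 * δ + θ) := by
        rw [Real.rpow_add hl0]
        ring

end ParameterEstimates

section ErrorTerms

variable {l α θ δ Ω σ : ℝ} {v : ℂ}

lemma moment_error_le {g b N : ℝ} (hΩ : 0 ≤ Ω) (hg : 0 ≤ g) (hb : 1 ≤ b) (hN : 0 < N)
    (hNg : N ≤ Real.exp (2 * g)) {k : ℕ} (hk : (k : ℝ) ≤ 2 * b)
    (h : (8 + 32 * Ω) * (b ^ 2 * g) ≤ l / 2) :
    6 * Real.exp (2 * g) ^ (2 * k) / (Real.exp l * N ^ (-(Ω * ((2 * k : ℕ) : ℝ) ^ 2)))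
      ≤ 6 * Real.exp (-(l / 2)) := by
  have hspacing : Real.exp (-(8 * (Ω * k ^ 2 * g))) ≤ N ^ (-(Ω * ((2 * k : ℕ) : ℝ) ^ 2)) := by
    calc Real.exp (-(8 * (Ω * k ^ 2 * g)))
        = Real.exp (2 * g) ^ (-(Ω * ((2 * k : ℕ) : ℝ) ^ 2)) := by
          rw [← Real.exp_mul]
          push_cast
          ring_nf
      _ ≤ N ^ (-(Ω * ((2 * k : ℕ) : ℝ) ^ 2)) :=
          Real.rpow_le_rpow_of_nonpos hN hNg (neg_nonpos.2 (by positivity))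
  have hexponent : 4 * (k * g) + 8 * (Ω * k ^ 2 * g) ≤ l / 2 := by
    have hksq : (k : ℝ) ^ 2 ≤ 4 * b ^ 2 := by nlinarith [k.cast_nonneg (α := ℝ)]
    have hlin : (k : ℝ) * g ≤ 2 * b ^ 2 * g := by
      gcongr
      nlinarith
    have hquad : Ω * k ^ 2 * g ≤ Ω * (4 * b ^ 2) * g := by gcongr
    linarith
  calc _ ≤ 6 * Real.exp (2 * g) ^ (2 * k) / (Real.exp l * Real.exp (-(8 * (Ω * k ^ 2 * g)))) := by
        gcongr
    _ = 6 * Real.exp (4 * (k * g) + 8 * (Ω * k ^ 2 * g) - l) := by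
        rw [← Real.exp_nat_mul, mul_div_assoc, ← Real.exp_add, ← Real.exp_sub]
        push_cast
        ring_nf
    _ ≤ 6 * Real.exp (-(l / 2)) := by
        gcongr
        linarith

lemma LargeEnough.moment_error_le (h : LargeEnough α θ δ Ω l) (hΩ : 0 ≤ Ω) (hθ : 0 ≤ θ)
    (hδ : 0 ≤ δ) {k : ℕ} (hk : k = ⌈l ^ (2 * δ + 5 * θ / 4)⌉₊) :
    6 * Real.exp (2 * l ^ (3 * θ / 2)) ^ (2 * k)
          / (Real.exp l * (polyLength θ l : ℝ) ^ (-(Ω * ((2 * k : ℕ) : ℝ) ^ 2)))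
        + 2 * Real.exp (4 * (12 * l ^ (2 * δ + θ)) - 2 * k)
      ≤ 8 * Real.exp (-l ^ (θ / 2)) := by
  have hl1 : 1 ≤ l := by linarith [h.three_le]
  have hl0 : 0 < l := by linarith
  have hb : 1 ≤ l ^ (2 * δ + 5 * θ / 4) := Real.one_le_rpow hl1 (by positivity)
  have hkb : l ^ (2 * δ + 5 * θ / 4) ≤ k := hk ▸ Nat.le_ceil _
  have hk2 : (k : ℝ) ≤ 2 * l ^ (2 * δ + 5 * θ / 4) := by
    linarith [hk ▸ Nat.ceil_lt_add_one (zero_le_one.trans hb)]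
  have hN : (0 : ℝ) < polyLength θ l := Nat.cast_pos.2 (two_pos.trans_le (two_le_polyLength θ l))
  have hexponent : (8 + 32 * Ω) * ((l ^ (2 * δ + 5 * θ / 4)) ^ 2 * l ^ (3 * θ / 2)) ≤ l / 2 := by
    refine Eq.trans_le ?_ h.mul_rpow_le
    rw [sq, ← Real.rpow_add hl0, ← Real.rpow_add hl0]
    ring_nf
  have hmoment := LerchMean.moment_error_le hΩ (by positivity) hb hN h.polyLength_le_exp hk2
    hexponent
  have hsum : 4 * (12 * l ^ (2 * δ + θ)) ≤ l ^ (2 * δ + 5 * θ / 4) := by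
    calc 4 * (12 * l ^ (2 * δ + θ)) = l ^ (2 * δ + θ) * 48 := by ring
      _ ≤ l ^ (2 * δ + θ) * l ^ (θ / 4) := by gcongr; exact h.le_rpow_quarter
      _ = l ^ (2 * δ + 5 * θ / 4) := by
          rw [← Real.rpow_add hl0]
          ring_nf
  have hy : l ^ (θ / 2) ≤ l ^ (2 * δ + 5 * θ / 4) :=
    Real.rpow_le_rpow_of_exponent_le hl1 (by linarith)
  have hmoment' : Real.exp (-(l / 2)) ≤ Real.exp (-l ^ (θ / 2)) :=
    Real.exp_le_exp.2 (by linarith [h.rpow_half_le])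
  have htaylor : Real.exp (4 * (12 * l ^ (2 * δ + θ)) - 2 * k) ≤ Real.exp (-l ^ (θ / 2)) :=
    Real.exp_le_exp.2 (by linarith)
  linarith

lemma norm_sq_div_two_mul_tail_le (hl : 1 ≤ l) (hθδ : 2 * δ + θ ≤ 1) (hv : ‖v‖ ≤ 2 * l ^ δ) :
    ‖v‖ ^ 2 / 2 * (Real.exp (-2 * l ^ (θ / 2)) * l ^ θ) ≤ 2 * l * Real.exp (-l ^ (θ / 2)) := by
  have hl0 : 0 < l := by linarith
  calc _ ≤ 4 * l ^ (2 * δ) / 2 * (Real.exp (-l ^ (θ / 2)) * l ^ θ) := by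
        gcongr
        · exact norm_sq_le_of_le_two_mul_rpow hl0 hv
        · linarith [Real.rpow_pos_of_pos hl0 (θ / 2)]
    _ = 2 * l ^ (2 * δ + θ) * Real.exp (-l ^ (θ / 2)) := by
        rw [Real.rpow_add hl0]
        ring
    _ ≤ 2 * l * Real.exp (-l ^ (θ / 2)) := by
        gcongr
        exact Real.rpow_le_self_of_one_le hl hθδ

lemma LargeEnough.total_error_le (h : LargeEnough α θ δ Ω l) :
    2 * Real.exp (-l ^ (θ / 2)) + 2 * l * (48 * l ^ 2 * Real.exp (-l ^ (θ / 2)))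
        + 8 * Real.exp (-l ^ (θ / 2)) + 2 * l * Real.exp (-l ^ (θ / 2))
      ≤ Real.exp (-(1 / 2) * l ^ (θ / 2)) := by
  have hl1 : 1 ≤ l := by linarith [h.three_le]
  have hone : 1 ≤ l ^ 3 := one_le_pow₀ hl1
  have hlin : l ≤ l ^ 3 := le_self_pow₀ hl1 three_ne_zero
  calc _ = (10 + 2 * l + 96 * l ^ 3) * Real.exp (-l ^ (θ / 2)) := by ring
    _ ≤ Real.exp (l ^ (θ / 2) / 2) * Real.exp (-l ^ (θ / 2)) := by
        gcongr
        linarith [h.cube_le]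
    _ = Real.exp (-(1 / 2) * l ^ (θ / 2)) := by
        rw [← Real.exp_add]
        ring_nf

lemma norm_integral_exp_lerchZeta_sub_charFun_le_exp {lam : ℝ} (hα : α ∈ Set.Ioc (0 : ℝ) 1)
    (hind : LinearIndependent ℚ fun n : ℕ => Real.log (n + α)) (hΩ : 0 ≤ Ω) (hθ : 0 < θ)
    (hδ : 0 < δ) (hθδ : θ + δ < 1 / 4) (hl : LargeEnough α θ δ Ω l) (hlam : lamBound lam ≤ l)
    (hσ : 1 / 2 + l ^ (-θ) ≤ σ) (hσl : 2 * σ ≤ √(Real.log l)) (hv : ‖v‖ ≤ 2 * l ^ δ)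
    {φ : ProbabilityMeasure ℂ} (hφ : Tendsto (partialConv σ α) atTop (𝓝 φ)) :
    ‖∫ t : ℝ, Complex.exp ((⟪lerchZeta lam α (σ + t * I), v⟫ : ℝ) * I)
        ∂uniformAverage (Real.exp l) - charFun (φ : Measure ℂ) v‖
      ≤ Real.exp (-(1 / 2) * l ^ (θ / 2)) := by
  have hl3 := hl.three_le
  have hl1 : 1 ≤ l := by linarith
  have hσ2 : 1 / 2 ≤ σ := by linarith [Real.rpow_pos_of_pos (show 0 < l by linarith) (-θ)]
  have hN2 := two_le_polyLength θ l
  have hv' : ‖v‖ ≤ 2 * l := hv.trans (by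
    gcongr
    exact Real.rpow_le_self_of_one_le hl1 (by linarith))
  have hpow : Real.exp l ^ (-(1 / 4) : ℝ) ≤ Real.exp (-l ^ (θ / 2)) := by
    rw [← Real.exp_mul]
    exact Real.exp_le_exp.2 (by linarith [hl.rpow_half_le])
  have htruncation := truncation_error_le hl3 (Set.Ioc_subset_Icc_self hα) hσ2 hl.rpow_half_le
    (Real.rpow_le_self_of_one_le hl1 (show θ ≤ 1 by linarith))
  have hmoment := hl.moment_error_le hΩ hθ.le hδ.le rfl
  have htail := norm_sq_div_two_mul_tail_le hl1 (show 2 * δ + θ ≤ 1 by linarith) hv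
  refine (norm_integral_exp_lerchZeta_sub_charFun_le hα hind hΩ hlam hσ2
    (Real.one_le_exp (by linarith)) (by linarith)
    (polyLength_le_truncationLength hl1 (by linarith)) hl.spacedAt
    (by linarith [two_mul_add_exp_mul_le_truncationLength hl1 hσl, hα.1])
    (sum_circleRadius_sq_polyLength_tail_le hα.1 (by linarith) hσ) v
    ⌈l ^ (2 * δ + 5 * θ / 4)⌉₊ (Real.one_le_exp (by positivity))
    (hl.norm_mul_sum_circleRadius_le hα (by linarith) (by linarith) hσl hv)
    (hl.norm_sq_mul_sum_circleRadius_sq_le hα hθ.le hσ hσl hv) hφ).trans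
    (le_trans (add_le_add (add_le_add (add_le_add ?_ ?_) hmoment) htail) hl.total_error_le)
  · gcongr
  · exact (mul_le_mul_of_nonneg_left htruncation (norm_nonneg v)).trans (by gcongr)

end ErrorTerms

section FourierInversion

variable {X : Type*} [MeasurableSpace X] {μ : Measure X} {f : X → ℂ}

lemma psi_neg_eq (z w : ℂ) : psi (-z) w = Complex.exp ((⟪z, -w⟫ : ℝ) * I) := by
  rw [psi, mul_comm, Complex.inner]
  simp [mul_comm]

instance : SFinite dz := by
  unfold dz
  infer_instance

lemma continuous_integral_exp_inner [IsFiniteMeasure μ] (hf : AEStronglyMeasurable f μ) :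
    Continuous fun v : ℂ => ∫ x, Complex.exp ((⟪f x, v⟫ : ℝ) * I) ∂μ :=
  continuous_of_dominated (bound := fun _ => 1)
    (fun v => (integrable_exp_inner hf v).aestronglyMeasurable)
    (fun _ => ae_of_all _ fun _ => (Complex.norm_exp_ofReal_mul_I _).le) (integrable_const _)
    (ae_of_all _ fun _ => by fun_prop)

lemma norm_integral_exp_inner_le_one [IsProbabilityMeasure μ] (f : X → ℂ) (v : ℂ) :
    ‖∫ x, Complex.exp ((⟪f x, v⟫ : ℝ) * I) ∂μ‖ ≤ 1 := by
  simpa using norm_integral_le_of_norm_le_const (μ := μ) (C := 1)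
    (ae_of_all _ fun x => (Complex.norm_exp_ofReal_mul_I ⟪f x, v⟫).le)

lemma integral_integral_mul_psi_neg [IsFiniteMeasure μ] (hf : AEStronglyMeasurable f μ)
    {g : ℂ → ℂ} (hg : Integrable g dz) :
    ∫ x, ∫ w, g w * psi (-f x) w ∂dz ∂μ
      = ∫ w, g w * ∫ x, Complex.exp ((⟪f x, -w⟫ : ℝ) * I) ∂μ ∂dz := by
  simp only [psi_neg_eq]
  rw [integral_integral_swap]
  · simp only [integral_const_mul]
  · have hcont : Continuous fun p : ℂ × ℂ => Complex.exp ((⟪p.1, -p.2⟫ : ℝ) * I) := by fun_prop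
    have hmeas : AEStronglyMeasurable
        (fun p : X × ℂ => Complex.exp ((⟪f p.1, -p.2⟫ : ℝ) * I)) (μ.prod dz) :=
      hcont.comp_aestronglyMeasurable (f := fun p : X × ℂ => (f p.1, p.2))
        (hf.comp_fst.prodMk aestronglyMeasurable_id.comp_snd)
    exact (hg.comp_snd μ).mul_bdd (c := 1) hmeas
      (ae_of_all _ fun _ => (Complex.norm_exp_ofReal_mul_I _).le)

lemma ClassLambda.integrable_fourierT {Φ : ℂ → ℂ} (hΦ : ClassLambda Φ) :
    Integrable (fourierT Φ) dz :=
  memLp_one_iff_integrable.1 hΦ.fourier_memL1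

lemma ClassLambda.integral_comp_eq [IsFiniteMeasure μ] {Φ : ℂ → ℂ} (hΦ : ClassLambda Φ)
    (hf : AEStronglyMeasurable f μ) :
    ∫ x, Φ (f x) ∂μ
      = ∫ w, fourierT Φ w * ∫ x, Complex.exp ((⟪f x, -w⟫ : ℝ) * I) ∂μ ∂dz := by
  simp only [← integral_integral_mul_psi_neg hf hΦ.integrable_fourierT, ← hΦ.inversion]

lemma norm_integral_mul_le_of_norm_le_on {Y : Type*} [MeasurableSpace Y] {ν : Measure Y}
    {g D : Y → ℂ} (hg : Integrable g ν) (hD : AEStronglyMeasurable D ν) {s : Set Y}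
    (hs : MeasurableSet s) {a c : ℝ} (ha : ∀ w ∈ s, ‖D w‖ ≤ a) (hc : ∀ w, ‖D w‖ ≤ c) :
    ‖∫ w, g w * D w ∂ν‖ ≤ a * ∫ w in s, ‖g w‖ ∂ν + c * ∫ w in sᶜ, ‖g w‖ ∂ν := by
  have hint : Integrable (fun w => ‖g w * D w‖) ν := (hg.mul_bdd hD (ae_of_all _ hc)).norm
  have hmul {w : Y} {b : ℝ} (hb : ‖D w‖ ≤ b) : ‖g w * D w‖ ≤ b * ‖g w‖ := by
    rw [norm_mul, mul_comm]
    gcongr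
  refine (norm_integral_le_integral_norm _).trans ?_
  rw [← integral_add_compl hs hint, ← integral_const_mul, ← integral_const_mul]
  exact add_le_add
    (setIntegral_mono_on hint.integrableOn (hg.norm.const_mul a).integrableOn hs
      fun w hw => hmul (ha w hw))
    (setIntegral_mono hint.integrableOn (hg.norm.const_mul c).integrableOn fun w => hmul (hc w))

lemma ClassLambda.norm_integral_comp_sub_integral_le [IsProbabilityMeasure μ] {Φ : ℂ → ℂ}
    (hΦ : ClassLambda Φ) (hf : AEStronglyMeasurable f μ) {φ : Measure ℂ} [IsProbabilityMeasure φ]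
    {s : Set ℂ} (hs : MeasurableSet s) {a : ℝ}
    (ha : ∀ w ∈ s, ‖∫ x, Complex.exp ((⟪f x, -w⟫ : ℝ) * I) ∂μ - charFun φ (-w)‖ ≤ a) :
    ‖∫ x, Φ (f x) ∂μ - ∫ z, Φ z ∂φ‖
      ≤ a * ∫ w in s, ‖fourierT Φ w‖ ∂dz + 2 * ∫ w in sᶜ, ‖fourierT Φ w‖ ∂dz := by
  have hid : AEStronglyMeasurable (fun z : ℂ => z) φ := aestronglyMeasurable_id
  have hμ : AEStronglyMeasurable (fun w => ∫ x, Complex.exp ((⟪f x, -w⟫ : ℝ) * I) ∂μ) dz :=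
    ((continuous_integral_exp_inner hf).comp continuous_neg).aestronglyMeasurable
  have hφ : AEStronglyMeasurable (fun w => ∫ z, Complex.exp ((⟪z, -w⟫ : ℝ) * I) ∂φ) dz :=
    ((continuous_integral_exp_inner hid).comp continuous_neg).aestronglyMeasurable
  have hμ1 (w : ℂ) := norm_integral_exp_inner_le_one (μ := μ) f (-w)
  have hφ1 (w : ℂ) := norm_integral_exp_inner_le_one (μ := φ) (fun z => z) (-w)
  have hg := hΦ.integrable_fourierT
  rw [hΦ.integral_comp_eq hf, hΦ.integral_comp_eq hid,
    ← integral_sub (hg.mul_bdd hμ (ae_of_all _ hμ1)) (hg.mul_bdd hφ (ae_of_all _ hφ1))]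
  simp only [← mul_sub]
  refine norm_integral_mul_le_of_norm_le_on hg (hμ.sub hφ) hs
    (fun w hw => by simpa only [charFun_apply, Pi.sub_apply] using ha w hw) fun w => ?_
  exact (norm_sub_le _ _).trans (by linarith [hμ1 w, hφ1 w])

end FourierInversion

section MeanValueTheorem

variable {lam α θ δ T σ σ₁ : ℝ}

lemma IsLimitDensity.integral_mul_eq {M : ℂ → ℝ} (hM : IsLimitDensity σ α M) (Φ : ℂ → ℂ)
    {φ : Measure ℂ} (hφ : φ = dz.withDensity fun z => ENNReal.ofReal (M z)) :
    ∫ z, Φ z * (M z : ℂ) ∂dz = ∫ z, Φ z ∂φ := by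
  rw [hφ, integral_withDensity_eq_integral_toReal_smul hM.continuous.measurable.ennreal_ofReal
    (ae_of_all _ fun _ => ENNReal.ofReal_lt_top)]
  simp only [ENNReal.toReal_ofReal (hM.nonneg _), Complex.real_smul, mul_comm]

lemma ClassLambda.norm_mean_lerchZeta_sub_integral_density_le {Φ : ℂ → ℂ} (hΦ : ClassLambda Φ)
    (hα : 0 < α) (hσ : 1 / 2 < σ) (hT : 0 < T) {s : Set ℂ} (hs : MeasurableSet s) {a : ℝ}
    (ha : ∀ φ : ProbabilityMeasure ℂ, Tendsto (partialConv σ α) atTop (𝓝 φ) → ∀ w ∈ s,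
      ‖∫ t : ℝ, Complex.exp ((⟪lerchZeta lam α (σ + t * I), -w⟫ : ℝ) * I) ∂uniformAverage T
        - charFun (φ : Measure ℂ) (-w)‖ ≤ a) :
    ‖(1 / (T : ℂ)) * (∫ t in (0 : ℝ)..T, Φ (lerchZeta lam α ((σ : ℂ) + (t : ℂ) * I)))
        - ∫ z, Φ z * (densityM σ α z : ℂ) ∂dz‖
      ≤ a * ∫ w in s, ‖fourierT Φ w‖ ∂dz + 2 * ∫ w in sᶜ, ‖fourierT Φ w‖ ∂dz := by
  have := isProbabilityMeasure_uniformAverage hT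
  have hM := isLimitDensity_densityM hα hσ
  obtain ⟨φ, hφ, hdensity⟩ := hM.isLimit
  have hmean : (1 / (T : ℂ)) * (∫ t in (0 : ℝ)..T, Φ (lerchZeta lam α ((σ : ℂ) + (t : ℂ) * I)))
      = ∫ t : ℝ, Φ (lerchZeta lam α (σ + t * I)) ∂uniformAverage T := by
    rw [integral_uniformAverage hT, Complex.real_smul, Complex.ofReal_inv, one_div]
  rw [hmean, hM.integral_mul_eq Φ hdensity]
  exact hΦ.norm_integral_comp_sub_integral_le
    (aestronglyMeasurable_lerchZeta hα lam (by linarith) T) hs (ha φ hφ)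

lemma measurableSet_squareΩ (δ T : ℝ) : MeasurableSet (squareΩ δ T) :=
  ((isClosed_le Complex.continuous_re.abs continuous_const).inter
    (isClosed_le Complex.continuous_im.abs continuous_const)).measurableSet

lemma norm_neg_le_of_mem_squareΩ {w : ℂ} (hw : w ∈ squareΩ δ T) :
    ‖-w‖ ≤ 2 * Real.log T ^ δ := by
  rw [norm_neg]
  linarith [Complex.norm_le_abs_re_add_abs_im w, hw.1, hw.2]

/-- The value of `log T` beyond which the comparison of the characteristic functions holds without
a further constant, for given `lam` and all `σ ≤ σ₁`. -/
noncomputable def logThreshold (lam σ₁ : ℝ) : ℝ := max (lamBound lam) (Real.exp (4 * σ₁ ^ 2))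

/-- The constant of the theorem. It is so large that the theorem is trivial as long as
`log T ≤ logThreshold lam σ₁`, hence `T₀` need not depend on `lam` and `σ₁`. -/
noncomputable def meanConst (lam σ₁ : ℝ) : ℝ := 2 * Real.exp (logThreshold lam σ₁ / 2)

lemma two_le_meanConst (lam σ₁ : ℝ) : 2 ≤ meanConst lam σ₁ := by
  have hthreshold : 1 ≤ logThreshold lam σ₁ := (one_le_lamBound lam).trans (le_max_left _ _)
  have hexp : 1 ≤ Real.exp (logThreshold lam σ₁ / 2) := Real.one_le_exp (by linarith)
  rw [meanConst]
  linarith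

lemma two_le_meanConst_mul_exp {l y : ℝ} (hy : y ≤ l) (hl : l ≤ logThreshold lam σ₁) :
    2 ≤ meanConst lam σ₁ * Real.exp (-(1 / 2) * y) := by
  have hexp : 1 ≤ Real.exp (logThreshold lam σ₁ / 2 + -(1 / 2) * y) :=
    Real.one_le_exp (by linarith)
  rw [meanConst, mul_assoc, ← Real.exp_add]
  linarith

lemma two_mul_le_sqrt_log_of_logThreshold_le {l : ℝ} (hσ0 : 0 ≤ σ) (hσ : σ ≤ σ₁)
    (hl : logThreshold lam σ₁ ≤ l) : 2 * σ ≤ √(Real.log l) := by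
  have hexp : Real.exp (4 * σ₁ ^ 2) ≤ l := (le_max_right _ _).trans hl
  have hlog : 4 * σ₁ ^ 2 ≤ Real.log l :=
    (Real.le_log_iff_exp_le ((Real.exp_pos _).trans_le hexp)).2 hexp
  exact Real.le_sqrt_of_sq_le (by nlinarith)

lemma norm_integral_exp_lerchZeta_sub_charFun_le_meanConst {Ω : ℝ} (hα : α ∈ Set.Ioc (0 : ℝ) 1)
    (hind : LinearIndependent ℚ fun n : ℕ => Real.log (n + α)) (hΩ : 0 ≤ Ω) (hθ : 0 < θ)
    (hδ : 0 < δ) (hθδ : θ + δ < 1 / 4) (hT : 0 < T) (hl : LargeEnough α θ δ Ω (Real.log T))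
    (hσ : σ ∈ Set.Icc (1 / 2 + Real.log T ^ (-θ)) σ₁) {v : ℂ} (hv : ‖v‖ ≤ 2 * Real.log T ^ δ)
    {φ : ProbabilityMeasure ℂ} (hφ : Tendsto (partialConv σ α) atTop (𝓝 φ)) :
    ‖∫ t : ℝ, Complex.exp ((⟪lerchZeta lam α (σ + t * I), v⟫ : ℝ) * I) ∂uniformAverage T
        - charFun (φ : Measure ℂ) v‖
      ≤ meanConst lam σ₁ * Real.exp (-(1 / 2) * Real.log T ^ (θ / 2)) := by
  have := isProbabilityMeasure_uniformAverage hT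
  have hlog : 0 < Real.log T := by linarith [hl.three_le]
  rcases le_total (logThreshold lam σ₁) (Real.log T) with hlarge | hsmall
  · have hσ0 : 0 ≤ σ := by linarith [hσ.1, Real.rpow_pos_of_pos hlog (-θ)]
    have hkey := norm_integral_exp_lerchZeta_sub_charFun_le_exp hα hind hΩ hθ hδ hθδ hl
      ((le_max_left _ _).trans hlarge) hσ.1 (two_mul_le_sqrt_log_of_logThreshold_le hσ0 hσ.2 hlarge)
      hv hφ
    rw [Real.exp_log hT] at hkey
    exact hkey.trans (le_mul_of_one_le_left (Real.exp_pos _).le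
      (one_le_two.trans (two_le_meanConst lam σ₁)))
  · refine ((norm_sub_le _ _).trans ?_).trans (two_le_meanConst_mul_exp
      (by linarith [hl.rpow_half_le]) hsmall)
    linarith [norm_charFun_le_one (μ := (φ : Measure ℂ)) v, norm_integral_exp_inner_le_one
      (μ := uniformAverage T) (fun t : ℝ => lerchZeta lam α (σ + t * I)) v]

lemma exists_largeEnough_log (α θ δ : ℝ) :
    ∃ T₀ > 0, α ∈ admissibleSet → 0 < θ → 0 < δ → θ + δ < 1 / 4 →
      ∃ Ω ≥ 0, ∀ T ≥ T₀, LargeEnough α θ δ Ω (Real.log T) := by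
  by_cases h : α ∈ admissibleSet ∧ 0 < θ ∧ 0 < δ ∧ θ + δ < 1 / 4
  · obtain ⟨⟨-, -, Ω, hΩ, hspaced⟩, hθ, hδ, hθδ⟩ := h
    obtain ⟨T₁, hT₁⟩ := eventually_atTop.1
      (Real.tendsto_log_atTop.eventually (eventually_largeEnough hθ hδ hθδ hspaced))
    exact ⟨max T₁ 1, lt_max_of_lt_right one_pos, fun _ _ _ _ =>
      ⟨Ω, hΩ.le, fun T hT => hT₁ T ((le_max_left _ _).trans hT)⟩⟩
  · exact ⟨1, one_pos, fun hα hθ hδ hθδ => (h ⟨hα, hθ, hδ, hθδ⟩).elim⟩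

end MeanValueTheorem

end LerchMean

theorem mainTheorem3 :
    ∃ (C : ℝ → ℝ → ℝ) (T₀ : ℝ → ℝ → ℝ → ℝ),
      (∀ lam σ₁, 0 < C lam σ₁) ∧ (∀ α θ δ, 0 < T₀ α θ δ) ∧
      ∀ (lam α σ₁ θ δ : ℝ), α ∈ LerchMean.admissibleSet → 0 < σ₁ →
        0 < θ → 0 < δ → θ + δ < 1 / 4 →
        ∀ T : ℝ, T₀ α θ δ ≤ T →
        ∀ σ ∈ Set.Icc (1 / 2 + Real.log T ^ (-θ)) σ₁,
        -- the density in the main term is the one it is meant to be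
        LerchMean.IsLimitDensity σ α (LerchMean.densityM σ α) ∧
        ∀ Φ : ℂ → ℂ, LerchMean.ClassLambda Φ →
          ‖(1 / (T : ℂ)) * (∫ t in (0 : ℝ)..T,
                Φ (LerchMean.lerchZeta lam α ((σ : ℂ) + (t : ℂ) * Complex.I)))
              - ∫ z, Φ z * (LerchMean.densityM σ α z : ℂ) ∂LerchMean.dz‖
            ≤ C lam σ₁ *
              (Real.exp (-(1 / 2) * Real.log T ^ (θ / 2)) *
                  (∫ z in LerchMean.squareΩ δ T, ‖LerchMean.fourierT Φ z‖ ∂LerchMean.dz)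
                + ∫ z in (LerchMean.squareΩ δ T)ᶜ, ‖LerchMean.fourierT Φ z‖ ∂LerchMean.dz) := by
  choose T₀ hT₀ hlarge using LerchMean.exists_largeEnough_log
  refine ⟨LerchMean.meanConst, T₀,
    fun lam σ₁ => two_pos.trans_le (LerchMean.two_le_meanConst lam σ₁),
    hT₀, fun lam α σ₁ θ δ hα _ hθ hδ hθδ T hT σ hσ => ?_⟩
  obtain ⟨Ω, hΩ, hΩlarge⟩ := hlarge α θ δ hα hθ hδ hθδ
  have hlog := hΩlarge T hT
  have hTpos : 0 < T := (hT₀ α θ δ).trans_le hT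
  have hσ2 : 1 / 2 < σ := by
    linarith [hσ.1, Real.rpow_pos_of_pos (show 0 < Real.log T by linarith [hlog.three_le]) (-θ)]
  obtain ⟨hα01, hind, -⟩ := hα
  refine ⟨LerchMean.isLimitDensity_densityM hα01.1 hσ2, fun Φ hΦ => ?_⟩
  have hmean := hΦ.norm_mean_lerchZeta_sub_integral_density_le (lam := lam) hα01.1 hσ2 hTpos
    (LerchMean.measurableSet_squareΩ δ T) fun φ hφ w hw =>
      LerchMean.norm_integral_exp_lerchZeta_sub_charFun_le_meanConst hα01 hind hΩ hθ hδ hθδ hTpos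
        hlog hσ (LerchMean.norm_neg_le_of_mem_squareΩ hw) hφ
  rw [mul_add, ← mul_assoc]
  exact hmean.trans (by gcongr; exact LerchMean.two_le_meanConst lam σ₁)
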